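/- Consider pure $SU(3)$ Yang–Mills theory in $n=4+\varepsilon$ dimensions with metric $(+,-,\dots,-)$, $F^a_{\mu\nu}=\partial_\mu A^a_\nu-\partial_\nu A^a_\mu+g f^{abc}A^b_\mu A^c_\nu$, coupling $g=g_r\mu^{-\varepsilon/2}$ ($\mu>0$), gluon propagator $-i\,\frac{\delta^{ab}}{k^2}\bigl(g_{\mu\nu}-(1-\alpha_r)\frac{k_\mu k_\nu}{k^2}\bigr)$ and the standard three- and four-gluon vertices, where $[T^a,T^b]=if^{abc}T^c$, $\operatorname{tr}T^aT^b=\tfrac12\delta^{ab}$. Let $O=\tfrac12\,\Delta^\mu F^a_{\mu\rho}\,\Delta^\nu F_\nu^{a\,\rho}$ with $\Delta^2=0$ (the gauge-invariant energy–momentum tensor contracted with $\Delta$). Take one external gluon of colour $a$, outgoing momentum $p_1$ and polarization $\epsilon_1$, and one of colour $b$, incoming momentum $p_2$ and polarization $\epsilon_2$, with $p_1^2=p_2^2=0$, $\epsilon_1\cdot p_1=\epsilon_2\cdot p_2=0$, and let $O$ be inserted at momentum $Q=p_1-p_2$ with $Q^2=-2p_1\cdot p_2\neq0$. The Born vertex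 is $$\mathcal T^{ab}=-\delta^{ab}\bigl[-\Delta\cdot\epsilon_1\,\Delta\cdot\epsilon_2\;p_1\cdot p_2+\Delta\cdot\epsilon_1\;p_1\cdot\epsilon_2\;\Delta\cdot p_2+\Delta\cdot\epsilon_2\;p_2\cdot\epsilon_1\;\Delta\cdot p_1-\Delta\cdot p_1\,\Delta\cdot p_2\;\epsilon_1\cdot\epsilon_2\bigr].$$ Let $\mathcal A^{ab}_{\alpha_r}(n)$ be the sum of all one-loop one-particle-irreducible diagrams with one insertion of $O$: the triangle with two three-gluon vertices, the bubble with a four-gluon vertex, the two bubbles with the three-gluon vertex of $O$, and the tadpole with the four-gluon vertex of $O$ (the last four with symmetry factor $\tfrac12$). It is taken in dimensional regularization: after Feynman parametrization the momentum integral in $n$ dimensions is expressed by Gamma functions, and the remaining parameter integrals, which converge for $\operatorname{Re}n>8$, are continued analytically in $n$. Then $\mathcal A^{ab}_{\alpha_r}(n)$, defined for $\operatorname{Re} n>8$ and $n$ not an even integer, extends to a meromorphic function of $n\in\mathbb C$ that is the same function $\mathcal A^{ab}(n)$ for all real $\alpha_r$, so that the physical matrix element $\langle O(Q)\rangle=\mathcal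 T^{ab}+\mathcal A^{ab}(4+\varepsilon)$ is independent of the gauge parameter. As $\varepsilon\to0^+$, $$\langle O(Q)\rangle=\mathcal T^{ab}\Bigl\{1+g_r^2C_AS_n\Bigl(-\frac{Q^2}{\mu^2}\Bigr)^{\varepsilon/2}\Bigl[-\frac8{\varepsilon^2}+\frac{-4\gamma_E+22/3}{\varepsilon}+h(2)\Bigr]\Bigr\}$$ $$\qquad+\,\delta^{ab}g_r^2C_AS_n\Bigl(-\frac{Q^2}{\mu^2}\Bigr)^{\varepsilon/2}\Bigl[\epsilon_1\cdot\epsilon_2-\frac{p_1\cdot\epsilon_2\;p_2\cdot\epsilon_1}{p_1\cdot p_2}\Bigr]\Bigl[\tfrac23(\Delta\cdot p_1)^2-\Delta\cdot p_1\,\Delta\cdot p_2+\tfrac23(\Delta\cdot p_2)^2\Bigr]+O(\varepsilon),$$ where $C_A=3$, $S_n=\pi^{n/2}/(2\pi)^n$, $\gamma_E$ is Euler's constant, $h(2)=-\gamma_E^2+\tfrac{11}3\gamma_E+\tfrac{\pi^2}6-\tfrac{203}{18}$, and for $Q^2>0$ the power is that of $-Q^2/\mu^2-i0$. -/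

import Mathlib

open Filter Topology Asymptotics

noncomputable section

namespace GluonOneLoop

/-! ## External kinematics -/

/-- The Minkowski product of signature `(+, -, …, -)`, bilinear (no complex conjugation). -/
def mink {R : Type*} [CommRing R] {d : ℕ} (u v : Fin (d + 1) → R) : R :=
  u 0 * v 0 - ∑ i : Fin d, u i.succ * v i.succ

/-- External data of the two-gluon matrix element: the real momenta `p₁` (flowing out) and `p₂`
(flowing in), the vector `Δ` that the operator is contracted with, and the polarization vectors
`ε₁ = ε(p₁)`, `ε₂ = ε(p₂)`. -/
structure Kinematics (d : ℕ) where
  p₁ : Fin (d + 1) → ℝ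
  p₂ : Fin (d + 1) → ℝ
  Δ : Fin (d + 1) → ℂ
  ε₁ : Fin (d + 1) → ℂ
  ε₂ : Fin (d + 1) → ℂ

variable {d : ℕ}

/-- The five external vectors `p₁, p₂, Δ, ε₁, ε₂`, in this order. -/
def Kinematics.ext (K : Kinematics d) : Fin 5 → Fin (d + 1) → ℂ :=
  ![fun i => (K.p₁ i : ℂ), fun i => (K.p₂ i : ℂ), K.Δ, K.ε₁, K.ε₂]

/-- `Q²` for `Q = p₁ - p₂`, the momentum flowing into the operator vertex. -/
def Kinematics.Qsq (K : Kinematics d) : ℝ := mink (K.p₁ - K.p₂) (K.p₁ - K.p₂)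

/-- Massless on-shell legs with transverse polarizations, light-like `Δ`, and `Q² ≠ 0`. -/
structure Kinematics.OnShell (K : Kinematics d) : Prop where
  p₁_sq : mink K.p₁ K.p₁ = 0
  p₂_sq : mink K.p₂ K.p₂ = 0
  ε₁_p₁ : mink K.ε₁ (K.ext 0) = 0
  ε₂_p₂ : mink K.ε₂ (K.ext 1) = 0
  Δ_sq : mink K.Δ K.Δ = 0
  Q_sq : K.Qsq ≠ 0

/-! ## Colour -/

/-- `T` is a system of generators of `SU(3)`, normalized by `tr (Tᵃ Tᵇ) = δᵃᵇ / 2`. -/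
structure IsSU3Generators (T : Fin 8 → Matrix (Fin 3) (Fin 3) ℂ) : Prop where
  hermitian : ∀ a, (T a).IsHermitian
  traceless : ∀ a, (T a).trace = 0
  normalized : ∀ a b, (T a * T b).trace = if a = b then 1 / 2 else 0

/-- The structure constants, `[Tᵃ, Tᵇ] = i fᵃᵇᶜ Tᶜ`, solved for `fᵃᵇᶜ`. -/
def structureConst (T : Fin 8 → Matrix (Fin 3) (Fin 3) ℂ) (a b c : Fin 8) : ℂ :=
  -2 * Complex.I * ((T a * T b - T b * T a) * T c).trace

/-- `δᵃᵇ`. -/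
def kron (a b : Fin 8) : ℂ := if a = b then 1 else 0

/-- `C_A = N_c = 3`. -/
def CA : ℝ := 3

/-! ## Tensor algebra in `n` dimensions

The vectors that occur are linear combinations of the loop momentum `k` and the external vectors.
The scalars are polynomials in the scalar products that involve `k`:
`X 0` stands for `k²` and `X (i + 1)` for `k · vᵢ`, where `v = (p₁, p₂, Δ, ε₁, ε₂)`. -/

/-- Polynomials in `k²` and `k · vᵢ`. -/
abbrev Poly := MvPolynomial (Fin 6) ℂ

/-- Lorentz vectors, by their coefficients on `k, p₁, p₂, Δ, ε₁, ε₂`. -/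
abbrev LVec := Fin 6 → Poly

/-- Lorentz tensors with two indices: `(c, M)` stands for `c gᵘᵛ + ∑ M i j wᵢᵘ wⱼᵛ`, where
`w = (k, p₁, p₂, Δ, ε₁, ε₂)`. -/
abbrev Tens := Poly × Matrix (Fin 6) (Fin 6) Poly

/-- The table of scalar products of `k, p₁, p₂, Δ, ε₁, ε₂`. -/
def gram (K : Kinematics d) : Matrix (Fin 6) (Fin 6) Poly := Matrix.of fun i j =>
  Fin.cases (motive := fun _ => Poly) (MvPolynomial.X j)
    (fun i' => Fin.cases (motive := fun _ => Poly) (MvPolynomial.X i'.succ)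
      (fun j' => MvPolynomial.C (mink (K.ext i') (K.ext j'))) j) i

/-- The scalar product `u · w`. -/
def dot (K : Kinematics d) (u w : LVec) : Poly := u ⬝ᵥ ((gram K).mulVec w)

/-- The metric tensor `gᵘᵛ`. -/
def metric : Tens := (1, 0)

/-- The tensor `uᵘ wᵛ`. -/
def dyad (u w : LVec) : Tens := (0, Matrix.vecMulVec u w)

/-- The contraction `Aᵘᵖ Bₚᵛ`. -/
def contr (K : Kinematics d) (A B : Tens) : Tens :=
  (A.1 * B.1, A.1 • B.2 + B.1 • A.2 + A.2 * gram K * B.2)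

/-- The contraction `Aᵘᵛ gᵤᵥ` in `n` dimensions, where `gᵘᵛ gᵤᵥ = n`. -/
def tensTrace (K : Kinematics d) (n : ℂ) (A : Tens) : Poly :=
  MvPolynomial.C n * A.1 + (A.2 * gram K).trace

/-- The closed chain `A₁ A₂ ⋯ Aₘ` of contractions. -/
def chain (K : Kinematics d) (n : ℂ) (L : List Tens) : Poly :=
  tensTrace K n (L.foldl (contr K) metric)

def kVec : LVec := Pi.single 0 1
def p₁Vec : LVec := Pi.single 1 1
def p₂Vec : LVec := Pi.single 2 1
def ΔVec : LVec := Pi.single 3 1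
def ε₁Vec : LVec := Pi.single 4 1
def ε₂Vec : LVec := Pi.single 5 1

/-! ## Feynman rules

All momenta flow into the vertices. In vertices with external legs, the indices of these legs are
already contracted with the polarization vectors, and the two remaining indices are open. -/

/-- The numerator over `(q²)^(1 + j)`, `j = 0, 1`, of the gluon propagator
`-i D(q)`, `D(q) = (1 / q²) (gᵘᵛ - (1 - α) qᵘ qᵛ / q²)`. -/
def propNum (α : ℝ) (q : LVec) (j : Fin 2) : Tens :=
  if j = 0 then (-Complex.I : ℂ) • metric
  else (Complex.I * (1 - α) : ℂ) • dyad q q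

/-- The three-gluon vertex (`i` times the Lagrangian vertex)
`g fᵃᵇᶜ [g₁₂ (k₁ - k₂)₃ + g₂₃ (k₂ - k₃)₁ + g₃₁ (k₃ - k₁)₂]`, the first leg contracted with `u`. -/
def gluon3 (K : Kinematics d) (f : Fin 8 → Fin 8 → Fin 8 → ℂ) (g : ℂ) (a b c : Fin 8)
    (u k₁ k₂ k₃ : LVec) : Tens :=
  (g * f a b c : ℂ) •
    (dyad u (k₁ - k₂) + dot K (k₂ - k₃) u • metric + dyad (k₃ - k₁) u)

/-- The four-gluon vertex (`i` times the Lagrangian vertex)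
`-i g² [fᵃᵇᵉ fᶜᵈᵉ (g₁₃ g₂₄ - g₁₄ g₂₃) + fᵃᶜᵉ fᵇᵈᵉ (g₁₂ g₃₄ - g₁₄ g₂₃)
  + fᵃᵈᵉ fᵇᶜᵉ (g₁₂ g₃₄ - g₁₃ g₂₄)]`, the first two legs contracted with `u` and `w`. -/
def gluon4 (K : Kinematics d) (f : Fin 8 → Fin 8 → Fin 8 → ℂ) (g : ℂ) (a b c e : Fin 8)
    (u w : LVec) : Tens :=
  (-Complex.I * g ^ 2 : ℂ) •
    ((∑ x, f a b x * f c e x : ℂ) • (dyad u w - dyad w u)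
      + (∑ x, f a c x * f b e x : ℂ) • (dot K u w • metric - dyad w u)
      + (∑ x, f a e x * f b c x : ℂ) • (dot K u w • metric - dyad u w))

/-- The two-gluon vertex of `O = ½ Δᵘ Fᵤₚ Δᵛ Fᵥᵖ`, both indices open. -/
def op2 (K : Kinematics d) (a b : Fin 8) (k₁ k₂ : LVec) : Tens :=
  (-kron a b : ℂ) •
    (dot K k₁ k₂ • dyad ΔVec ΔVec - dot K ΔVec k₂ • dyad ΔVec k₁
      - dot K ΔVec k₁ • dyad k₂ ΔVec + (dot K ΔVec k₁ * dot K ΔVec k₂) • metric)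

/-- The three-gluon vertex of `O`, the first leg contracted with `u`. -/
def op3 (K : Kinematics d) (f : Fin 8 → Fin 8 → Fin 8 → ℂ) (g : ℂ) (a b c : Fin 8)
    (u k₁ k₂ k₃ : LVec) : Tens :=
  (-Complex.I * g * f a b c : ℂ) •
    (dot K ΔVec u • (dyad k₁ ΔVec - dyad ΔVec k₁)
      + dot K ΔVec k₁ • (dyad ΔVec u - dyad u ΔVec)
      + (dot K ΔVec u • dyad ΔVec k₂ - dot K k₂ u • dyad ΔVec ΔVec)
      + dot K ΔVec k₂ • (dyad u ΔVec - dot K ΔVec u • metric)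
      + (dot K k₃ u • dyad ΔVec ΔVec - dot K ΔVec u • dyad k₃ ΔVec)
      + dot K ΔVec k₃ • (dot K ΔVec u • metric - dyad ΔVec u))

/-- The four-gluon vertex of `O`, the first two legs contracted with `u` and `w`: the sum over the
three ways to split the legs into two pairs of
`g² fᵃᵇˣ fᶜᵉˣ (Δ₁ g₂₊ - Δ₂ g₁₊) (Δ₃ g₄₊ - Δ₄ g₃₊)`, where `+` is a summed index. -/
def op4 (K : Kinematics d) (f : Fin 8 → Fin 8 → Fin 8 → ℂ) (g : ℂ) (a b c e : Fin 8)
    (u w : LVec) : Tens :=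
  (g ^ 2 : ℂ) •
    ((∑ x, f a b x * f c e x : ℂ) •
        (dot K ΔVec u • dyad ΔVec w - dot K ΔVec u • dyad w ΔVec
          - dot K ΔVec w • dyad ΔVec u + dot K ΔVec w • dyad u ΔVec)
      + (∑ x, f a c x * f b e x : ℂ) •
        ((dot K ΔVec u * dot K ΔVec w) • metric - dot K ΔVec u • dyad w ΔVec
          - dot K ΔVec w • dyad ΔVec u + dot K u w • dyad ΔVec ΔVec)
      + (∑ x, f a e x * f c b x : ℂ) •
        (dot K ΔVec u • dyad ΔVec w - (dot K ΔVec u * dot K ΔVec w) • metric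
          - dot K u w • dyad ΔVec ΔVec + dot K ΔVec w • dyad u ΔVec))

/-- The Born vertex `ε₁ᵘ ε₂ᵛ Tᵤᵥᵃᵇ(k₁, k₂, 2)` at `k₁ = -p₁`, `k₂ = p₂`, where `T(k₁, k₂, 2)` is
`-δᵃᵇ [ΔᵤΔᵥ k₁·k₂ - Δᵤ k₁ᵥ Δ·k₂ - Δᵥ k₂ᵤ Δ·k₁ + Δ·k₁ Δ·k₂ gᵤᵥ]`. -/
def born (K : Kinematics d) (a b : Fin 8) : ℂ :=
  -kron a b * (mink K.Δ K.ε₁ * mink K.Δ K.ε₂ * mink (-K.ext 0) (K.ext 1)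
    - mink K.Δ K.ε₁ * mink (-K.ext 0) K.ε₂ * mink K.Δ (K.ext 1)
    - mink K.Δ K.ε₂ * mink (K.ext 1) K.ε₁ * mink K.Δ (-K.ext 0)
    + mink K.Δ (-K.ext 0) * mink K.Δ (K.ext 1) * mink K.ε₁ K.ε₂)

/-! ## Loop integrals in `n` dimensions

After the introduction of Feynman parameters `xᵢ` for the propagators `((k + qᵢ)² + i0)^(-aᵢ)`, the
loop momentum is centred at `k₀ = -∑ xᵢ qᵢ` and the integral over it is Gaussian up to a scale:
with `s = ∑ aᵢ` and `m = k₀² - ∑ xᵢ qᵢ²`,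
`∫ dⁿk / (2π)ⁿ N(k) / ∏ ((k + qᵢ)²)^aᵢ = i (-1)ˢ (4π)^(-n/2) ∏ Γ(aᵢ)⁻¹ ∫ dx δ(1 - ∑ xᵢ) ∏ xᵢ^(aᵢ - 1)
  ∑ᵣ (1 / r!) (-1/4)ʳ Γ(s - r - n/2) (m - i0)^(n/2 + r - s) (□ʳ N)(k₀)`,
where `□` is the d'Alembertian in `n` dimensions with respect to `k`. -/

/-- `(m - i0)^w`. -/
def powI0 (m : ℝ) (w : ℂ) : ℂ :=
  if 0 ≤ m then (m : ℂ) ^ w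
  else ((-m : ℝ) : ℂ) ^ w * Complex.exp (-(Real.pi * Complex.I * w))

/-- The d'Alembertian `∂²/∂k²` in `n` dimensions on polynomials in `k²` and `k · vᵢ`. -/
def box (K : Kinematics d) (n : ℂ) (N : Poly) : Poly :=
  MvPolynomial.C (2 * n) * MvPolynomial.pderiv 0 N
    + 4 * MvPolynomial.X 0 * MvPolynomial.pderiv 0 (MvPolynomial.pderiv 0 N)
    + 4 * ∑ i : Fin 5, MvPolynomial.X i.succ *
        MvPolynomial.pderiv i.succ (MvPolynomial.pderiv 0 N)
    + ∑ i : Fin 5, ∑ j : Fin 5, MvPolynomial.C (mink (K.ext i) (K.ext j)) *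
        MvPolynomial.pderiv i.succ (MvPolynomial.pderiv j.succ N)

/-- The value of a polynomial in `k²` and `k · vᵢ` at `k = k₀`. -/
def evalAt (K : Kinematics d) (k₀ : Fin (d + 1) → ℝ) (N : Poly) : ℂ :=
  MvPolynomial.eval (fun i => Fin.cases (motive := fun _ => ℂ) ((mink k₀ k₀ : ℝ) : ℂ)
    (fun j => mink (fun ν => (k₀ ν : ℂ)) (K.ext j)) i) N

/-- The momentum integral at fixed Feynman parameters:
`∑ᵣ (1 / r!) (-1/4)ʳ Γ(s - r - n/2) (m - i0)^(n/2 + r - s) (□ʳ N)(k₀)`. The sum is finite, as `□`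
lowers the degree in `k` by two. -/
def momentumIntegral (K : Kinematics d) (n : ℂ) (s : ℕ) (k₀ : Fin (d + 1) → ℝ) (m : ℝ)
    (N : Poly) : ℂ :=
  ∑ r ∈ Finset.range (N.totalDegree + 1),
    (-1 / 4 : ℂ) ^ r / (r.factorial : ℂ) * Complex.Gamma (s - r - n / 2)
      * powI0 m (n / 2 + r - s) * evalAt K k₀ ((box K n)^[r] N)

/-- `∫ dⁿk / (2π)ⁿ N(k) / [(k²)^(1 + i) ((k + p₁)²)^(1 + j) ((k + p₂)²)^(1 + l)]`. -/
def triangleIntegral (K : Kinematics d) (n : ℂ) (i j l : ℕ) (N : Poly) : ℂ :=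
  Complex.I * (-1) ^ (i + j + l + 3) * ((4 * Real.pi : ℝ) : ℂ) ^ (-(n / 2))
    / ((i.factorial : ℂ) * (j.factorial : ℂ) * (l.factorial : ℂ)) *
  ∫ y in (0 : ℝ)..1, ∫ z in (0 : ℝ)..(1 - y),
    (((1 - y - z) ^ i * y ^ j * z ^ l : ℝ) : ℂ) *
      (let k₀ := -(y • K.p₁ + z • K.p₂)
       momentumIntegral K n (i + j + l + 3) k₀
        (mink k₀ k₀ - (y * mink K.p₁ K.p₁ + z * mink K.p₂ K.p₂)) N)

/-- `∫ dⁿk / (2π)ⁿ N(k) / [((k + q)²)^(1 + i) ((k + q')²)^(1 + j)]`. -/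
def bubbleIntegral (K : Kinematics d) (n : ℂ) (q q' : Fin (d + 1) → ℝ) (i j : ℕ) (N : Poly) : ℂ :=
  Complex.I * (-1) ^ (i + j + 2) * ((4 * Real.pi : ℝ) : ℂ) ^ (-(n / 2))
    / ((i.factorial : ℂ) * (j.factorial : ℂ)) *
  ∫ x in (0 : ℝ)..1,
    ((x ^ i * (1 - x) ^ j : ℝ) : ℂ) *
      (let k₀ := -(x • q + (1 - x) • q')
       momentumIntegral K n (i + j + 2) k₀
        (mink k₀ k₀ - (x * mink q q + (1 - x) * mink q' q')) N)

/-- `∫ dⁿk / (2π)ⁿ N(k) / (k²)^(1 + i)`. -/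
def tadpoleIntegral (K : Kinematics d) (n : ℂ) (i : ℕ) (N : Poly) : ℂ :=
  Complex.I * (-1) ^ (i + 1) * ((4 * Real.pi : ℝ) : ℂ) ^ (-(n / 2)) / (i.factorial : ℂ) *
    momentumIntegral K n (i + 1) 0 0 N

/-! ## The one-loop diagrams

External legs: colour `a`, incoming momentum `-p₁`, polarization `ε₁`; and colour `b`, incoming
momentum `p₂`, polarization `ε₂`. The operator vertex receives the momentum `Q = p₁ - p₂`. -/

section Diagrams

variable (K : Kinematics d) (f : Fin 8 → Fin 8 → Fin 8 → ℂ) (g : ℂ) (α : ℝ) (n : ℂ) (a b : Fin 8)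

/-- The three-gluon vertex on the external leg `p₁`, joining the lines `k + p₁` (colour `c`) and
`k` (colour `e`). -/
def leg₁ (c e : Fin 8) : Tens :=
  gluon3 K f g a c e ε₁Vec (-p₁Vec) (kVec + p₁Vec) (-kVec)

/-- The three-gluon vertex on the external leg `p₂`, joining the lines `k` (colour `e`) and
`k + p₂` (colour `c`). -/
def leg₂ (e c : Fin 8) : Tens :=
  gluon3 K f g b e c ε₂Vec p₂Vec kVec (-(kVec + p₂Vec))

/-- The triangle: the two-gluon operator vertex and two three-gluon vertices. -/
def diagramB : ℂ :=
  ∑ i : Fin 2, ∑ j : Fin 2, ∑ l : Fin 2,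
    triangleIntegral K n i j l (∑ c, ∑ c', ∑ e, chain K n
      [op2 K c c' (kVec + p₂Vec) (-(kVec + p₁Vec)), propNum α (kVec + p₁Vec) j,
        leg₁ K f g a c' e, propNum α kVec i, leg₂ K f g b e c, propNum α (kVec + p₂Vec) l])

/-- The bubble with the two-gluon operator vertex and the four-gluon vertex, with its symmetry
factor `1/2`. -/
def diagramC : ℂ :=
  1 / 2 * ∑ j : Fin 2, ∑ l : Fin 2,
    bubbleIntegral K n K.p₁ K.p₂ j l (∑ c, ∑ c', chain K n
      [op2 K c c' (kVec + p₂Vec) (-(kVec + p₁Vec)), propNum α (kVec + p₁Vec) j,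
        gluon4 K f g a b c' c ε₁Vec ε₂Vec, propNum α (kVec + p₂Vec) l])

/-- The bubble on the leg `p₁`, with its symmetry factor `1/2`. -/
def diagramD : ℂ :=
  1 / 2 * ∑ i : Fin 2, ∑ j : Fin 2,
    bubbleIntegral K n 0 K.p₁ i j (∑ c, ∑ e, chain K n
      [op3 K f g b e c ε₂Vec p₂Vec kVec (-(kVec + p₁Vec)), propNum α (kVec + p₁Vec) j,
        leg₁ K f g a c e, propNum α kVec i])

/-- The bubble on the leg `p₂`, with its symmetry factor `1/2`. -/
def diagramE : ℂ :=
  1 / 2 * ∑ i : Fin 2, ∑ l : Fin 2,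
    bubbleIntegral K n 0 K.p₂ i l (∑ c, ∑ e, chain K n
      [op3 K f g a c e ε₁Vec (-p₁Vec) (kVec + p₂Vec) (-kVec), propNum α kVec i,
        leg₂ K f g b e c, propNum α (kVec + p₂Vec) l])

/-- The tadpole with the four-gluon operator vertex, with its symmetry factor `1/2`. -/
def diagramF : ℂ :=
  1 / 2 * ∑ i : Fin 2,
    tadpoleIntegral K n i (∑ c, chain K n
      [op4 K f g a b c c ε₁Vec ε₂Vec, propNum α kVec i])

end Diagrams

/-- The coupling `g = g_r μ^((4 - n)/2)` in `n` dimensions. -/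
def coupling (gr μ : ℝ) (n : ℂ) : ℂ := gr * (μ : ℂ) ^ ((4 - n) / 2)

/-- The sum `ε₁ᵘ ε₂ᵛ Aᵤᵥᵃᵇ(-p₁, p₂, 2)` of all one-loop diagrams, as an integral in `n` dimensions.
For massless on-shell legs all the integrals over Feynman parameters converge if `Re n > 8`. -/
def oneLoop (K : Kinematics d) (f : Fin 8 → Fin 8 → Fin 8 → ℂ) (gr μ α : ℝ) (a b : Fin 8)
    (n : ℂ) : ℂ :=
  diagramB K f (coupling gr μ n) α n a b + diagramC K f (coupling gr μ n) α n a b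
    + diagramD K f (coupling gr μ n) α n a b + diagramE K f (coupling gr μ n) α n a b
    + diagramF K f (coupling gr μ n) α n a b

/-- `F` is the analytic continuation in the dimension of the integral `I`: a meromorphic function
on `ℂ` that agrees with `I` where `Re n` is large enough for the integrals over Feynman parameters
to converge. The even integers are poles of the Gamma functions in `I`. -/
def IsDimContinuation (F I : ℂ → ℂ) : Prop :=
  MeromorphicOn F Set.univ ∧
    ∀ n : ℂ, 8 < n.re → (∀ j : ℕ, n ≠ 2 * j) → F n = I n

/-! ## The functions in the result -/

/-- `S_n = π^(n/2) / (2π)ⁿ`. -/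
def Sn (n : ℝ) : ℝ := Real.pi ^ (n / 2) / (2 * Real.pi) ^ n

/-- `γ_gg^(m) / C_A`. -/
def gammagg (m : ℕ) : ℝ :=
  8 / (m + 2) - 8 / (m + 1) + 16 / m - 8 / (m - 1) + 8 * ∑ i ∈ Finset.Icc 1 (m - 1), (1 / i : ℝ)
    - 22 / 3

/-- `S̃(n) = ∑_{l = 1}^n (n choose l) (-1)^(l + 1) / l²`. -/
def STilde (n : ℕ) : ℝ :=
  ∑ l ∈ Finset.Icc 1 n, (n.choose l : ℝ) * (-1) ^ (l + 1) / (l : ℝ) ^ 2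

/-- The finite function `h(m)`, `m ≥ 2`. -/
def h (m : ℕ) : ℝ :=
  -Real.eulerMascheroniConstant ^ 2
    + Real.eulerMascheroniConstant / 2 * (gammagg m + 22 / 3) + Real.pi ^ 2 / 6
    - 8 * STilde (m - 2)
    - 8 * (∑ l ∈ Finset.Icc 1 (m - 1), (1 / l : ℝ)) * (1 / (m + 2) - 1 / (m + 1) + 2 / m)
    - 8 / (m + 2) ^ 2 + 12 / (m + 2) + 8 / (m + 1) ^ 2 - 16 / (m + 1) - 16 / m ^ 2 + 4 / m

/-- `[ε₁·ε₂ - (p₁·ε₂)(p₂·ε₁) / p₁·p₂] [⅔ (Δ·p₁)² - (Δ·p₁)(Δ·p₂) + ⅔ (Δ·p₂)²]`. -/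
def newFormFactor (K : Kinematics d) : ℂ :=
  (mink K.ε₁ K.ε₂
      - mink (K.ext 0) K.ε₂ * mink (K.ext 1) K.ε₁ / mink (K.ext 0) (K.ext 1)) *
    (2 / 3 * mink K.Δ (K.ext 0) ^ 2 - mink K.Δ (K.ext 0) * mink K.Δ (K.ext 1)
      + 2 / 3 * mink K.Δ (K.ext 1) ^ 2)

/-- The common factor `g_r² C_A S_n (-Q²/μ² - i0)^(ε/2)`, `n = 4 + ε`. -/
def loopFactor (K : Kinematics d) (gr μ ε : ℝ) : ℂ :=
  (gr ^ 2 * CA * Sn (4 + ε) : ℝ) * powI0 (-K.Qsq / μ ^ 2) (ε / 2)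

/-- The right-hand side of the result, without the terms that vanish with `ε`. -/
def closedForm (K : Kinematics d) (gr μ : ℝ) (a b : Fin 8) (ε : ℝ) : ℂ :=
  born K a b * (1 + loopFactor K gr μ ε *
      ((-8 / ε ^ 2 + (-4 * Real.eulerMascheroniConstant + 22 / 3) / ε + h 2 : ℝ) : ℂ))
    + kron a b * loopFactor K gr μ ε * newFormFactor K

end GluonOneLoop

end

open GluonOneLoop

/-!
The one-loop amplitude is computed in closed form in `n = 4 + 2 e` dimensions: it is a product
of Gamma functions and powers with a rational function of `e` (`amplitude`, `oneLoop_eq`). This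
function is meromorphic in `n` and does not contain the gauge parameter; its expansion at `e =
0` is the asserted formula.

*Reduction to two diagrams.* The bubbles on the massless external legs and the tadpole are
scaleless and vanish. In the triangle and in the bubble with the four-gluon vertex the operator
vertex is transverse (`contr_op2Core_dyad`, `contr_dyad_op2Core`), so that the longitudinal
parts of the propagators next to it drop out. The longitudinal part of the remaining propagator
of the triangle is reduced by the Ward identity of the three-gluon vertices to a numerator
divisible by the two other denominators (`triangle_trace_longitudinal`); what is left is a
scaleless integral, which is shown to vanish on the level of Feynman parameters
(`longitudinal_zero`). The colour sums are Casimirs, obtained from the completeness relation of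
the generators (`IsSU3Generators.casimir`).

*Integrals.* On shell the Feynman parameter integrals are Dirichlet integrals with exponents
`x`, and `triangleIntegral_eq` and `bubbleIntegral_eq` write them as Gamma functions times a
mean value `loopMean` of the iterated d'Alembertians of the numerator. The d'Alembertian is
evaluated through its product rule `box_mul`, with the carré du champ `gradPair`; the mean value
is linear, and multiplication of its argument by `k²` or `k·vᵢ` shifts the exponents
(`momentMean_X_zero_mul` and its companions). This turns the two Feynman-gauge numerators into
rational functions (`loopMean_triangleNumerator`, `loopMean_bubbleNumerator`).

*Expansion.* The Gamma functions combine to `Γ(1 - e) Γ(1 + e)² / Γ(1 + 2 e)`. To second order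
this needs `Γ'(1) = -γ` and the second-order coefficient of `Γ`, which follows from the
reflection formula (`hasExpansion_Gamma`, `hasExpansion_gammaFactor`). The remaining prefactor
is `loopFactor`.
-/

open Filter Topology Asymptotics

noncomputable section

namespace GluonOneLoop

variable {d : ℕ}

/-! ### Colour -/

section Colour

variable {T : Fin 8 → Matrix (Fin 3) (Fin 3) ℂ}

/-- The generators and the identity are linearly independent, hence, by counting dimensions, a basis
of the `3 × 3` matrices; the coefficients are read off from traces. -/
lemma IsSU3Generators.expansion (hT : IsSU3Generators T) (M : Matrix (Fin 3) (Fin 3) ℂ) :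
    M = (2 : ℂ) • ∑ b, (M * T b).trace • T b + (M.trace / 3) • (1 : Matrix (Fin 3) (Fin 3) ℂ) := by
  classical
  let v : Option (Fin 8) → Matrix (Fin 3) (Fin 3) ℂ := fun o => o.elim 1 T
  have hpair : ∀ (c : Option (Fin 8) → ℂ) (b : Fin 8),
      ((∑ o, c o • v o) * T b).trace = c (some b) / 2 := by
    intro c b
    rw [Fintype.sum_option]
    simp only [v, Option.elim, add_mul, Finset.sum_mul, smul_mul_assoc, Matrix.trace_add,
      Matrix.trace_sum, Matrix.trace_smul, hT.normalized, one_mul, hT.traceless, smul_eq_mul]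
    simp [div_eq_mul_inv]
  have htr : ∀ c : Option (Fin 8) → ℂ, (∑ o, c o • v o).trace = 3 * c none := by
    intro c
    rw [Fintype.sum_option]
    simp [v, Matrix.trace_sum, Matrix.trace_smul, hT.traceless, mul_comm]
  have hli : LinearIndependent ℂ v := by
    rw [Fintype.linearIndependent_iff]
    intro c hc o
    cases o with
    | none => have := htr c; rw [hc] at this; simpa using this
    | some b =>
      have := hpair c b
      rw [hc, zero_mul, Matrix.trace_zero] at this
      linear_combination -2 * this
  have hspan : Submodule.span ℂ (Set.range v) = ⊤ := by
    apply hli.span_eq_top_of_card_eq_finrank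
    simp [Module.finrank_matrix]
  obtain ⟨c, hc⟩ := (Submodule.mem_span_range_iff_exists_fun ℂ).1
    (hspan ▸ Submodule.mem_top : M ∈ Submodule.span ℂ (Set.range v))
  have h1 : ∀ b, (M * T b).trace = c (some b) / 2 := fun b => hc ▸ hpair c b
  have h2 : M.trace = 3 * c none := hc ▸ htr c
  simp only [h1, h2]
  rw [← hc, Fintype.sum_option, Finset.smul_sum]
  simp only [v, Option.elim, smul_smul]
  rw [add_comm]
  congr 1
  · refine Finset.sum_congr rfl fun b _ => ?_
    congr 1; ring
  · congr 1; ring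

/-- The Fierz identity in the form of a sum over sandwiched generators. -/
lemma IsSU3Generators.sum_sandwich (hT : IsSU3Generators T) (M : Matrix (Fin 3) (Fin 3) ℂ) :
    ∑ c, T c * M * T c = (1 / 2 : ℂ) • (M.trace • 1 - (1 / 3 : ℂ) • M) := by
  have key : ∀ i j k l, ∑ c, T c i j * T c k l
      = 1 / 2 * ((if i = l then 1 else 0) * (if j = k then 1 else 0)
        - 1 / 3 * ((if i = j then 1 else 0) * (if k = l then 1 else 0))) := by
    intro i j k l
    have h := congrFun (congrFun (hT.expansion (Matrix.single j i 1)) k) l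
    simp only [Matrix.add_apply, Matrix.smul_apply, Matrix.sum_apply, Matrix.trace_single_mul,
      smul_eq_mul, one_mul] at h
    have hs : (Matrix.single j i (1 : ℂ)) k l
        = (if i = l then 1 else 0) * (if j = k then 1 else 0) := by
      rw [Matrix.single_apply]
      by_cases h1 : i = l <;> by_cases h2 : j = k <;> simp [h1, h2]
    have ht : (Matrix.single j i (1 : ℂ)).trace = if i = j then 1 else 0 := by
      by_cases hij : i = j
      · subst hij; simp
      · rw [Matrix.trace_single_eq_of_ne _ _ _ (Ne.symm hij)]; simp [hij]
    rw [hs, ht, Matrix.one_apply] at h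
    linear_combination (-1 / 2 : ℂ) * h
  ext i l
  simp only [Matrix.sum_apply, Matrix.mul_apply, Finset.sum_mul]
  rw [Finset.sum_comm]
  have : ∀ k, ∑ c, ∑ j, T c i j * M j k * T c k l = ∑ j, M j k * ∑ c, T c i j * T c k l := by
    intro k
    rw [Finset.sum_comm]
    refine Finset.sum_congr rfl fun j _ => ?_
    rw [Finset.mul_sum]
    exact Finset.sum_congr rfl fun c _ => by ring
  simp only [this, key, Matrix.smul_apply, Matrix.sub_apply, Matrix.trace, Matrix.diag,
    Matrix.one_apply, smul_eq_mul]
  simp only [Fin.sum_univ_three]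
  fin_cases i <;> fin_cases l <;> simp <;> ring

lemma structureConst_swap (a b c : Fin 8) :
    structureConst T a c b = -structureConst T a b c := by
  have h1 : (T a * T c * T b).trace = (T b * T a * T c).trace := by
    rw [Matrix.trace_mul_comm, ← Matrix.mul_assoc]
  have h2 : (T c * T a * T b).trace = (T a * T b * T c).trace := by
    rw [Matrix.mul_assoc, Matrix.trace_mul_comm]
  simp only [structureConst, sub_mul, Matrix.trace_sub, h1, h2]
  ring

lemma structureConst_self (a b : Fin 8) : structureConst T a a b = 0 := by
  simp [structureConst]

/-- The quadratic Casimir of the adjoint representation is `C_A = 3`. -/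
lemma IsSU3Generators.casimir (hT : IsSU3Generators T) (a b : Fin 8) :
    ∑ c, ∑ e, structureConst T a c e * structureConst T b c e = 3 * kron a b := by
  have hpair : ∀ X Y : Matrix (Fin 3) (Fin 3) ℂ, X.trace = 0 →
      ∑ e, (X * T e).trace * (Y * T e).trace = 1 / 2 * (X * Y).trace := by
    intro X Y hX
    have h := congrArg (fun Z => (Z * Y).trace) (hT.expansion X)
    simp only [hX, zero_div, zero_smul, add_zero, Finset.smul_sum, Finset.sum_mul,
      Matrix.trace_sum, smul_mul_assoc, Matrix.trace_smul, smul_eq_mul] at h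
    rw [h, Finset.mul_sum]
    refine Finset.sum_congr rfl fun e _ => ?_
    rw [Matrix.trace_mul_comm Y (T e)]; ring
  have hcomm : ∀ X Y : Matrix (Fin 3) (Fin 3) ℂ, (X * Y - Y * X).trace = 0 := by
    intro X Y; rw [Matrix.trace_sub, Matrix.trace_mul_comm, sub_self]
  have h1 : ∀ c, ∑ e, structureConst T a c e * structureConst T b c e
      = -2 * ((T a * T c - T c * T a) * (T b * T c - T c * T b)).trace := by
    intro c
    have := hpair (T a * T c - T c * T a) (T b * T c - T c * T b) (hcomm _ _)
    rw [show (-2 : ℂ) = -4 * (1 / 2) by norm_num, mul_assoc, ← this, Finset.mul_sum]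
    refine Finset.sum_congr rfl fun e _ => ?_
    simp only [structureConst]
    linear_combination (4 * ((T a * T c - T c * T a) * T e).trace
      * ((T b * T c - T c * T b) * T e).trace) * Complex.I_sq
  have h2 : ∀ c, ((T a * T c - T c * T a) * (T b * T c - T c * T b)).trace
      = 2 * (T a * (T c * T b * T c)).trace - (T a * (T c * 1 * T c) * T b).trace
        - (T b * (T c * 1 * T c) * T a).trace := by
    intro c
    simp only [sub_mul, mul_sub, Matrix.trace_sub, Matrix.mul_one, Matrix.mul_assoc]
    rw [Matrix.trace_mul_comm (T c) (T a * (T b * T c)),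
      Matrix.trace_mul_comm (T c) (T a * (T c * T b))]
    simp only [Matrix.mul_assoc]
    rw [Matrix.trace_mul_comm (T a) (T b * (T c * T c))]
    simp only [Matrix.mul_assoc]
    ring
  simp only [h1, h2]
  rw [← Finset.mul_sum, Finset.sum_sub_distrib, Finset.sum_sub_distrib, ← Finset.mul_sum,
    ← Matrix.trace_sum, ← Matrix.trace_sum, ← Matrix.trace_sum, ← Finset.sum_mul, ← Finset.sum_mul,
    ← Finset.mul_sum, ← Finset.mul_sum, ← Finset.mul_sum, hT.sum_sandwich, hT.sum_sandwich]
  have hba : (T b * T a).trace = (T a * T b).trace := Matrix.trace_mul_comm _ _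
  simp [hT.traceless, Matrix.trace_smul, hba, hT.normalized, kron, mul_sub, sub_mul,
    Matrix.trace_sub]
  split_ifs <;> norm_num

end Colour

/-! ### Tensor algebra -/

section Tensors

variable (K : Kinematics d)

/-- The scalar products of the external vectors. -/
def Kinematics.prod (i j : Fin 5) : ℂ := mink (K.ext i) (K.ext j)

lemma mink_comm {R : Type*} [CommRing R] (u v : Fin (d + 1) → R) : mink u v = mink v u := by
  simp only [mink, mul_comm]

lemma gram_transpose : (gram K).transpose = gram K := by
  ext i j : 2
  refine Fin.cases ?_ (fun i => ?_) i <;> refine Fin.cases ?_ (fun j => ?_) j <;>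
    simp [gram, mink_comm]

lemma dot_comm (u w : LVec) : dot K u w = dot K w u := by
  rw [dot, dot, Matrix.dotProduct_mulVec, ← Matrix.mulVec_transpose, gram_transpose,
    dotProduct_comm]

@[simp] lemma dot_add_left (u v w : LVec) : dot K (u + v) w = dot K u w + dot K v w := by
  simp [dot, add_dotProduct]
@[simp] lemma dot_add_right (u v w : LVec) : dot K u (v + w) = dot K u v + dot K u w := by
  simp [dot, Matrix.mulVec_add]
@[simp] lemma dot_neg_left (u w : LVec) : dot K (-u) w = -dot K u w := by
  simp [dot]
@[simp] lemma dot_neg_right (u w : LVec) : dot K u (-w) = -dot K u w := by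
  simp [dot, Matrix.mulVec_neg]
@[simp] lemma dot_sub_left (u v w : LVec) : dot K (u - v) w = dot K u w - dot K v w := by
  simp [dot, sub_dotProduct]
@[simp] lemma dot_sub_right (u v w : LVec) : dot K u (v - w) = dot K u v - dot K u w := by
  simp [dot, Matrix.mulVec_sub]

lemma dot_single (i j : Fin 6) : dot K (Pi.single i 1) (Pi.single j 1) = gram K i j := by
  simp [dot]

lemma contr_add_left (A B D : Tens) : contr K (A + B) D = contr K A D + contr K B D := by
  ext1
  · simp [contr, add_mul]
  · simp only [contr, Prod.fst_add, Prod.snd_add, add_smul, smul_add, add_mul]; abel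

lemma contr_add_right (A B D : Tens) : contr K A (B + D) = contr K A B + contr K A D := by
  ext1
  · simp [contr, mul_add]
  · simp only [contr, Prod.fst_add, Prod.snd_add, add_smul, smul_add, mul_add]; abel

lemma contr_smul_left (p : Poly) (A B : Tens) : contr K (p • A) B = p • contr K A B := by
  ext1
  · simp [contr, mul_assoc]
  · simp [contr, smul_smul, mul_comm]

lemma contr_smul_right (p : Poly) (A B : Tens) : contr K A (p • B) = p • contr K A B := by
  ext1
  · simp [contr]; ring
  · simp [contr, smul_smul, mul_comm]

lemma complex_smul_tens (c : ℂ) (A : Tens) : c • A = (MvPolynomial.C c : Poly) • A := by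
  ext1
  · simp [MvPolynomial.smul_eq_C_mul]
  · ext i j : 2; simp [MvPolynomial.smul_eq_C_mul]

@[simp] lemma contr_metric_left (A : Tens) : contr K metric A = A := by
  ext1 <;> simp [contr, metric]

@[simp] lemma contr_metric_right (A : Tens) : contr K A metric = A := by
  ext1 <;> simp [contr, metric]

lemma contr_assoc (A B D : Tens) : contr K (contr K A B) D = contr K A (contr K B D) := by
  ext1
  · simp [contr, mul_assoc]
  · simp only [contr, smul_add, smul_smul, add_mul, mul_add, Matrix.smul_mul, Matrix.mul_smul,
      Matrix.mul_assoc]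
    rw [mul_comm D.1 A.1, mul_comm D.1 B.1]
    abel

@[simp] lemma contr_zero_left (A : Tens) : contr K 0 A = 0 := by ext1 <;> simp [contr]

lemma contr_dyad_dyad (u v w x : LVec) :
    contr K (dyad u v) (dyad w x) = dot K v w • dyad u x := by
  ext1
  · simp [contr, dyad]
  · simp only [contr, dyad, zero_smul, zero_add, Prod.smul_snd]
    rw [Matrix.vecMulVec_mul, Matrix.vecMulVec_mul_vecMulVec, dot, Matrix.dotProduct_mulVec,
      Matrix.vecMulVec_smul]

lemma tensTrace_add (n : ℂ) (A B : Tens) :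
    tensTrace K n (A + B) = tensTrace K n A + tensTrace K n B := by
  simp only [tensTrace, Prod.fst_add, Prod.snd_add, add_mul, mul_add, Matrix.trace_add]; ring

lemma tensTrace_smul (n : ℂ) (p : Poly) (A : Tens) :
    tensTrace K n (p • A) = p * tensTrace K n A := by
  simp only [tensTrace, Prod.smul_fst, Prod.smul_snd, smul_eq_mul, Matrix.smul_mul,
    Matrix.trace_smul]; ring

@[simp] lemma tensTrace_zero (n : ℂ) : tensTrace K n 0 = 0 := by simp [tensTrace]

lemma tensTrace_dyad (n : ℂ) (u v : LVec) : tensTrace K n (dyad u v) = dot K u v := by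
  simp only [tensTrace, dyad, mul_zero, zero_add]
  rw [Matrix.vecMulVec_mul, Matrix.trace_vecMulVec, ← Matrix.mulVec_transpose, gram_transpose, dot]

lemma tensTrace_metric (n : ℂ) : tensTrace K n metric = MvPolynomial.C n := by
  simp [tensTrace, metric]

/-- Cyclicity of the trace. -/
lemma tensTrace_contr_comm (n : ℂ) (A B : Tens) :
    tensTrace K n (contr K A B) = tensTrace K n (contr K B A) := by
  simp only [tensTrace, contr, add_mul, Matrix.trace_add, Matrix.smul_mul, Matrix.trace_smul]
  have : (A.2 * gram K * B.2 * gram K).trace = (B.2 * gram K * A.2 * gram K).trace := by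
    rw [Matrix.mul_assoc, Matrix.trace_mul_comm, Matrix.mul_assoc, Matrix.mul_assoc]
    simp only [Matrix.mul_assoc]
  rw [this, mul_comm A.1 B.1]
  ring

end Tensors

/-! ### The numerators of the diagrams -/

section Numerators

open MvPolynomial

variable (K : Kinematics d)

lemma Kinematics.prod_comm (i j : Fin 5) : K.prod i j = K.prod j i := mink_comm _ _

lemma mink_ofReal (u v : Fin (d + 1) → ℝ) :
    mink (fun i => (u i : ℂ)) (fun i => (v i : ℂ)) = ((mink u v : ℝ) : ℂ) := by
  simp [mink]

variable {K}

lemma Kinematics.OnShell.prod_zero_zero (hK : K.OnShell) : K.prod 0 0 = 0 := by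
  simp [Kinematics.prod, Kinematics.ext, mink_ofReal, hK.p₁_sq]
lemma Kinematics.OnShell.prod_one_one (hK : K.OnShell) : K.prod 1 1 = 0 := by
  simp [Kinematics.prod, Kinematics.ext, mink_ofReal, hK.p₂_sq]
lemma Kinematics.OnShell.prod_two_two (hK : K.OnShell) : K.prod 2 2 = 0 := hK.Δ_sq
lemma Kinematics.OnShell.prod_zero_three (hK : K.OnShell) : K.prod 0 3 = 0 := by
  rw [K.prod_comm]; exact hK.ε₁_p₁
lemma Kinematics.OnShell.prod_one_four (hK : K.OnShell) : K.prod 1 4 = 0 := by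
  rw [K.prod_comm]; exact hK.ε₂_p₂

/-- The table of scalar products on shell. -/
lemma Kinematics.OnShell.gram_eq (hK : K.OnShell) : gram K = Matrix.of
    ![![X 0, X 1, X 2, X 3, X 4, X 5],
      ![X 1, 0, C (K.prod 0 1), C (K.prod 0 2), 0, C (K.prod 0 4)],
      ![X 2, C (K.prod 0 1), 0, C (K.prod 1 2), C (K.prod 1 3), 0],
      ![X 3, C (K.prod 0 2), C (K.prod 1 2), 0, C (K.prod 2 3), C (K.prod 2 4)],
      ![X 4, 0, C (K.prod 1 3), C (K.prod 2 3), C (K.prod 3 3), C (K.prod 3 4)],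
      ![X 5, C (K.prod 0 4), 0, C (K.prod 2 4), C (K.prod 3 4), C (K.prod 4 4)]] := by
  have h : ∀ i j : Fin 5, gram K i.succ j.succ = C (K.prod i j) := fun i j => rfl
  have h00 := hK.prod_zero_zero
  have h11 := hK.prod_one_one
  have h22 := hK.prod_two_two
  have h03 := hK.prod_zero_three
  have h14 := hK.prod_one_four
  have h30 := (K.prod_comm 3 0).trans h03
  have h41 := (K.prod_comm 4 1).trans h14
  ext1 i j
  refine Fin.cases ?_ (fun i => ?_) i <;> refine Fin.cases ?_ (fun j => ?_) j
  · rfl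
  · fin_cases j <;> rfl
  · fin_cases i <;> rfl
  · rw [h]
    fin_cases i <;> fin_cases j <;> simp [h00, h11, h22, h03, h14, h30, h41] <;>
      exact K.prod_comm _ _

variable (K)

/-- The two-gluon vertex of the operator without its colour factor. -/
def op2Core (k₁ k₂ : LVec) : Tens :=
  dot K k₁ k₂ • dyad ΔVec ΔVec - dot K ΔVec k₂ • dyad ΔVec k₁
    - dot K ΔVec k₁ • dyad k₂ ΔVec + (dot K ΔVec k₁ * dot K ΔVec k₂) • metric

/-- The three-gluon vertex without colour and coupling. -/
def gluon3Core (u k₁ k₂ k₃ : LVec) : Tens :=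
  dyad u (k₁ - k₂) + dot K (k₂ - k₃) u • metric + dyad (k₃ - k₁) u

lemma op2_eq (a b : Fin 8) (k₁ k₂ : LVec) :
    op2 K a b k₁ k₂ = (C (-kron a b) : Poly) • op2Core K k₁ k₂ := by
  rw [op2, complex_smul_tens]; rfl

lemma gluon3_eq (f : Fin 8 → Fin 8 → Fin 8 → ℂ) (g : ℂ) (a b c : Fin 8) (u k₁ k₂ k₃ : LVec) :
    gluon3 K f g a b c u k₁ k₂ k₃ = (C (g * f a b c) : Poly) • gluon3Core K u k₁ k₂ k₃ := by
  rw [gluon3, complex_smul_tens]; rfl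

lemma propNum_zero (α : ℝ) (q : LVec) :
    propNum α q 0 = (C (-Complex.I) : Poly) • metric := by
  simp [propNum, complex_smul_tens]

lemma propNum_one (α : ℝ) (q : LVec) :
    propNum α q 1 = (C (Complex.I * (1 - α)) : Poly) • dyad q q := by
  simp [propNum, complex_smul_tens]

lemma tens_sub_eq (A B : Tens) : A - B = A + (-1 : Poly) • B := by
  rw [neg_one_smul, sub_eq_add_neg]

lemma dyad_neg_left (u w : LVec) : dyad (-u) w = (-1 : Poly) • dyad u w := by
  ext1 <;> simp [dyad, Matrix.neg_vecMulVec]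

/-- The operator vertex is transverse in its second leg. -/
lemma contr_op2Core_dyad (k q w : LVec) : contr K (op2Core K k (-q)) (dyad q w) = 0 := by
  simp only [op2Core, tens_sub_eq, contr_add_left, contr_smul_left, contr_dyad_dyad,
    contr_metric_left, dot_neg_right, dyad_neg_left, smul_smul]
  module

/-- The operator vertex is transverse in its first leg. -/
lemma contr_dyad_op2Core (k q w : LVec) : contr K (dyad w q) (op2Core K q k) = 0 := by
  simp only [op2Core, tens_sub_eq, contr_add_right, contr_smul_right, contr_dyad_dyad,
    contr_metric_right, smul_smul]
  simp only [dot_comm K q]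
  module

/-- The numerator of the triangle with three Feynman-gauge propagators, without colour factors. The
abbreviations are `s = p₁·p₂`, `dᵢ = pᵢ·Δ`, `a = p₂·ε₁`, `b = p₁·ε₂`, `u = Δ·ε₁`, `v = Δ·ε₂` and
`w = ε₁·ε₂`. -/
def triangleNumerator (n : ℂ) : Poly :=
  let s : Poly := C (K.prod 0 1)
  let d₁ : Poly := C (K.prod 0 2)
  let d₂ : Poly := C (K.prod 1 2)
  let a : Poly := C (K.prod 1 3)
  let b : Poly := C (K.prod 0 4)
  let u : Poly := C (K.prod 2 3)
  let v : Poly := C (K.prod 2 4)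
  let w : Poly := C (K.prod 3 4)
  u * v * (-X 0 ^ 2 - 3 * X 0 * (X 1 + X 2) - 5 * s * X 0 - 2 * (X 1 + X 2) ^ 2
      - 6 * s * (X 1 + X 2) - 4 * s ^ 2)
  - w * ((X 0 + 2 * X 1 + 2 * X 2 + 8 * s) * X 3 ^ 2
      + ((X 0 + 4 * s) * (d₁ + d₂) + 2 * (X 1 - X 2) * (d₁ - d₂)) * X 3
      + (5 * X 0 + 2 * X 1 + 2 * X 2 + 4 * s) * d₁ * d₂)
  + v * ((X 0 + 2 * X 1 + 2 * X 2 + 8 * s) * X 3 * X 4 + (X 0 - 2 * X 1 + 2 * X 2) * a * X 3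
      + ((X 0 + 2 * X 1 - 2 * X 2) * d₁ + 4 * d₂ * X 2 + 4 * s * (d₁ + d₂)) * X 4
      + (5 * X 0 + 2 * X 1 + 6 * X 2 + 4 * s) * d₁ * a)
  + u * ((X 0 + 2 * X 1 + 2 * X 2 + 8 * s) * X 3 * X 5 + (X 0 + 2 * X 1 - 2 * X 2) * b * X 3
      + ((X 0 - 2 * X 1 + 2 * X 2) * d₂ + 4 * d₁ * X 1 + 4 * s * (d₁ + d₂)) * X 5
      + (5 * X 0 + 6 * X 1 + 2 * X 2 + 4 * s) * d₂ * b)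
  + X 4 * X 5 * ((8 - 4 * C n) * (X 3 ^ 2 + (d₁ + d₂) * X 3)
      + (16 - 4 * C n) * d₁ * d₂ - 4 * d₁ ^ 2 - 4 * d₂ ^ 2)
  + 8 * a * b * X 3 ^ 2 + 4 * (d₁ + d₂) * a * b * X 3
  - 4 * d₂ * b * X 4 * (2 * X 3 + d₁ + d₂) - 4 * d₁ * a * X 5 * (2 * X 3 + d₁ + d₂)

/-- The numerator of the bubble with the four-gluon vertex, without colour factors. -/
def bubbleNumerator (n : ℂ) : Poly :=
  let s : Poly := C (K.prod 0 1)
  let d₁ : Poly := C (K.prod 0 2)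
  let d₂ : Poly := C (K.prod 1 2)
  let a : Poly := C (K.prod 1 3)
  let b : Poly := C (K.prod 0 4)
  let u : Poly := C (K.prod 2 3)
  let v : Poly := C (K.prod 2 4)
  let w : Poly := C (K.prod 3 4)
  2 * u * v * (X 0 + X 1 + X 2 + s) + (6 - 2 * C n) * w * (X 3 + d₁) * (X 3 + d₂)
    - v * (2 * X 3 * X 4 + a * X 3 + (d₁ + d₂) * X 4 + d₁ * a)
    - u * (2 * X 3 * X 5 + b * X 3 + (d₁ + d₂) * X 5 + d₂ * b)

/-- `ε₂ · V · ε₁` for the two-gluon operator vertex `V` on the lines `k + p₂` and `k + p₁`. -/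
def operatorForm : Poly :=
  let s : Poly := C (K.prod 0 1)
  let d₁ : Poly := C (K.prod 0 2)
  let d₂ : Poly := C (K.prod 1 2)
  let a : Poly := C (K.prod 1 3)
  let b : Poly := C (K.prod 0 4)
  let u : Poly := C (K.prod 2 3)
  let v : Poly := C (K.prod 2 4)
  let w : Poly := C (K.prod 3 4)
  v * (X 3 + d₁) * (X 4 + a) + u * (X 3 + d₂) * (X 5 + b)
    - w * (X 3 + d₁) * (X 3 + d₂) - u * v * (X 0 + X 1 + X 2 + s)

variable {K}

lemma triangle_trace (hK : K.OnShell) (n : ℂ) :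
    tensTrace K n (contr K (contr K (op2Core K (kVec + p₂Vec) (-(kVec + p₁Vec)))
      (gluon3Core K ε₁Vec (-p₁Vec) (kVec + p₁Vec) (-kVec)))
      (gluon3Core K ε₂Vec p₂Vec kVec (-(kVec + p₂Vec)))) = triangleNumerator K n := by
  simp only [op2Core, gluon3Core, tens_sub_eq, contr_add_left, contr_smul_left, contr_dyad_dyad,
    contr_metric_left, contr_add_right, contr_smul_right, contr_metric_right, tensTrace_add,
    tensTrace_smul, tensTrace_dyad, tensTrace_metric, smul_add, dot_add_left, dot_add_right,
    dot_neg_left, dot_neg_right, dot_sub_left, dot_sub_right]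
  simp only [kVec, p₁Vec, p₂Vec, ΔVec, ε₁Vec, ε₂Vec, dot_single, hK.gram_eq]
  simp [triangleNumerator]
  ring

lemma bubble_trace (hK : K.OnShell) (n : ℂ) :
    tensTrace K n (contr K (op2Core K (kVec + p₂Vec) (-(kVec + p₁Vec)))
      ((2 : Poly) • (dot K ε₁Vec ε₂Vec • metric) - dyad ε₁Vec ε₂Vec - dyad ε₂Vec ε₁Vec))
      = bubbleNumerator K n := by
  simp only [op2Core, tens_sub_eq, contr_add_left, contr_smul_left, contr_dyad_dyad,
    contr_metric_left, contr_add_right, contr_smul_right, contr_metric_right, tensTrace_add,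
    tensTrace_smul, tensTrace_dyad, tensTrace_metric, smul_add, dot_add_left, dot_add_right,
    dot_neg_left, dot_neg_right]
  simp only [kVec, p₁Vec, p₂Vec, ΔVec, ε₁Vec, ε₂Vec, dot_single, hK.gram_eq]
  simp [bubbleNumerator]
  ring

/-- With the longitudinal part `k ⊗ k` of the propagator between the two three-gluon vertices, the
Ward identity turns the triangle numerator into a multiple of `(k + p₁)² (k + p₂)²`. -/
lemma triangle_trace_longitudinal (hK : K.OnShell) (n : ℂ) :
    tensTrace K n (contr K (contr K (contr K (op2Core K (kVec + p₂Vec) (-(kVec + p₁Vec)))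
      (gluon3Core K ε₁Vec (-p₁Vec) (kVec + p₁Vec) (-kVec))) (dyad kVec kVec))
      (gluon3Core K ε₂Vec p₂Vec kVec (-(kVec + p₂Vec))))
      = (X 0 + 2 * X 1) * (X 0 + 2 * X 2) * operatorForm K := by
  simp only [op2Core, gluon3Core, tens_sub_eq, contr_add_left, contr_smul_left, contr_dyad_dyad,
    contr_metric_left, contr_add_right, contr_smul_right, contr_metric_right, tensTrace_add,
    tensTrace_smul, tensTrace_dyad, smul_add, dot_add_left, dot_add_right,
    dot_neg_left, dot_neg_right, dot_sub_left, dot_sub_right]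
  simp only [kVec, p₁Vec, p₂Vec, ΔVec, ε₁Vec, ε₂Vec, dot_single, hK.gram_eq]
  simp [operatorForm]
  ring

end Numerators

/-! ### Reduction of the diagrams to two Feynman-gauge integrals -/

section Diagrams

open MvPolynomial

variable (K : Kinematics d)

lemma box_zero (n : ℂ) : box K n 0 = 0 := by simp [box]

lemma iterate_box_zero (n : ℂ) (r : ℕ) : (box K n)^[r] 0 = 0 :=
  Function.iterate_fixed (box_zero K n) r

lemma momentumIntegral_zero (n : ℂ) (s : ℕ) (k₀ : Fin (d + 1) → ℝ) (m : ℝ) :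
    momentumIntegral K n s k₀ m 0 = 0 := by
  simp [momentumIntegral, iterate_box_zero, evalAt]

lemma triangleIntegral_zero (n : ℂ) (i j l : ℕ) : triangleIntegral K n i j l 0 = 0 := by
  simp [triangleIntegral, momentumIntegral_zero]

lemma bubbleIntegral_zero (n : ℂ) (q q' : Fin (d + 1) → ℝ) (i j : ℕ) :
    bubbleIntegral K n q q' i j 0 = 0 := by
  simp [bubbleIntegral, momentumIntegral_zero]

/-- Scaleless momentum integrals vanish. -/
lemma momentumIntegral_scaleless {n : ℂ} (hn : 0 < n.re) (hn' : ∀ j : ℕ, n ≠ 2 * j) (s : ℕ)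
    (k₀ : Fin (d + 1) → ℝ) (N : Poly) : momentumIntegral K n s k₀ 0 N = 0 := by
  refine Finset.sum_eq_zero fun r _ => ?_
  have hw : n / 2 + r - s ≠ 0 := by
    intro h
    have h1 : n = 2 * ((s : ℂ) - r) := by linear_combination 2 * h
    rcases le_total r s with hrs | hrs
    · exact hn' (s - r) (by rw [h1, Nat.cast_sub hrs])
    · rw [h1, ← neg_sub, ← Nat.cast_sub hrs] at hn
      simp at hn
      have : (0 : ℝ) ≤ ((r - s : ℕ) : ℝ) := Nat.cast_nonneg _
      linarith
  simp [powI0, Complex.zero_cpow hw]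

variable {K}

lemma mink_smul_smul {R : Type*} [CommRing R] (x y : R) (u v : Fin (d + 1) → R) :
    mink (x • u) (y • v) = x * y * mink u v := by
  simp only [mink, Pi.smul_apply, smul_eq_mul, mul_sub, Finset.mul_sum]
  congr 1
  · ring
  · exact Finset.sum_congr rfl fun i _ => by ring

lemma mink_zero {R : Type*} [CommRing R] (v : Fin (d + 1) → R) : mink 0 v = 0 := by
  simp [mink]

lemma bubbleIntegral_null {n : ℂ} (hn : 0 < n.re) (hn' : ∀ j : ℕ, n ≠ 2 * j)
    {p : Fin (d + 1) → ℝ} (hp : mink p p = 0) (i j : ℕ) (N : Poly) :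
    bubbleIntegral K n 0 p i j N = 0 := by
  have : ∀ x : ℝ, mink (-(x • (0 : Fin (d + 1) → ℝ) + (1 - x) • p))
      (-(x • (0 : Fin (d + 1) → ℝ) + (1 - x) • p))
      - (x * mink (0 : Fin (d + 1) → ℝ) 0 + (1 - x) * mink p p) = 0 := by
    intro x
    rw [smul_zero, zero_add, ← neg_smul, mink_smul_smul, hp, mink_zero]; ring
  simp only [bubbleIntegral, this, momentumIntegral_scaleless K hn hn', mul_zero,
    intervalIntegral.integral_zero]

lemma tadpoleIntegral_eq_zero {n : ℂ} (hn : 0 < n.re) (hn' : ∀ j : ℕ, n ≠ 2 * j) (i : ℕ)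
    (N : Poly) : tadpoleIntegral K n i N = 0 := by
  simp [tadpoleIntegral, momentumIntegral_scaleless K hn hn']

section

variable (f : Fin 8 → Fin 8 → Fin 8 → ℂ) (g : ℂ) (α : ℝ) (n : ℂ) (a b : Fin 8)

/-- The bubble on an external leg depends on no scale, since the leg is massless. -/
lemma diagramD_eq_zero (hK : K.OnShell) (hn : 0 < n.re) (hn' : ∀ j : ℕ, n ≠ 2 * j) :
    diagramD K f g α n a b = 0 := by
  simp [diagramD, bubbleIntegral_null hn hn' hK.p₁_sq]

lemma diagramE_eq_zero (hK : K.OnShell) (hn : 0 < n.re) (hn' : ∀ j : ℕ, n ≠ 2 * j) :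
    diagramE K f g α n a b = 0 := by
  simp [diagramE, bubbleIntegral_null hn hn' hK.p₂_sq]

lemma diagramF_eq_zero (hn : 0 < n.re) (hn' : ∀ j : ℕ, n ≠ 2 * j) :
    diagramF K f g α n a b = 0 := by
  simp [diagramF, tadpoleIntegral_eq_zero hn hn']

variable {f}

/-- Summing the colours of the triangle. -/
lemma sum_triangle_colour (hswap : ∀ a b c, f a c b = -f a b c)
    (hcas : ∑ c, ∑ e, f a c e * f b c e = 3 * kron a b) (z : ℂ) (N : Poly) :
    ∑ c, ∑ c', ∑ e, (C (z * (kron c c' * f a c' e * f b e c)) : Poly) * N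
      = C (-(3 * z * kron a b)) * N := by
  simp only [← Finset.sum_mul, ← map_sum, ← Finset.mul_sum]
  congr 2
  have : ∀ c, ∑ c', ∑ e, kron c c' * f a c' e * f b e c = -∑ e, f a c e * f b c e := by
    intro c
    rw [Finset.sum_eq_single c, ← Finset.sum_neg_distrib]
    · refine Finset.sum_congr rfl fun e _ => ?_
      rw [hswap b c e]; simp [kron]
    · intro c' _ h
      simp [kron, h.symm]
    · simp
  simp only [this, Finset.sum_neg_distrib, hcas]
  ring

/-- Only the longitudinal part of the propagator between the two three-gluon vertices couples; the
operator vertex annihilates those of the other two. -/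
lemma diagramB_eq (hK : K.OnShell) (hswap : ∀ a b c, f a c b = -f a b c)
    (hcas : ∑ c, ∑ e, f a c e * f b c e = 3 * kron a b) :
    diagramB K f g α n a b
      = triangleIntegral K n 0 0 0
          (C (3 * Complex.I * g ^ 2 * kron a b) * triangleNumerator K n)
        + triangleIntegral K n 1 0 0 (C (-(3 * Complex.I * (1 - α) * g ^ 2 * kron a b))
          * ((X 0 + 2 * X 1) * (X 0 + 2 * X 2) * operatorForm K)) := by
  have hc : ∀ c c' e (A₁ A₂ A₃ : Tens) , chain K n
      [op2 K c c' (kVec + p₂Vec) (-(kVec + p₁Vec)), A₁, leg₁ K f g a c' e, A₂,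
        leg₂ K f g b e c, A₃]
      = C (-g ^ 2 * (kron c c' * f a c' e * f b e c)) * tensTrace K n (contr K (contr K (contr K
        (contr K (contr K (op2Core K (kVec + p₂Vec) (-(kVec + p₁Vec))) A₁)
        (gluon3Core K ε₁Vec (-p₁Vec) (kVec + p₁Vec) (-kVec))) A₂)
        (gluon3Core K ε₂Vec p₂Vec kVec (-(kVec + p₂Vec)))) A₃) := by
    intro c c' e A₁ A₂ A₃
    simp only [chain, List.foldl, contr_metric_left, op2_eq, leg₁, leg₂, gluon3_eq,
      contr_smul_left, contr_smul_right, tensTrace_smul]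
    simp only [← mul_assoc, ← map_mul]
    congr 2
    ring
  have h1 : ∀ z : ℂ, ∀ A₂ A₃ : Tens, ∀ q : LVec, q = kVec + p₁Vec → ∀ c c' e, chain K n
      [op2 K c c' (kVec + p₂Vec) (-(kVec + p₁Vec)), (C z : Poly) • dyad q q,
        leg₁ K f g a c' e, A₂, leg₂ K f g b e c, A₃] = 0 := by
    rintro z A₂ A₃ q rfl c c' e
    simp only [hc, contr_smul_right, contr_op2Core_dyad, smul_zero, contr_zero_left,
      tensTrace_zero, mul_zero]
  have h2 : ∀ z : ℂ, ∀ A₁ A₂ : Tens, ∀ q : LVec, q = kVec + p₂Vec → ∀ c c' e, chain K n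
      [op2 K c c' (kVec + p₂Vec) (-(kVec + p₁Vec)), A₁,
        leg₁ K f g a c' e, A₂, leg₂ K f g b e c, (C z : Poly) • dyad q q] = 0 := by
    rintro z A₁ A₂ q rfl c c' e
    rw [hc, tensTrace_contr_comm]
    simp [← contr_assoc, contr_smul_left, contr_dyad_op2Core]
  have h0 : ∀ c c' e, chain K n
      [op2 K c c' (kVec + p₂Vec) (-(kVec + p₁Vec)), (C (-Complex.I) : Poly) • metric,
        leg₁ K f g a c' e, (C (-Complex.I) : Poly) • metric, leg₂ K f g b e c,
        (C (-Complex.I) : Poly) • metric]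
      = C (-Complex.I * g ^ 2 * (kron c c' * f a c' e * f b e c)) * triangleNumerator K n := by
    intro c c' e
    simp only [hc, contr_smul_left, contr_smul_right, contr_metric_right, tensTrace_smul,
      triangle_trace hK, ← mul_assoc, ← map_mul]
    congr 2
    linear_combination (g ^ 2 * Complex.I * (kron c c' * f a c' e * f b e c)) * Complex.I_sq
  have h3 : ∀ c c' e, chain K n
      [op2 K c c' (kVec + p₂Vec) (-(kVec + p₁Vec)), (C (-Complex.I) : Poly) • metric,
        leg₁ K f g a c' e, (C (Complex.I * (1 - α)) : Poly) • dyad kVec kVec, leg₂ K f g b e c,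
        (C (-Complex.I) : Poly) • metric]
      = C (Complex.I * (1 - α) * g ^ 2 * (kron c c' * f a c' e * f b e c))
        * ((X 0 + 2 * X 1) * (X 0 + 2 * X 2) * operatorForm K) := by
    intro c c' e
    simp only [hc, contr_smul_left, contr_smul_right, contr_metric_right, tensTrace_smul,
      triangle_trace_longitudinal hK, ← mul_assoc (C _) (C _), ← map_mul]
    congr 2
    linear_combination (-g ^ 2 * Complex.I * (1 - α) * (kron c c' * f a c' e * f b e c))
      * Complex.I_sq
  simp only [diagramB, Fin.sum_univ_two, propNum_zero, propNum_one]
  simp only [h1 _ _ _ _ rfl, h2 _ _ _ _ rfl, h0, h3, Finset.sum_const_zero,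
    triangleIntegral_zero, add_zero, sum_triangle_colour a b hswap hcas]
  simp only [Fin.val_zero, Fin.val_one]
  congr 4 <;> ring

/-- For equal colours on the two internal lines the four-gluon vertex is a multiple of
`2 ε₁·ε₂ g - ε₁ ε₂ - ε₂ ε₁`; longitudinal parts of the propagators drop out as in the triangle. -/
lemma diagramC_eq (hK : K.OnShell) (hself : ∀ a b, f a a b = 0)
    (hcas : ∑ c, ∑ e, f a c e * f b c e = 3 * kron a b) :
    diagramC K f g α n a b
      = 1 / 2 * bubbleIntegral K n K.p₁ K.p₂ 0 0
          (C (-(3 * Complex.I * g ^ 2 * kron a b)) * bubbleNumerator K n) := by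
  have hc : ∀ (c c' : Fin 8) (A₁ A₂ A₃ : Tens), chain K n
      [op2 K c c' (kVec + p₂Vec) (-(kVec + p₁Vec)), A₁, A₂, A₃]
      = C (-kron c c') * tensTrace K n (contr K (contr K (contr K
        (op2Core K (kVec + p₂Vec) (-(kVec + p₁Vec))) A₁) A₂) A₃) := by
    intro c c' A₁ A₂ A₃
    simp only [chain, List.foldl, contr_metric_left, op2_eq, contr_smul_left, tensTrace_smul]
  have h1 : ∀ z : ℂ, ∀ A₂ A₃ : Tens, ∀ q : LVec, q = kVec + p₁Vec → ∀ c c', chain K n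
      [op2 K c c' (kVec + p₂Vec) (-(kVec + p₁Vec)), (C z : Poly) • dyad q q, A₂, A₃] = 0 := by
    rintro z A₂ A₃ q rfl c c'
    simp only [hc, contr_smul_right, contr_op2Core_dyad, smul_zero, contr_zero_left,
      tensTrace_zero, mul_zero]
  have h2 : ∀ z : ℂ, ∀ A₁ A₂ : Tens, ∀ q : LVec, q = kVec + p₂Vec → ∀ c c', chain K n
      [op2 K c c' (kVec + p₂Vec) (-(kVec + p₁Vec)), A₁, A₂, (C z : Poly) • dyad q q] = 0 := by
    rintro z A₁ A₂ q rfl c c'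
    rw [hc, tensTrace_contr_comm]
    simp [← contr_assoc, contr_smul_left, contr_dyad_op2Core]
  have h0 : ∀ c c', chain K n
      [op2 K c c' (kVec + p₂Vec) (-(kVec + p₁Vec)), (C (-Complex.I) : Poly) • metric,
        gluon4 K f g a b c' c ε₁Vec ε₂Vec, (C (-Complex.I) : Poly) • metric]
      = C (-Complex.I * g ^ 2 * (kron c c' * ∑ x, f a c x * f b c x)) * bubbleNumerator K n := by
    intro c c'
    by_cases h : c = c'
    · subst h
      have hg : gluon4 K f g a b c c ε₁Vec ε₂Vec
          = (C (-Complex.I * g ^ 2 * ∑ x, f a c x * f b c x) : Poly) •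
            ((2 : Poly) • (dot K ε₁Vec ε₂Vec • metric) - dyad ε₁Vec ε₂Vec
              - dyad ε₂Vec ε₁Vec) := by
        simp only [gluon4, complex_smul_tens, hself, mul_zero, Finset.sum_const_zero,
          zero_smul, zero_add, C_mul]
        module
      rw [hg]
      simp only [hc, contr_smul_left, contr_smul_right, contr_metric_right, tensTrace_smul,
        bubble_trace hK, ← mul_assoc, ← map_mul]
      congr 2
      linear_combination (g ^ 2 * Complex.I * (kron c c * ∑ x, f a c x * f b c x)) * Complex.I_sq
    · simp only [hc, kron, if_neg h, neg_zero, map_zero, zero_mul, mul_zero]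
  have hs : ∑ c, ∑ c', (C (-Complex.I * g ^ 2 * (kron c c' * ∑ x, f a c x * f b c x)) : Poly)
      * bubbleNumerator K n = C (-(3 * Complex.I * g ^ 2 * kron a b)) * bubbleNumerator K n := by
    simp only [← Finset.sum_mul, ← map_sum, ← Finset.mul_sum]
    congr 2
    simp only [kron, Finset.sum_ite_eq, Finset.mem_univ, if_true, one_mul]
    rw [hcas, kron]
    ring
  simp only [diagramC, Fin.sum_univ_two, propNum_zero, propNum_one]
  simp only [h1 _ _ _ _ rfl, h2 _ _ _ _ rfl, h0, hs, Finset.sum_const_zero,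
    bubbleIntegral_zero, add_zero]
  simp only [Fin.val_zero]

end

end Diagrams

/-! ### The d'Alembertian on polynomials -/

section Box

open MvPolynomial

variable (K : Kinematics d) (n : ℂ)

lemma box_eq (N : Poly) : box K n N = C (2 * n) * pderiv 0 N
    + 4 * X 0 * pderiv 0 (pderiv 0 N) + 4 * ∑ i : Fin 5, X i.succ * pderiv i.succ (pderiv 0 N)
    + ∑ i : Fin 5, ∑ j : Fin 5, C (K.prod i j) * pderiv i.succ (pderiv j.succ N) := rfl

lemma box_add (M N : Poly) : box K n (M + N) = box K n M + box K n N := by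
  simp only [box, map_add, mul_add, Finset.sum_add_distrib]; ring

/-- The carré du champ of the d'Alembertian: the scalar product of the gradients with respect to
`k`. -/
def gradPair (M N : Poly) : Poly :=
  4 * X 0 * (pderiv 0 M * pderiv 0 N)
    + 2 * ∑ i : Fin 5, X i.succ * (pderiv 0 M * pderiv i.succ N + pderiv i.succ M * pderiv 0 N)
    + ∑ i : Fin 5, ∑ j : Fin 5, C (K.prod i j) * (pderiv i.succ M * pderiv j.succ N)

lemma gradPair_comm (M N : Poly) : gradPair K M N = gradPair K N M := by
  have h1 : ∑ i : Fin 5, X i.succ * (pderiv 0 M * pderiv i.succ N + pderiv i.succ M * pderiv 0 N)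
      = ∑ i : Fin 5, X i.succ *
        (pderiv 0 N * pderiv i.succ M + pderiv i.succ N * pderiv 0 M) :=
    Finset.sum_congr rfl fun i _ => by ring
  have h2 : ∑ i : Fin 5, ∑ j : Fin 5, C (K.prod i j) * (pderiv i.succ M * pderiv j.succ N)
      = ∑ i : Fin 5, ∑ j : Fin 5, C (K.prod i j) * (pderiv i.succ N * pderiv j.succ M) := by
    rw [Finset.sum_comm]
    exact Finset.sum_congr rfl fun i _ => Finset.sum_congr rfl fun j _ => by
      rw [K.prod_comm, mul_comm (pderiv j.succ M)]
  rw [gradPair, h1, h2, gradPair, mul_comm (pderiv 0 M)]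

lemma gradPair_add_right (M N N' : Poly) :
    gradPair K M (N + N') = gradPair K M N + gradPair K M N' := by
  simp only [gradPair, map_add, mul_add, Finset.sum_add_distrib]; ring

lemma gradPair_add_left (M M' N : Poly) :
    gradPair K (M + M') N = gradPair K M N + gradPair K M' N := by
  simp only [gradPair_comm K _ N, gradPair_add_right]

lemma gradPair_mul_right (M N N' : Poly) :
    gradPair K M (N * N') = N * gradPair K M N' + N' * gradPair K M N := by
  simp only [gradPair, Derivation.leibniz, smul_eq_mul]
  have h1 : ∑ i : Fin 5, X i.succ * (pderiv 0 M * (N * pderiv i.succ N' + N' * pderiv i.succ N)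
        + pderiv i.succ M * (N * pderiv 0 N' + N' * pderiv 0 N))
      = N * ∑ i : Fin 5, X i.succ *
          (pderiv 0 M * pderiv i.succ N' + pderiv i.succ M * pderiv 0 N')
        + N' * ∑ i : Fin 5, X i.succ *
          (pderiv 0 M * pderiv i.succ N + pderiv i.succ M * pderiv 0 N) := by
    rw [Finset.mul_sum, Finset.mul_sum, ← Finset.sum_add_distrib]
    exact Finset.sum_congr rfl fun i _ => by ring
  have h2 : ∑ i : Fin 5, ∑ j : Fin 5, C (K.prod i j) *
        (pderiv i.succ M * (N * pderiv j.succ N' + N' * pderiv j.succ N))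
      = N * ∑ i : Fin 5, ∑ j : Fin 5, C (K.prod i j) * (pderiv i.succ M * pderiv j.succ N')
        + N' * ∑ i : Fin 5, ∑ j : Fin 5, C (K.prod i j) *
          (pderiv i.succ M * pderiv j.succ N) := by
    simp only [Finset.mul_sum, ← Finset.sum_add_distrib]
    exact Finset.sum_congr rfl fun i _ => Finset.sum_congr rfl fun j _ => by ring
  rw [h1, h2]
  ring

lemma gradPair_mul_left (M M' N : Poly) :
    gradPair K (M * M') N = M * gradPair K M' N + M' * gradPair K M N := by
  simp only [gradPair_comm K _ N, gradPair_mul_right]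

lemma gradPair_C_right (M : Poly) (z : ℂ) : gradPair K M (C z) = 0 := by simp [gradPair]
lemma gradPair_C_left (M : Poly) (z : ℂ) : gradPair K (C z) M = 0 := by simp [gradPair]

lemma gradPair_X (i j : Fin 6) : gradPair K (X i) (X j) =
    (if i = 0 ∧ j = 0 then 4 else if i = 0 ∨ j = 0 then 2 else 1) * gram K i j := by
  refine Fin.cases ?_ (fun i => ?_) i <;> refine Fin.cases ?_ (fun j => ?_) j
  · simp [gradPair, gram, pderiv_X, (Fin.succ_ne_zero _).symm]
  · simp [gradPair, gram, pderiv_X, Pi.single_apply, (Fin.succ_ne_zero _).symm, Fin.succ_ne_zero]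
  · simp [gradPair, gram, pderiv_X, Pi.single_apply, (Fin.succ_ne_zero _).symm, Fin.succ_ne_zero]
  · simp [gradPair, gram, pderiv_X, Pi.single_apply, Fin.succ_ne_zero, Kinematics.prod]

lemma box_mul (M N : Poly) :
    box K n (M * N) = M * box K n N + N * box K n M + 2 * gradPair K M N := by
  have hs : ∑ i : Fin 5, ∑ j : Fin 5, C (K.prod i j) * (pderiv j.succ M * pderiv i.succ N)
      = ∑ i : Fin 5, ∑ j : Fin 5, C (K.prod i j) * (pderiv i.succ M * pderiv j.succ N) := by
    rw [Finset.sum_comm]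
    exact Finset.sum_congr rfl fun i _ => Finset.sum_congr rfl fun j _ => by
      rw [K.prod_comm]
  have h1 : ∑ i : Fin 5, X i.succ * pderiv i.succ (pderiv 0 (M * N))
      = M * ∑ i : Fin 5, X i.succ * pderiv i.succ (pderiv 0 N)
        + N * ∑ i : Fin 5, X i.succ * pderiv i.succ (pderiv 0 M)
        + ∑ i : Fin 5, X i.succ *
          (pderiv 0 M * pderiv i.succ N + pderiv i.succ M * pderiv 0 N) := by
    simp only [Finset.mul_sum, ← Finset.sum_add_distrib, Derivation.leibniz, smul_eq_mul, map_add]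
    exact Finset.sum_congr rfl fun i _ => by ring
  have h2 : ∑ i : Fin 5, ∑ j : Fin 5, C (K.prod i j) * pderiv i.succ (pderiv j.succ (M * N))
      = M * ∑ i : Fin 5, ∑ j : Fin 5, C (K.prod i j) * pderiv i.succ (pderiv j.succ N)
        + N * ∑ i : Fin 5, ∑ j : Fin 5, C (K.prod i j) * pderiv i.succ (pderiv j.succ M)
        + (∑ i : Fin 5, ∑ j : Fin 5, C (K.prod i j) * (pderiv i.succ M * pderiv j.succ N)
        + ∑ i : Fin 5, ∑ j : Fin 5, C (K.prod i j) * (pderiv j.succ M * pderiv i.succ N)) := by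
    simp only [Finset.mul_sum, ← Finset.sum_add_distrib, Derivation.leibniz, smul_eq_mul, map_add]
    exact Finset.sum_congr rfl fun i _ => Finset.sum_congr rfl fun j _ => by ring
  rw [hs] at h2
  rw [box_eq, h1, h2, box_eq, box_eq, gradPair]
  simp only [Derivation.leibniz, smul_eq_mul, map_add]
  ring

lemma box_C (z : ℂ) : box K n (C z) = 0 := by simp [box]

lemma box_X_zero : box K n (X 0) = C (2 * n) := by
  simp [box, pderiv_X, (Fin.succ_ne_zero _).symm]

lemma box_X_succ (i : Fin 5) : box K n (X i.succ) = 0 := by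
  have h : ∀ j l : Fin 5, pderiv l.succ (pderiv j.succ (X i.succ : Poly)) = 0 := by
    intro j l
    by_cases hj : j = i
    · rw [hj, pderiv_X_self, pderiv_one]
    · rw [pderiv_X_of_ne (by simpa using Ne.symm hj), map_zero]
  simp only [box, h, pderiv_X_of_ne (Fin.succ_ne_zero i), map_zero, mul_zero,
    Finset.sum_const_zero, add_zero]

lemma box_C_mul (z : ℂ) (N : Poly) : box K n (C z * N) = C z * box K n N := by
  rw [box_mul, box_C, gradPair_C_left]; ring

lemma iterate_box_C_mul (z : ℂ) (N : Poly) (r : ℕ) :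
    (box K n)^[r] (C z * N) = C z * (box K n)^[r] N := by
  induction r generalizing N with
  | zero => rfl
  | succ r ih => simp only [Function.iterate_succ_apply, box_C_mul, ih]

lemma iterate_box_add (M N : Poly) (r : ℕ) :
    (box K n)^[r] (M + N) = (box K n)^[r] M + (box K n)^[r] N := by
  induction r generalizing M N with
  | zero => rfl
  | succ r ih => simp only [Function.iterate_succ_apply, box_add, ih]

lemma iterate_box_sum {ι : Type*} (S : Finset ι) (N : ι → Poly) (r : ℕ) :
    (box K n)^[r] (∑ i ∈ S, N i) = ∑ i ∈ S, (box K n)^[r] (N i) := by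
  classical
  induction S using Finset.induction_on with
  | empty => simpa using iterate_box_zero K n r
  | insert i S hi ih => rw [Finset.sum_insert hi, Finset.sum_insert hi, iterate_box_add, ih]

/-- The degree in the loop momentum, in which `k²` counts twice. -/
def loopDegree (m : Fin 6 →₀ ℕ) : ℕ := m.degree + m 0

lemma loopDegree_le (m : Fin 6 →₀ ℕ) : loopDegree m ≤ 2 * m.degree := by
  have : m 0 ≤ m.degree := Finsupp.le_degree 0 m
  unfold loopDegree; omega

lemma loopDegree_add (m m' : Fin 6 →₀ ℕ) :
    loopDegree (m + m') = loopDegree m + loopDegree m' := by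
  simp [loopDegree]; ring

lemma loopDegree_single_zero : loopDegree (Finsupp.single 0 1) = 2 := by
  simp [loopDegree]

lemma loopDegree_single_succ (i : Fin 5) : loopDegree (Finsupp.single i.succ 1) = 1 := by
  simp [loopDegree]

lemma loopDegree_sub {m : Fin 6 →₀ ℕ} {i : Fin 6} (h : m i ≠ 0) :
    loopDegree (m - Finsupp.single i 1) + loopDegree (Finsupp.single i 1) = loopDegree m := by
  rw [← loopDegree_add, tsub_add_cancel_of_le]
  rw [Finsupp.single_le_iff]; omega

/-- The d'Alembertian lowers the degree in the loop momentum by two. -/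
lemma iterate_box_monomial (r : ℕ) (m : Fin 6 →₀ ℕ) (z : ℂ) (h : loopDegree m < 2 * r) :
    (box K n)^[r] (monomial m z) = 0 := by
  induction r generalizing m z with
  | zero => omega
  | succ r ih =>
    have key : ∀ (m' : Fin 6 →₀ ℕ) (z' : ℂ), (z' ≠ 0 → loopDegree m' + 2 ≤ loopDegree m) →
        (box K n)^[r] (monomial m' z') = 0 := by
      intro m' z' h'
      by_cases hz : z' = 0
      · rw [hz, monomial_zero, iterate_box_zero]
      · exact ih m' z' (by have := h' hz; omega)
    have h0 := loopDegree_single_zero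
    have h1 := loopDegree_single_succ
    rw [Function.iterate_succ_apply, box_eq K n (monomial m z)]
    rw [iterate_box_add, iterate_box_add, iterate_box_add, ← map_ofNat (C : ℂ →+* Poly) 4,
      mul_assoc (C 4), iterate_box_C_mul, iterate_box_C_mul, iterate_box_C_mul, iterate_box_sum,
      iterate_box_sum]
    simp only [pderiv_monomial]
    have t1 : (box K n)^[r] (monomial (m - Finsupp.single 0 1) (z * (m 0 : ℂ))) = 0 := by
      refine key _ _ fun hz => ?_
      have hm : m 0 ≠ 0 := by rintro h; simp [h] at hz
      have := loopDegree_sub hm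
      omega
    have t2 : (box K n)^[r] (X 0 * monomial (m - Finsupp.single 0 1 - Finsupp.single 0 1)
        (z * (m 0 : ℂ) * ((m - Finsupp.single 0 1 : Fin 6 →₀ ℕ) 0 : ℕ))) = 0 := by
      rw [X, monomial_mul, one_mul]
      refine key _ _ fun hz => ?_
      have hm : m 0 ≠ 0 := by rintro h; simp [h] at hz
      have hm' : (m - Finsupp.single 0 1 : Fin 6 →₀ ℕ) 0 ≠ 0 := by
        rintro h; simp only [h] at hz; simp at hz
      have := loopDegree_sub hm
      have := loopDegree_sub hm'
      rw [loopDegree_add]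
      omega
    have t3 : ∀ i : Fin 5, (box K n)^[r] (X i.succ *
        monomial (m - Finsupp.single 0 1 - Finsupp.single i.succ 1)
        (z * (m 0 : ℂ) * ((m - Finsupp.single 0 1 : Fin 6 →₀ ℕ) i.succ : ℕ))) = 0 := by
      intro i
      rw [X, monomial_mul, one_mul]
      refine key _ _ fun hz => ?_
      have hm : m 0 ≠ 0 := by rintro h; simp [h] at hz
      have hm' : (m - Finsupp.single 0 1 : Fin 6 →₀ ℕ) i.succ ≠ 0 := by
        rintro h; simp only [h] at hz; simp at hz
      have := loopDegree_sub hm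
      have := loopDegree_sub hm'
      rw [loopDegree_add]
      omega
    have t4 : ∀ i j : Fin 5, (box K n)^[r]
        (monomial (m - Finsupp.single j.succ 1 - Finsupp.single i.succ 1)
        (z * (m j.succ : ℂ) * ((m - Finsupp.single j.succ 1 : Fin 6 →₀ ℕ) i.succ : ℕ))) = 0 := by
      intro i j
      refine key _ _ fun hz => ?_
      have hm : m j.succ ≠ 0 := by rintro h; simp [h] at hz
      have hm' : (m - Finsupp.single j.succ 1 : Fin 6 →₀ ℕ) i.succ ≠ 0 := by
        rintro h; simp only [h] at hz; simp at hz
      have := loopDegree_sub hm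
      have := loopDegree_sub hm'
      have := h1 i
      have := h1 j
      omega
    rw [t1, t2, Finset.sum_eq_zero fun i _ => t3 i, Finset.sum_eq_zero fun i _ => ?_]
    · simp only [mul_zero, add_zero]
    · rw [iterate_box_sum]
      refine Finset.sum_eq_zero fun j _ => ?_
      rw [iterate_box_C_mul, t4, mul_zero]

lemma iterate_box_eq_zero {N : Poly} {r : ℕ} (h : N.totalDegree < r) : (box K n)^[r] N = 0 := by
  rw [N.as_sum, iterate_box_sum]
  refine Finset.sum_eq_zero fun m hm => iterate_box_monomial K n r m _ ?_
  have h1 := loopDegree_le m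
  have h2 : m.degree ≤ N.totalDegree := le_totalDegree hm
  omega

/-- The sum over `r` may be cut off wherever the iterated d'Alembertian has become zero. -/
lemma momentumIntegral_eq (s : ℕ) (k₀ : Fin (d + 1) → ℝ) (m : ℝ) {N : Poly} {R : ℕ}
    (hR : (box K n)^[R] N = 0) :
    momentumIntegral K n s k₀ m N = ∑ r ∈ Finset.range R,
      (-1 / 4 : ℂ) ^ r / (r.factorial : ℂ) * Complex.Gamma (s - r - n / 2)
        * powI0 m (n / 2 + r - s) * evalAt K k₀ ((box K n)^[r] N) := by
  have hzero : ∀ R' r : ℕ, (box K n)^[R'] N = 0 → R' ≤ r → (box K n)^[r] N = 0 := by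
    intro R' r h hr
    obtain ⟨t, rfl⟩ := Nat.exists_eq_add_of_le hr
    rw [add_comm, Function.iterate_add_apply, h, iterate_box_zero]
  have hext : ∀ R' : ℕ, (box K n)^[R'] N = 0 → ∀ R'' : ℕ, R' ≤ R'' →
      ∑ r ∈ Finset.range R', (-1 / 4 : ℂ) ^ r / (r.factorial : ℂ) * Complex.Gamma (s - r - n / 2)
        * powI0 m (n / 2 + r - s) * evalAt K k₀ ((box K n)^[r] N)
      = ∑ r ∈ Finset.range R'', (-1 / 4 : ℂ) ^ r / (r.factorial : ℂ)
        * Complex.Gamma (s - r - n / 2)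
        * powI0 m (n / 2 + r - s) * evalAt K k₀ ((box K n)^[r] N) := by
    intro R' h R'' hR'
    refine Finset.sum_subset (by simpa using hR') fun r _ hr => ?_
    rw [hzero R' r h (by simpa using hr)]
    simp [evalAt]
  rw [momentumIntegral, hext _ (iterate_box_eq_zero K n (Nat.lt_succ_self _))
    (max (N.totalDegree + 1) R) (le_max_left _ _), hext R hR _ (le_max_right _ _)]

end Box

/-! ### Feynman parameter integrals -/

section Parameters

open MvPolynomial

/-- The rising factorial `x (x + 1) ⋯ (x + k - 1)`. -/
def rising (x : ℂ) (k : ℕ) : ℂ := (ascPochhammer ℂ k).eval x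

lemma rising_zero (x : ℂ) : rising x 0 = 1 := by simp [rising]

lemma rising_succ (x : ℂ) (k : ℕ) : rising x (k + 1) = rising x k * (x + k) :=
  ascPochhammer_succ_eval k x

lemma rising_ne_zero {x : ℂ} (hx : 0 < x.re) (k : ℕ) : rising x k ≠ 0 := by
  induction k with
  | zero => simp [rising_zero]
  | succ k ih =>
    rw [rising_succ]
    refine mul_ne_zero ih fun h => ?_
    have := congrArg Complex.re h
    simp at this
    have hk : (0 : ℝ) ≤ k := Nat.cast_nonneg k
    linarith

lemma Gamma_add_nat {x : ℂ} (hx : 0 < x.re) (k : ℕ) :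
    Complex.Gamma (x + k) = rising x k * Complex.Gamma x := by
  induction k with
  | zero => simp [rising_zero]
  | succ k ih =>
    have h : x + k ≠ 0 := by
      intro h
      have := congrArg Complex.re h
      simp at this
      have hk : (0 : ℝ) ≤ k := Nat.cast_nonneg k
      linarith
    rw [Nat.cast_succ, ← add_assoc, Complex.Gamma_add_one _ h, ih, rising_succ]
    ring

lemma Gamma_one_sub_sub_nat {x : ℂ} (hx : 0 < x.re) (r : ℕ) :
    (-1) ^ r * Complex.Gamma (1 - x - r) = Complex.Gamma (1 - x) / rising x r := by
  rw [eq_div_iff (rising_ne_zero hx r)]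
  induction r with
  | zero => simp [rising_zero]
  | succ r ih =>
    have h : -(x + r) ≠ 0 := by
      intro h
      have := congrArg Complex.re h
      simp at this
      have hk : (0 : ℝ) ≤ r := Nat.cast_nonneg r
      linarith
    have h1 := Complex.Gamma_add_one _ h
    rw [show -(x + r) + 1 = 1 - x - r by ring] at h1
    rw [← ih, h1, rising_succ, show 1 - x - ((r + 1 : ℕ) : ℂ) = -(x + r) by push_cast; ring]
    ring

/-- The mean of a polynomial in two Feynman parameters `y, z` with respect to the (normalized)
Dirichlet weight `y ^ (x - 1) z ^ (x - 1)`, after multiplication with `(y z) ^ r`. The argument `c`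
is the sum of all exponents of the Dirichlet weight. -/
def paramMean (x c : ℂ) (r : ℕ) : MvPolynomial (Fin 2) ℂ →ₗ[ℂ] ℂ :=
  (basisMonomials (Fin 2) ℂ).constr ℂ fun m =>
    rising x (r + m 0) * rising x (r + m 1) / rising c (2 * r + m 0 + m 1)

lemma paramMean_monomial (x c : ℂ) (r : ℕ) (m : Fin 2 →₀ ℕ) (z : ℂ) :
    paramMean x c r (monomial m z)
      = z * (rising x (r + m 0) * rising x (r + m 1) / rising c (2 * r + m 0 + m 1)) := by
  have h : monomial m z = z • basisMonomials (Fin 2) ℂ m := by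
    simp [coe_basisMonomials, smul_monomial]
  rw [h, map_smul, paramMean, Module.Basis.constr_basis, smul_eq_mul]

lemma eval_monomial_two (y z t : ℂ) (m : Fin 2 →₀ ℕ) :
    eval ![y, z] (monomial m t) = t * (y ^ m 0 * z ^ m 1) := by
  rw [eval_monomial, Finsupp.prod_fintype _ _ (fun i => pow_zero _), Fin.prod_univ_two]
  rfl

lemma cpow_mul_pow {y : ℝ} {w : ℂ} (hw : 0 < w.re) (a : ℕ) :
    (y : ℂ) ^ w * (y : ℂ) ^ a = (y : ℂ) ^ (w + a) := by
  by_cases hy : y = 0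
  · have h1 : w ≠ 0 := by rintro rfl; simp at hw
    have h2 : w + a ≠ 0 := by
      intro h
      have := congrArg Complex.re h
      simp at this
      have hk : (0 : ℝ) ≤ a := Nat.cast_nonneg a
      linarith
    simp [hy, Complex.zero_cpow h1, Complex.zero_cpow h2]
  · rw [Complex.cpow_add _ _ (by exact_mod_cast hy), Complex.cpow_natCast]

lemma add_nat_re {x : ℂ} {t : ℝ} (hx : t < x.re) (k : ℕ) : t < (x + k).re := by
  have hk : (0 : ℝ) ≤ k := Nat.cast_nonneg k
  simp; linarith

lemma bubble_integral_monomial {x : ℂ} (hx : 1 < x.re) (r a b : ℕ) :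
    ∫ y in (0 : ℝ)..1, (y : ℂ) ^ (x - 1 + r) * ((1 - y : ℝ) : ℂ) ^ (x - 1 + r)
        * ((y : ℂ) ^ a * ((1 - y : ℝ) : ℂ) ^ b)
      = Complex.Gamma x ^ 2 / Complex.Gamma (2 * x)
        * (rising x (r + a) * rising x (r + b) / rising (2 * x) (2 * r + a + b)) := by
  have hw : 0 < (x - 1 + r).re := add_nat_re (by simpa using hx) r
  have hx0 : 0 < x.re := by linarith
  have hα : 0 < (x + (r + a : ℕ)).re := add_nat_re hx0 _
  have hβ : 0 < (x + (r + b : ℕ)).re := add_nat_re hx0 _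
  have hc : 0 < (2 * x).re := by simpa using hx0
  have h1 : ∀ y : ℝ, (y : ℂ) ^ (x - 1 + r) * ((1 - y : ℝ) : ℂ) ^ (x - 1 + r)
        * ((y : ℂ) ^ a * ((1 - y : ℝ) : ℂ) ^ b)
      = (y : ℂ) ^ (x + (r + a : ℕ) - 1) * (1 - (y : ℂ)) ^ (x + (r + b : ℕ) - 1) := by
    intro y
    rw [mul_mul_mul_comm, cpow_mul_pow hw, cpow_mul_pow hw]
    congr 2
    · push_cast; ring
    · push_cast; ring
    · push_cast; ring
  simp only [h1]
  rw [← Complex.betaIntegral, Complex.betaIntegral_eq_Gamma_mul_div _ _ hα hβ,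
    Gamma_add_nat hx0, Gamma_add_nat hx0,
    show x + ((r + a : ℕ) : ℂ) + (x + ((r + b : ℕ) : ℂ)) = 2 * x + ((2 * r + a + b : ℕ) : ℂ) by
      push_cast; ring, Gamma_add_nat hc]
  have := Complex.Gamma_ne_zero_of_re_pos hc
  have := rising_ne_zero hc (2 * r + a + b)
  field_simp

lemma simplex_integral_monomial {x : ℂ} (hx : 1 < x.re) (i r a b : ℕ) :
    ∫ y in (0 : ℝ)..1, ∫ z in (0 : ℝ)..(1 - y), ((1 - y - z : ℝ) : ℂ) ^ i
        * ((y : ℂ) ^ (x - 1 + r) * (z : ℂ) ^ (x - 1 + r)) * ((y : ℂ) ^ a * (z : ℂ) ^ b)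
      = i.factorial * (Complex.Gamma x ^ 2 / Complex.Gamma (2 * x + 1 + i))
        * (rising x (r + a) * rising x (r + b) / rising (2 * x + 1 + i) (2 * r + a + b)) := by
  have hw : 0 < (x - 1 + r).re := add_nat_re (by simpa using hx) r
  have hx0 : 0 < x.re := by linarith
  have hα : 0 < (x + (r + a : ℕ)).re := add_nat_re hx0 _
  have hβ : 0 < (x + (r + b : ℕ)).re := add_nat_re hx0 _
  have hi : 0 < ((i : ℂ) + 1).re := by simp; positivity
  have hβi : 0 < (x + (r + b : ℕ) + ((i : ℂ) + 1)).re := by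
    rw [Complex.add_re]; exact add_pos hβ hi
  have hc : 0 < (2 * x + 1 + i).re := by
    simp
    have hk : (0 : ℝ) ≤ i := Nat.cast_nonneg i
    linarith
  have h1 : ∀ y z : ℝ, ((1 - y - z : ℝ) : ℂ) ^ i
        * ((y : ℂ) ^ (x - 1 + r) * (z : ℂ) ^ (x - 1 + r)) * ((y : ℂ) ^ a * (z : ℂ) ^ b)
      = (y : ℂ) ^ (x + (r + a : ℕ) - 1) * ((z : ℂ) ^ (x + (r + b : ℕ) - 1)
        * (((1 - y : ℝ) : ℂ) - z) ^ ((i : ℂ) + 1 - 1)) := by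
    intro y z
    have e : ∀ k : ℕ, x + ((r + k : ℕ) : ℂ) - 1 = x - 1 + r + k := fun k => by push_cast; ring
    rw [e, e, ← cpow_mul_pow hw, ← cpow_mul_pow hw, add_sub_cancel_right, Complex.cpow_natCast]
    push_cast
    ring
  have h2 : ∀ y ∈ Set.uIcc (0 : ℝ) 1, ∫ z in (0 : ℝ)..(1 - y), ((1 - y - z : ℝ) : ℂ) ^ i
        * ((y : ℂ) ^ (x - 1 + r) * (z : ℂ) ^ (x - 1 + r)) * ((y : ℂ) ^ a * (z : ℂ) ^ b)
      = (y : ℂ) ^ (x + (r + a : ℕ) - 1)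
        * (1 - (y : ℂ)) ^ (x + (r + b : ℕ) + ((i : ℂ) + 1) - 1)
        * Complex.betaIntegral (x + (r + b : ℕ)) (i + 1) := by
    intro y hy
    rw [Set.uIcc_of_le zero_le_one] at hy
    simp only [h1]
    rw [intervalIntegral.integral_const_mul]
    rcases hy.2.eq_or_lt with rfl | hy1
    · have : x + ((r + b : ℕ) : ℂ) + ((i : ℂ) + 1) - 1 ≠ 0 := by
        intro h
        have h3 := congrArg Complex.re h
        have h4 : 0 < (x + ((r + b : ℕ) : ℂ) + ((i : ℕ) : ℂ)).re := add_nat_re hβ i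
        rw [show x + ((r + b : ℕ) : ℂ) + ((i : ℂ) + 1) - 1
          = x + ((r + b : ℕ) : ℂ) + ((i : ℕ) : ℂ) by ring] at h3
        rw [h3] at h4
        simp at h4
      rw [sub_self, intervalIntegral.integral_same, Complex.ofReal_one, sub_self,
        Complex.zero_cpow this]
      ring
    · rw [Complex.betaIntegral_scaled _ _ (sub_pos.2 hy1)]
      push_cast
      ring
  rw [intervalIntegral.integral_congr h2, intervalIntegral.integral_mul_const,
    ← Complex.betaIntegral, Complex.betaIntegral_eq_Gamma_mul_div _ _ hα hβi,
    Complex.betaIntegral_eq_Gamma_mul_div _ _ hβ hi, Complex.Gamma_nat_eq_factorial,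
    show x + ((r + a : ℕ) : ℂ) + (x + ((r + b : ℕ) : ℂ) + ((i : ℂ) + 1))
      = 2 * x + 1 + i + ((2 * r + a + b : ℕ) : ℂ) by push_cast; ring, Gamma_add_nat hc,
    Gamma_add_nat hx0, Gamma_add_nat hx0]
  have := Complex.Gamma_ne_zero_of_re_pos hc
  have := Complex.Gamma_ne_zero_of_re_pos hβi
  have := rising_ne_zero hc (2 * r + a + b)
  field_simp

/-- The parameter integrand of the triangle is continuous on the closed simplex. -/
lemma continuous_simplex_integrand {x : ℂ} (hx : 1 < x.re) (i r : ℕ)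
    (q : MvPolynomial (Fin 2) ℂ) :
    Continuous (fun p : ℝ × ℝ => ((1 - p.1 - p.2 : ℝ) : ℂ) ^ i
      * ((p.1 : ℂ) ^ (x - 1 + r) * (p.2 : ℂ) ^ (x - 1 + r))
      * eval ![(p.1 : ℂ), (p.2 : ℂ)] q) := by
  have hw : 0 < (x - 1 + r).re := add_nat_re (by simpa using hx) r
  have h1 := Complex.continuous_ofReal_cpow_const hw
  have h2 : Continuous fun p : ℝ × ℝ => eval ![(p.1 : ℂ), (p.2 : ℂ)] q := by
    induction q using MvPolynomial.induction_on' with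
    | monomial m t => simp only [eval_monomial_two]; fun_prop
    | add p q hp hq => simp only [map_add]; exact hp.add hq
  exact ((by fun_prop : Continuous fun p : ℝ × ℝ => ((1 - p.1 - p.2 : ℝ) : ℂ) ^ i).mul
    ((h1.comp continuous_fst).mul (h1.comp continuous_snd))).mul h2

lemma simplex_integral_sum {ι : Type*} (S : Finset ι) (f : ι → ℝ → ℝ → ℂ)
    (hf : ∀ i ∈ S, Continuous (Function.uncurry (f i))) :
    ∫ y in (0 : ℝ)..1, ∫ z in (0 : ℝ)..(1 - y), ∑ i ∈ S, f i y z
      = ∑ i ∈ S, ∫ y in (0 : ℝ)..1, ∫ z in (0 : ℝ)..(1 - y), f i y z := by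
  have h1 : ∀ y : ℝ, ∫ z in (0 : ℝ)..(1 - y), ∑ i ∈ S, f i y z
      = ∑ i ∈ S, ∫ z in (0 : ℝ)..(1 - y), f i y z := fun y =>
    intervalIntegral.integral_finsetSum fun i hi =>
      ((hf i hi).comp (by fun_prop : Continuous fun z : ℝ => (y, z))).intervalIntegrable _ _
  simp only [h1]
  exact intervalIntegral.integral_finsetSum fun i hi =>
    (intervalIntegral.continuous_parametric_intervalIntegral_of_continuous (hf i hi)
      (by fun_prop : Continuous fun y : ℝ => 1 - y)).intervalIntegrable _ _

lemma simplex_integral_eq {x : ℂ} (hx : 1 < x.re) (i r : ℕ) (q : MvPolynomial (Fin 2) ℂ) :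
    ∫ y in (0 : ℝ)..1, ∫ z in (0 : ℝ)..(1 - y), ((1 - y - z : ℝ) : ℂ) ^ i
        * ((y : ℂ) ^ (x - 1 + r) * (z : ℂ) ^ (x - 1 + r)) * eval ![(y : ℂ), (z : ℂ)] q
      = i.factorial * (Complex.Gamma x ^ 2 / Complex.Gamma (2 * x + 1 + i))
        * paramMean x (2 * x + 1 + i) r q := by
  have h := simplex_integral_sum q.support (fun m y z => ((1 - y - z : ℝ) : ℂ) ^ i
        * ((y : ℂ) ^ (x - 1 + r) * (z : ℂ) ^ (x - 1 + r))
        * eval ![(y : ℂ), (z : ℂ)] (monomial m (coeff m q)))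
    fun m _ => continuous_simplex_integrand hx i r _
  simp only [← Finset.mul_sum, ← map_sum, ← q.as_sum] at h
  rw [h]
  conv_rhs => rw [q.as_sum]
  rw [map_sum, Finset.mul_sum]
  refine Finset.sum_congr rfl fun m _ => ?_
  rw [paramMean_monomial, mul_left_comm, ← simplex_integral_monomial hx,
    ← intervalIntegral.integral_const_mul]
  refine intervalIntegral.integral_congr fun y _ => ?_
  simp only [← intervalIntegral.integral_const_mul]
  refine intervalIntegral.integral_congr fun z _ => ?_
  simp only [eval_monomial_two]
  ring

lemma continuous_bubble_integrand {x : ℂ} (hx : 1 < x.re) (r : ℕ) (q : MvPolynomial (Fin 2) ℂ) :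
    Continuous fun y : ℝ => (y : ℂ) ^ (x - 1 + r) * ((1 - y : ℝ) : ℂ) ^ (x - 1 + r)
      * eval ![(y : ℂ), ((1 - y : ℝ) : ℂ)] q := by
  simpa [Function.comp_def] using (continuous_simplex_integrand hx 0 r q).comp
    (by fun_prop : Continuous fun y : ℝ => (y, 1 - y))

lemma bubble_integral_eq {x : ℂ} (hx : 1 < x.re) (r : ℕ) (q : MvPolynomial (Fin 2) ℂ) :
    ∫ y in (0 : ℝ)..1, (y : ℂ) ^ (x - 1 + r) * ((1 - y : ℝ) : ℂ) ^ (x - 1 + r)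
        * eval ![(y : ℂ), ((1 - y : ℝ) : ℂ)] q
      = Complex.Gamma x ^ 2 / Complex.Gamma (2 * x) * paramMean x (2 * x) r q := by
  have h := intervalIntegral.integral_finsetSum (μ := MeasureTheory.volume) (a := 0) (b := 1)
    (s := q.support) (f := fun m (y : ℝ) =>
      (y : ℂ) ^ (x - 1 + r) * ((1 - y : ℝ) : ℂ) ^ (x - 1 + r)
        * eval ![(y : ℂ), ((1 - y : ℝ) : ℂ)] (monomial m (coeff m q)))
    fun m _ => (continuous_bubble_integrand hx r _).intervalIntegrable _ _
  simp only [← Finset.mul_sum, ← map_sum, ← q.as_sum] at h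
  rw [h]
  conv_rhs => rw [q.as_sum]
  rw [map_sum, Finset.mul_sum]
  refine Finset.sum_congr rfl fun m _ => ?_
  rw [paramMean_monomial, mul_left_comm, ← bubble_integral_monomial hx,
    ← intervalIntegral.integral_const_mul]
  refine intervalIntegral.integral_congr fun y _ => ?_
  simp only [eval_monomial_two]
  ring

/-! ### The scale dependence `(m - i0) ^ w` -/

lemma powI0_mul {t m : ℝ} (ht : 0 ≤ t) (hm : m ≠ 0) {w : ℂ} (hw : 0 < w.re) :
    powI0 (t * m) w = (t : ℂ) ^ w * powI0 m w := by
  have hw0 : w ≠ 0 := by rintro rfl; simp at hw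
  rcases ht.eq_or_lt with rfl | ht'
  · simp [powI0, Complex.zero_cpow hw0]
  · rcases hm.lt_or_gt with h | h
    · rw [powI0, powI0, if_neg (by nlinarith), if_neg (by linarith), ← mul_assoc,
        ← Complex.mul_cpow_ofReal_nonneg ht (by linarith)]
      congr 2
      push_cast; ring
    · rw [powI0, powI0, if_pos (by positivity), if_pos h.le,
        ← Complex.mul_cpow_ofReal_nonneg ht h.le]
      push_cast; rfl

lemma powI0_add_nat {m : ℝ} (hm : m ≠ 0) (w : ℂ) (r : ℕ) :
    powI0 m (w + r) = powI0 m w * (m : ℂ) ^ r := by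
  unfold powI0
  split_ifs with h
  · rw [Complex.cpow_add _ _ (by exact_mod_cast hm), Complex.cpow_natCast]
  · have h' : ((-m : ℝ) : ℂ) ≠ 0 := by
      rw [Complex.ofReal_ne_zero]; linarith
    have he : Complex.exp (-(Real.pi * Complex.I * r)) = (-1) ^ r := by
      rw [show -(Real.pi * Complex.I * r) = -((r : ℂ) * (Real.pi * Complex.I)) by ring,
        Complex.exp_neg, Complex.exp_nat_mul, Complex.exp_pi_mul_I, ← inv_pow]
      norm_num
    rw [Complex.cpow_add _ _ h', Complex.cpow_natCast, mul_add, neg_add, Complex.exp_add, he]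
    have : (m : ℂ) ^ r = ((-m : ℝ) : ℂ) ^ r * (-1) ^ r := by
      rw [← mul_pow]; push_cast; ring
    rw [this]; ring

end Parameters

/-! ### Loop integrals as rational functions times Gamma functions -/

section LoopIntegrals

open MvPolynomial

variable (K : Kinematics d)

/-- Restriction of a polynomial in `k²` and `k · vᵢ` to `k = -(y p₁ + z p₂)`, for on-shell
kinematics; the result is a polynomial in `y` and `z`. -/
def paramHom : Poly →ₐ[ℂ] MvPolynomial (Fin 2) ℂ :=
  aeval ![2 * C (K.prod 0 1) * X 0 * X 1, -(C (K.prod 0 1) * X 1), -(C (K.prod 0 1) * X 0),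
    -(C (K.prod 0 2) * X 0 + C (K.prod 1 2) * X 1), -(C (K.prod 1 3) * X 1),
    -(C (K.prod 0 4) * X 0)]

/-- The integral of the numerator `N` over the loop momentum and the Feynman parameters, divided by
the integral of the leading term `r = 0` with numerator `1`. -/
def loopMean (n x c : ℂ) (R : ℕ) (N : Poly) : ℂ :=
  ∑ r ∈ Finset.range R, (2 * K.prod 0 1) ^ r / (r.factorial * 4 ^ r * rising x r)
    * paramMean x c r (paramHom K ((box K n)^[r] N))

lemma loopMean_C_mul (n x c : ℂ) (R : ℕ) (z : ℂ) (N : Poly) :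
    loopMean K n x c R (C z * N) = z * loopMean K n x c R N := by
  rw [loopMean, loopMean, Finset.mul_sum]
  refine Finset.sum_congr rfl fun r _ => ?_
  have h : paramHom K (C z * (box K n)^[r] N) = z • paramHom K ((box K n)^[r] N) := by
    rw [C_mul', map_smul]
  rw [iterate_box_C_mul, h, map_smul, smul_eq_mul]
  ring

variable {K}

lemma mink_param (y z : ℝ) (v : Fin (d + 1) → ℂ) :
    mink (fun ν => ((-(y • K.p₁ + z • K.p₂)) ν : ℂ)) v
      = -((y : ℂ) * mink (K.ext 0) v + z * mink (K.ext 1) v) := by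
  simp only [mink, Kinematics.ext, Pi.neg_apply, Pi.add_apply, Pi.smul_apply, smul_eq_mul,
    Complex.ofReal_neg, Complex.ofReal_add, Complex.ofReal_mul, Matrix.cons_val_zero,
    Matrix.cons_val_one]
  simp only [mul_sub, Finset.mul_sum, neg_mul, add_mul, neg_add, Finset.sum_add_distrib,
    Finset.sum_neg_distrib, mul_assoc]
  ring

lemma mink_param_self (hK : K.OnShell) (y z : ℝ) :
    mink (-(y • K.p₁ + z • K.p₂)) (-(y • K.p₁ + z • K.p₂)) = y * z * (2 * mink K.p₁ K.p₂) := by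
  have h : mink (-(y • K.p₁ + z • K.p₂)) (-(y • K.p₁ + z • K.p₂))
      = y ^ 2 * mink K.p₁ K.p₁ + y * z * (2 * mink K.p₁ K.p₂) + z ^ 2 * mink K.p₂ K.p₂ := by
    simp only [mink, Pi.neg_apply, Pi.add_apply, Pi.smul_apply, smul_eq_mul]
    simp only [mul_sub, Finset.mul_sum]
    have : ∀ i : Fin d, -(y * K.p₁ i.succ + z * K.p₂ i.succ) * -(y * K.p₁ i.succ + z * K.p₂ i.succ)
        = y ^ 2 * (K.p₁ i.succ * K.p₁ i.succ) + y * z * (2 * (K.p₁ i.succ * K.p₂ i.succ))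
          + z ^ 2 * (K.p₂ i.succ * K.p₂ i.succ) := fun i => by ring
    simp only [this, Finset.sum_add_distrib]
    ring
  rw [h, hK.p₁_sq, hK.p₂_sq]; ring

lemma Kinematics.OnShell.Qsq_eq (hK : K.OnShell) : K.Qsq = -(2 * mink K.p₁ K.p₂) := by
  have h := mink_param_self hK (-1) 1
  rw [Kinematics.Qsq, show K.p₁ - K.p₂ = -((-1 : ℝ) • K.p₁ + (1 : ℝ) • K.p₂) by module, h]
  ring

lemma Kinematics.prod_zero_one : K.prod 0 1 = (mink K.p₁ K.p₂ : ℝ) := mink_ofReal _ _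

lemma Kinematics.OnShell.neg_Qsq (hK : K.OnShell) : ((-K.Qsq : ℝ) : ℂ) = 2 * K.prod 0 1 := by
  rw [hK.Qsq_eq, Kinematics.prod_zero_one]; push_cast; ring

lemma Kinematics.OnShell.prod_ne_zero (hK : K.OnShell) : K.prod 0 1 ≠ 0 := by
  intro h
  have h1 := hK.neg_Qsq
  rw [h, mul_zero, Complex.ofReal_eq_zero, neg_eq_zero] at h1
  exact hK.Q_sq h1

lemma evalAt_param (hK : K.OnShell) (y z : ℝ) (N : Poly) :
    evalAt K (-(y • K.p₁ + z • K.p₂)) N = eval ![(y : ℂ), (z : ℂ)] (paramHom K N) := by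
  rw [evalAt]
  have key : ∀ i : Fin 6, (Fin.cases (motive := fun _ => ℂ)
      ((mink (-(y • K.p₁ + z • K.p₂)) (-(y • K.p₁ + z • K.p₂)) : ℝ) : ℂ)
      (fun j => mink (fun ν => ((-(y • K.p₁ + z • K.p₂)) ν : ℂ)) (K.ext j)) i)
      = eval ![(y : ℂ), (z : ℂ)] (paramHom K (X i)) := by
    intro i
    rw [paramHom, aeval_X]
    have hp : ∀ i j, mink (K.ext i) (K.ext j) = K.prod i j := fun i j => rfl
    refine Fin.cases ?_ (fun j => ?_) i
    · simp only [Fin.cases_zero, mink_param_self hK]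
      simp [Kinematics.prod_zero_one]
      ring
    · simp only [Fin.cases_succ, mink_param, hp]
      fin_cases j
      · simp [hK.prod_zero_zero, K.prod_comm 1 0, mul_comm]
      · simp [hK.prod_one_one, mul_comm]
      · simp [mul_comm]
      · simp [hK.prod_zero_three, mul_comm]
      · simp [hK.prod_one_four, mul_comm]
  induction N using MvPolynomial.induction_on with
  | C a => simp [paramHom]
  | add p q hp hq => simp only [map_add, hp, hq]
  | mul_X p i hp => rw [map_mul, map_mul, map_mul, hp, eval_X, key]

variable (K)

lemma momentumIntegral_param (hK : K.OnShell) {n x : ℂ} {s : ℕ} (hn : n = 2 * (x - 1 + s))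
    (hx : 1 < x.re) {y z : ℝ} (hy : 0 ≤ y) (hz : 0 ≤ z) {N : Poly} {R : ℕ}
    (hR : (box K n)^[R] N = 0) :
    momentumIntegral K n s (-(y • K.p₁ + z • K.p₂)) (y * z * (2 * mink K.p₁ K.p₂)) N
      = ∑ r ∈ Finset.range R, Complex.Gamma (1 - x) * powI0 (-K.Qsq) (x - 1)
        * ((2 * K.prod 0 1) ^ r / (r.factorial * 4 ^ r * rising x r))
        * ((y : ℂ) ^ (x - 1 + r) * (z : ℂ) ^ (x - 1 + r)
          * eval ![(y : ℂ), (z : ℂ)] (paramHom K ((box K n)^[r] N))) := by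
  rw [momentumIntegral_eq K n s _ _ hR]
  refine Finset.sum_congr rfl fun r _ => ?_
  have hw : 0 < (x - 1 + r).re := add_nat_re (by simpa using hx) r
  have hx0 : 0 < x.re := by linarith
  have hM : -K.Qsq ≠ 0 := neg_ne_zero.2 hK.Q_sq
  have e1 : (s : ℂ) - r - n / 2 = 1 - x - r := by rw [hn]; ring
  have e2 : n / 2 + r - s = x - 1 + r := by rw [hn]; ring
  have e3 : 2 * mink K.p₁ K.p₂ = -K.Qsq := by rw [hK.Qsq_eq, neg_neg]
  rw [e1, e2, e3, powI0_mul (mul_nonneg hy hz) hM hw, powI0_add_nat hM, hK.neg_Qsq,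
    Complex.ofReal_mul, Complex.mul_cpow_ofReal_nonneg hy hz, evalAt_param hK]
  have h := Gamma_one_sub_sub_nat hx0 r
  have h4 : (-1 / 4 : ℂ) ^ r = (-1) ^ r / 4 ^ r := div_pow _ _ _
  rw [h4, show ∀ A B D E F : ℂ, A / B / D * E * F = A * E / (B * D) * F from
    fun A B D E F => by ring, h]
  have := rising_ne_zero hx0 r
  field_simp

lemma triangleIntegral_eq (hK : K.OnShell) {n x : ℂ} {i : ℕ} (hn : n = 2 * (x + 2 + i))
    (hx : 1 < x.re) {N : Poly} {R : ℕ} (hR : (box K n)^[R] N = 0) :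
    triangleIntegral K n i 0 0 N = Complex.I * (-1) ^ (i + 3)
      * ((4 * Real.pi : ℝ) : ℂ) ^ (-(n / 2))
      * (Complex.Gamma (1 - x) * Complex.Gamma x ^ 2 / Complex.Gamma (2 * x + 1 + i))
      * powI0 (-K.Qsq) (x - 1) * loopMean K n x (2 * x + 1 + i) R N := by
  have hn' : n = 2 * (x - 1 + ((i + 0 + 0 + 3 : ℕ) : ℂ)) := by rw [hn]; push_cast; ring
  have h1 : ∫ y in (0 : ℝ)..1, ∫ z in (0 : ℝ)..(1 - y),
      (((1 - y - z) ^ i * y ^ 0 * z ^ 0 : ℝ) : ℂ) *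
      (let k₀ := -(y • K.p₁ + z • K.p₂)
       momentumIntegral K n (i + 0 + 0 + 3) k₀
        (mink k₀ k₀ - (y * mink K.p₁ K.p₁ + z * mink K.p₂ K.p₂)) N)
      = ∫ y in (0 : ℝ)..1, ∫ z in (0 : ℝ)..(1 - y), ∑ r ∈ Finset.range R,
        (Complex.Gamma (1 - x) * powI0 (-K.Qsq) (x - 1)
        * ((2 * K.prod 0 1) ^ r / (r.factorial * 4 ^ r * rising x r)))
        * (((1 - y - z : ℝ) : ℂ) ^ i * ((y : ℂ) ^ (x - 1 + r) * (z : ℂ) ^ (x - 1 + r))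
          * eval ![(y : ℂ), (z : ℂ)] (paramHom K ((box K n)^[r] N))) := by
    refine intervalIntegral.integral_congr fun y hy => ?_
    rw [Set.uIcc_of_le zero_le_one] at hy
    refine intervalIntegral.integral_congr fun z hz => ?_
    rw [Set.uIcc_of_le (sub_nonneg.2 hy.2)] at hz
    simp only [hK.p₁_sq, hK.p₂_sq, mul_zero, add_zero, sub_zero, mink_param_self hK]
    rw [momentumIntegral_param K hK hn' hx hy.1 hz.1 hR, Finset.mul_sum]
    refine Finset.sum_congr rfl fun r _ => ?_
    push_cast
    ring
  rw [triangleIntegral, h1, simplex_integral_sum]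
  swap
  · exact fun r _ => continuous_const.mul (continuous_simplex_integrand hx i r _)
  simp only [intervalIntegral.integral_const_mul, simplex_integral_eq hx, loopMean,
    Finset.mul_sum]
  refine Finset.sum_congr rfl fun r _ => ?_
  have hi : (i.factorial : ℂ) ≠ 0 := by exact_mod_cast i.factorial_ne_zero
  simp only [Nat.factorial_zero, Nat.cast_one, mul_one, add_zero]
  field_simp

lemma bubbleIntegral_eq (hK : K.OnShell) {n x : ℂ} (hn : n = 2 * (x + 1))
    (hx : 1 < x.re) {N : Poly} {R : ℕ} (hR : (box K n)^[R] N = 0) :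
    bubbleIntegral K n K.p₁ K.p₂ 0 0 N = Complex.I * ((4 * Real.pi : ℝ) : ℂ) ^ (-(n / 2))
      * (Complex.Gamma (1 - x) * Complex.Gamma x ^ 2 / Complex.Gamma (2 * x))
      * powI0 (-K.Qsq) (x - 1) * loopMean K n x (2 * x) R N := by
  have hn' : n = 2 * (x - 1 + ((0 + 0 + 2 : ℕ) : ℂ)) := by rw [hn]; push_cast; ring
  have h1 : ∫ y in (0 : ℝ)..1, ((y ^ 0 * (1 - y) ^ 0 : ℝ) : ℂ) *
      (let k₀ := -(y • K.p₁ + (1 - y) • K.p₂)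
       momentumIntegral K n (0 + 0 + 2) k₀
        (mink k₀ k₀ - (y * mink K.p₁ K.p₁ + (1 - y) * mink K.p₂ K.p₂)) N)
      = ∫ y in (0 : ℝ)..1, ∑ r ∈ Finset.range R,
        (Complex.Gamma (1 - x) * powI0 (-K.Qsq) (x - 1)
        * ((2 * K.prod 0 1) ^ r / (r.factorial * 4 ^ r * rising x r)))
        * ((y : ℂ) ^ (x - 1 + r) * ((1 - y : ℝ) : ℂ) ^ (x - 1 + r)
          * eval ![(y : ℂ), ((1 - y : ℝ) : ℂ)] (paramHom K ((box K n)^[r] N))) := by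
    refine intervalIntegral.integral_congr fun y hy => ?_
    rw [Set.uIcc_of_le zero_le_one] at hy
    simp only [hK.p₁_sq, hK.p₂_sq, mul_zero, add_zero, sub_zero, mink_param_self hK]
    rw [momentumIntegral_param K hK hn' hx hy.1 (sub_nonneg.2 hy.2) hR, Finset.mul_sum]
    refine Finset.sum_congr rfl fun r _ => ?_
    simp
  rw [bubbleIntegral, h1, intervalIntegral.integral_finsetSum]
  swap
  · exact fun r _ =>
      (continuous_const.mul (continuous_bubble_integrand hx r _)).intervalIntegrable _ _
  simp only [intervalIntegral.integral_const_mul, bubble_integral_eq hx, loopMean,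
    Finset.mul_sum]
  refine Finset.sum_congr rfl fun r _ => ?_
  simp only [Nat.factorial_zero, Nat.cast_one, mul_one, add_zero, zero_add, even_two,
    Even.neg_pow, one_pow, div_one]
  ring

end LoopIntegrals

/-! ### Evaluation of the loop integrals -/

section Evaluation

open MvPolynomial

lemma rising_add (x : ℂ) (r k : ℕ) : rising x (r + k) = rising x r * rising (x + r) k := by
  induction k with
  | zero => simp [rising_zero]
  | succ k ih => rw [← add_assoc, rising_succ, ih, rising_succ]; push_cast; ring

lemma rising_one_add (x : ℂ) (k : ℕ) : rising x (1 + k) = x * rising (x + 1) k := by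
  rw [rising_add, show rising x 1 = x by simpa [rising_zero] using rising_succ x 0, Nat.cast_one]

/-- The mean of a polynomial in two parameters with respect to the Dirichlet distribution with
exponents `α, β, c - α - β`. -/
def dirichletMean (α β c : ℂ) : MvPolynomial (Fin 2) ℂ →ₗ[ℂ] ℂ :=
  (basisMonomials (Fin 2) ℂ).constr ℂ fun m =>
    rising α (m 0) * rising β (m 1) / rising c (m 0 + m 1)

lemma dirichletMean_monomial (α β c : ℂ) (m : Fin 2 →₀ ℕ) (z : ℂ) :
    dirichletMean α β c (monomial m z)
      = z * (rising α (m 0) * rising β (m 1) / rising c (m 0 + m 1)) := by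
  have h : monomial m z = z • basisMonomials (Fin 2) ℂ m := by
    simp [coe_basisMonomials, smul_monomial]
  rw [h, map_smul, dirichletMean, Module.Basis.constr_basis, smul_eq_mul]

lemma paramMean_eq (x c : ℂ) (r : ℕ) (q : MvPolynomial (Fin 2) ℂ) :
    paramMean x c r q
      = rising x r ^ 2 / rising c (2 * r)
        * dirichletMean (x + r) (x + r) (c + (2 * r : ℕ)) q := by
  induction q using MvPolynomial.induction_on' with
  | monomial m z =>
    rw [paramMean_monomial, dirichletMean_monomial, rising_add, rising_add, add_assoc, rising_add]
    ring
  | add p q hp hq => rw [map_add, map_add, hp, hq, mul_add]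

lemma dirichletMean_X_zero_mul (α β c : ℂ) (q : MvPolynomial (Fin 2) ℂ) :
    dirichletMean α β c (X 0 * q) = α / c * dirichletMean (α + 1) β (c + 1) q := by
  induction q using MvPolynomial.induction_on' with
  | monomial m z =>
    rw [X, monomial_mul, one_mul, dirichletMean_monomial, dirichletMean_monomial]
    simp only [Finsupp.add_apply, Finsupp.single_eq_same, ne_eq, Fin.isValue, one_ne_zero,
      not_false_eq_true, Finsupp.single_eq_of_ne, zero_add, add_assoc, rising_one_add]
    ring
  | add p q hp hq => rw [mul_add, map_add, hp, hq, map_add, mul_add]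

lemma dirichletMean_X_one_mul (α β c : ℂ) (q : MvPolynomial (Fin 2) ℂ) :
    dirichletMean α β c (X 1 * q) = β / c * dirichletMean α (β + 1) (c + 1) q := by
  induction q using MvPolynomial.induction_on' with
  | monomial m z =>
    rw [X, monomial_mul, one_mul, dirichletMean_monomial, dirichletMean_monomial]
    simp only [Finsupp.add_apply, Finsupp.single_eq_same, ne_eq, Fin.isValue, zero_ne_one,
      not_false_eq_true, Finsupp.single_eq_of_ne, zero_add, add_left_comm (m 0) 1, rising_one_add]
    ring
  | add p q hp hq => rw [mul_add, map_add, hp, hq, map_add, mul_add]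

variable (K : Kinematics d)

/-- The Dirichlet mean of the values of a polynomial in `k²` and `k · vᵢ` at
`k = -(y p₁ + z p₂)`. -/
def momentMean (α β c : ℂ) : Poly →ₗ[ℂ] ℂ := dirichletMean α β c ∘ₗ (paramHom K).toLinearMap

lemma momentMean_C (α β c z : ℂ) : momentMean K α β c (C z) = z := by
  have : paramHom K (C z) = monomial 0 z := by rw [paramHom, algHom_C]; rfl
  rw [momentMean, LinearMap.comp_apply, AlgHom.toLinearMap_apply, this, dirichletMean_monomial]
  simp [rising_zero]

lemma momentMean_C_mul (α β c z : ℂ) (N : Poly) :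
    momentMean K α β c (C z * N) = z * momentMean K α β c N := by
  rw [C_mul', map_smul, smul_eq_mul]

lemma dirichletMean_C_mul (α β c z : ℂ) (q : MvPolynomial (Fin 2) ℂ) :
    dirichletMean α β c (C z * q) = z * dirichletMean α β c q := by
  rw [C_mul', map_smul, smul_eq_mul]

lemma paramHom_X_mul (i : Fin 6) (N : Poly) : paramHom K (X i * N) =
    ![2 * C (K.prod 0 1) * X 0 * X 1, -(C (K.prod 0 1) * X 1), -(C (K.prod 0 1) * X 0),
    -(C (K.prod 0 2) * X 0 + C (K.prod 1 2) * X 1), -(C (K.prod 1 3) * X 1),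
    -(C (K.prod 0 4) * X 0)] i * paramHom K N := by
  rw [map_mul]; congr 1; rw [paramHom, aeval_X]

lemma momentMean_X_zero_mul (α β c : ℂ) (N : Poly) : momentMean K α β c (X 0 * N)
    = 2 * K.prod 0 1 * (α / c * (β / (c + 1)))
      * momentMean K (α + 1) (β + 1) (c + 1 + 1) N := by
  have : paramHom K (X 0 * N) = C (2 * K.prod 0 1) * (X 0 * (X 1 * paramHom K N)) := by
    rw [paramHom_X_mul, C_mul, map_ofNat]; simp [mul_assoc]
  simp only [momentMean, LinearMap.comp_apply, AlgHom.toLinearMap_apply, this,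
    dirichletMean_C_mul, dirichletMean_X_zero_mul, dirichletMean_X_one_mul]
  ring

lemma momentMean_X_one_mul (α β c : ℂ) (N : Poly) : momentMean K α β c (X 1 * N)
    = -(K.prod 0 1 * (β / c)) * momentMean K α (β + 1) (c + 1) N := by
  have : paramHom K (X 1 * N) = C (-K.prod 0 1) * (X 1 * paramHom K N) := by
    rw [paramHom_X_mul, C_neg]; simp [mul_assoc]
  simp only [momentMean, LinearMap.comp_apply, AlgHom.toLinearMap_apply, this,
    dirichletMean_C_mul, dirichletMean_X_one_mul]
  ring

lemma momentMean_X_two_mul (α β c : ℂ) (N : Poly) : momentMean K α β c (X 2 * N)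
    = -(K.prod 0 1 * (α / c)) * momentMean K (α + 1) β (c + 1) N := by
  have : paramHom K (X 2 * N) = C (-K.prod 0 1) * (X 0 * paramHom K N) := by
    rw [paramHom_X_mul, C_neg]; simp [mul_assoc]
  simp only [momentMean, LinearMap.comp_apply, AlgHom.toLinearMap_apply, this,
    dirichletMean_C_mul, dirichletMean_X_zero_mul]
  ring

lemma momentMean_X_three_mul (α β c : ℂ) (N : Poly) : momentMean K α β c (X 3 * N)
    = -(K.prod 0 2 * (α / c)) * momentMean K (α + 1) β (c + 1) N
      - K.prod 1 2 * (β / c) * momentMean K α (β + 1) (c + 1) N := by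
  have : paramHom K (X 3 * N) = C (-K.prod 0 2) * (X 0 * paramHom K N)
      + C (-K.prod 1 2) * (X 1 * paramHom K N) := by
    rw [paramHom_X_mul, C_neg, C_neg]; simp; ring
  simp only [momentMean, LinearMap.comp_apply, AlgHom.toLinearMap_apply, this, map_add,
    dirichletMean_C_mul, dirichletMean_X_zero_mul, dirichletMean_X_one_mul]
  ring

lemma momentMean_X_four_mul (α β c : ℂ) (N : Poly) : momentMean K α β c (X 4 * N)
    = -(K.prod 1 3 * (β / c)) * momentMean K α (β + 1) (c + 1) N := by
  have : paramHom K (X 4 * N) = C (-K.prod 1 3) * (X 1 * paramHom K N) := by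
    rw [paramHom_X_mul, C_neg]; simp [mul_assoc]
  simp only [momentMean, LinearMap.comp_apply, AlgHom.toLinearMap_apply, this,
    dirichletMean_C_mul, dirichletMean_X_one_mul]
  ring

lemma momentMean_X_five_mul (α β c : ℂ) (N : Poly) : momentMean K α β c (X 5 * N)
    = -(K.prod 0 4 * (α / c)) * momentMean K (α + 1) β (c + 1) N := by
  have : paramHom K (X 5 * N) = C (-K.prod 0 4) * (X 0 * paramHom K N) := by
    rw [paramHom_X_mul, C_neg]; simp [mul_assoc]
  simp only [momentMean, LinearMap.comp_apply, AlgHom.toLinearMap_apply, this,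
    dirichletMean_C_mul, dirichletMean_X_zero_mul]
  ring

lemma loopMean_eq {n x c : ℂ} (hx : 0 < x.re) (R : ℕ) (N : Poly) :
    loopMean K n x c R N = ∑ r ∈ Finset.range R,
      (2 * K.prod 0 1) ^ r * rising x r / (r.factorial * 4 ^ r * rising c (2 * r))
        * momentMean K (x + r) (x + r) (c + (2 * r : ℕ)) ((box K n)^[r] N) := by
  refine Finset.sum_congr rfl fun r _ => ?_
  rw [paramMean_eq]
  have := rising_ne_zero hx r
  simp only [momentMean, LinearMap.comp_apply, AlgHom.toLinearMap_apply]
  field_simp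

/-! ### The d'Alembertians of the numerators -/

lemma box_ofNat (n : ℂ) (m : ℕ) [m.AtLeastTwo] :
    box K n (ofNat(m) : Poly) = 0 := by
  rw [← map_ofNat (C : ℂ →+* Poly), box_C]

lemma gradPair_ofNat_left (m : ℕ) [m.AtLeastTwo] (N : Poly) :
    gradPair K (ofNat(m) : Poly) N = 0 := by
  rw [← map_ofNat (C : ℂ →+* Poly), gradPair_C_left]

lemma gradPair_ofNat_right (m : ℕ) [m.AtLeastTwo] (N : Poly) :
    gradPair K N (ofNat(m) : Poly) = 0 := by
  rw [← map_ofNat (C : ℂ →+* Poly), gradPair_C_right]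

lemma box_neg (n : ℂ) (N : Poly) : box K n (-N) = -box K n N := by
  have := box_C_mul K n (-1) N
  simpa using this

lemma box_sub (n : ℂ) (M N : Poly) : box K n (M - N) = box K n M - box K n N := by
  rw [sub_eq_add_neg, box_add, box_neg, sub_eq_add_neg]

lemma gradPair_neg_left (M N : Poly) : gradPair K (-M) N = -gradPair K M N := by
  have := gradPair_mul_left K (C (-1)) M N
  rw [gradPair_C_left] at this
  simpa using this

lemma gradPair_neg_right (M N : Poly) : gradPair K M (-N) = -gradPair K M N := by
  rw [gradPair_comm, gradPair_neg_left, gradPair_comm]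

lemma gradPair_sub_left (M M' N : Poly) :
    gradPair K (M - M') N = gradPair K M N - gradPair K M' N := by
  rw [sub_eq_add_neg, gradPair_add_left, gradPair_neg_left, sub_eq_add_neg]

lemma gradPair_sub_right (M N N' : Poly) :
    gradPair K M (N - N') = gradPair K M N - gradPair K M N' := by
  rw [sub_eq_add_neg, gradPair_add_right, gradPair_neg_right, sub_eq_add_neg]

lemma box_X_one (n : ℂ) : box K n (X 1) = 0 := box_X_succ K n 0
lemma box_X_two (n : ℂ) : box K n (X 2) = 0 := box_X_succ K n 1
lemma box_X_three (n : ℂ) : box K n (X 3) = 0 := box_X_succ K n 2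
lemma box_X_four (n : ℂ) : box K n (X 4) = 0 := box_X_succ K n 3
lemma box_X_five (n : ℂ) : box K n (X 5) = 0 := box_X_succ K n 4

/-- The d'Alembertian of `triangleNumerator`. -/
def triangleNumeratorBox (n : ℂ) : Poly :=
  let s : Poly := C (K.prod 0 1)
  let d₁ : Poly := C (K.prod 0 2)
  let d₂ : Poly := C (K.prod 1 2)
  let a : Poly := C (K.prod 1 3)
  let b : Poly := C (K.prod 0 4)
  let u : Poly := C (K.prod 2 3)
  let v : Poly := C (K.prod 2 4)
  let w : Poly := C (K.prod 3 4)
  u * v * ((24 - 10 * C n) * s - (4 * C n + 4) * X 0 - (6 * C n + 4) * (X 1 + X 2))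
    + w * ((8 - 10 * C n) * X 3 ^ 2 + (4 - 10 * C n) * (d₁ + d₂) * X 3
      + (40 - 18 * C n) * d₁ * d₂ - 12 * d₁ ^ 2 - 12 * d₂ ^ 2)
    + v * ((40 - 14 * C n) * X 3 * X 4 + (2 * C n + 8) * a * X 3
      + ((24 - 6 * C n) * d₁ + (20 - 8 * C n) * d₂) * X 4 + (10 * C n - 24) * d₁ * a
      + 12 * d₂ * a)
    + u * ((40 - 14 * C n) * X 3 * X 5 + (2 * C n + 8) * b * X 3
      + ((20 - 8 * C n) * d₁ + (24 - 6 * C n) * d₂) * X 5 + (10 * C n - 24) * d₂ * b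
      + 12 * d₁ * b)

variable {K}

/-- The scalar products of the gradients of the variables, on shell. -/
lemma Kinematics.OnShell.gradPair_X (hK : K.OnShell) (i j : Fin 6) : gradPair K (X i) (X j) =
    ![![4 * X 0, 2 * X 1, 2 * X 2, 2 * X 3, 2 * X 4, 2 * X 5],
      ![2 * X 1, 0, C (K.prod 0 1), C (K.prod 0 2), 0, C (K.prod 0 4)],
      ![2 * X 2, C (K.prod 0 1), 0, C (K.prod 1 2), C (K.prod 1 3), 0],
      ![2 * X 3, C (K.prod 0 2), C (K.prod 1 2), 0, C (K.prod 2 3), C (K.prod 2 4)],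
      ![2 * X 4, 0, C (K.prod 1 3), C (K.prod 2 3), C (K.prod 3 3), C (K.prod 3 4)],
      ![2 * X 5, C (K.prod 0 4), 0, C (K.prod 2 4), C (K.prod 3 4), C (K.prod 4 4)]] i j := by
  rw [GluonOneLoop.gradPair_X, hK.gram_eq]
  fin_cases i <;> fin_cases j <;> simp

set_option maxRecDepth 4000 in
lemma box_triangleNumerator (hK : K.OnShell) (n : ℂ) :
    box K n (triangleNumerator K n) = triangleNumeratorBox K n := by
  simp only [triangleNumerator, triangleNumeratorBox, pow_two, box_add, box_sub, box_neg, box_mul,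
    box_C, box_ofNat, box_X_zero, box_X_one, box_X_two, box_X_three, box_X_four, box_X_five,
    gradPair_add_left, gradPair_add_right, gradPair_sub_left, gradPair_sub_right,
    gradPair_neg_right, gradPair_mul_left, gradPair_mul_right, gradPair_C_left,
      gradPair_C_right, gradPair_ofNat_left, gradPair_ofNat_right, hK.gradPair_X,
    mul_zero, add_zero, zero_add, sub_zero, neg_zero]
  simp only [Matrix.cons_val, C_mul, map_ofNat]
  ring

lemma box_triangleNumeratorBox (hK : K.OnShell) (n : ℂ) :
    box K n (triangleNumeratorBox K n)
      = C ((160 - 64 * n - 8 * n ^ 2) * K.prod 2 3 * K.prod 2 4) := by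
  simp only [triangleNumeratorBox, pow_two, box_add, box_sub, box_mul,
    box_C, box_ofNat, box_X_zero, box_X_one, box_X_two, box_X_three, box_X_four, box_X_five,
    gradPair_add_left, gradPair_add_right, gradPair_sub_left, gradPair_sub_right,
    gradPair_mul_left, gradPair_mul_right,
    gradPair_C_left,
      gradPair_C_right, gradPair_ofNat_left, gradPair_ofNat_right, hK.gradPair_X,
    mul_zero, add_zero, zero_add, sub_zero]
  simp only [Matrix.cons_val, C_mul, C_sub, map_ofNat]
  ring

lemma box_bubbleNumerator (hK : K.OnShell) (n : ℂ) :
    box K n (bubbleNumerator K n) = C ((4 * n - 8) * K.prod 2 3 * K.prod 2 4) := by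
  simp only [bubbleNumerator, box_add, box_sub, box_mul,
    box_C, box_ofNat, box_X_zero, box_X_one, box_X_two, box_X_three, box_X_four, box_X_five,
    gradPair_add_left, gradPair_add_right, gradPair_sub_left,
    gradPair_mul_left, gradPair_mul_right,
    gradPair_C_left,
      gradPair_C_right, gradPair_ofNat_left, gradPair_ofNat_right, hK.gradPair_X,
    mul_zero, add_zero, zero_add, sub_zero]
  simp only [Matrix.cons_val, C_mul, C_sub, map_ofNat]
  ring

end Evaluation

/-! ### The means of the numerators -/

section Means

open MvPolynomial

variable (K : Kinematics d)

lemma momentMean_ofNat_mul (α β c : ℂ) (m : ℕ) [m.AtLeastTwo] (N : Poly) :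
    momentMean K α β c ((ofNat(m) : Poly) * N) = ofNat(m) * momentMean K α β c N := by
  rw [← map_ofNat (C : ℂ →+* Poly), momentMean_C_mul]

lemma momentMean_one (α β c : ℂ) : momentMean K α β c 1 = 1 := by
  rw [← C_1, momentMean_C]

lemma momentMean_X_zero (α β c : ℂ) : momentMean K α β c (X 0)
    = 2 * K.prod 0 1 * (α / c * (β / (c + 1))) := by
  simpa [momentMean_one] using momentMean_X_zero_mul K α β c 1

lemma momentMean_X_one (α β c : ℂ) : momentMean K α β c (X 1) = -(K.prod 0 1 * (β / c)) := by
  simpa [momentMean_one] using momentMean_X_one_mul K α β c 1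

lemma momentMean_X_two (α β c : ℂ) : momentMean K α β c (X 2) = -(K.prod 0 1 * (α / c)) := by
  simpa [momentMean_one] using momentMean_X_two_mul K α β c 1

lemma momentMean_X_three (α β c : ℂ) : momentMean K α β c (X 3)
    = -(K.prod 0 2 * (α / c)) - K.prod 1 2 * (β / c) := by
  simpa [momentMean_one] using momentMean_X_three_mul K α β c 1

lemma momentMean_X_four (α β c : ℂ) : momentMean K α β c (X 4) = -(K.prod 1 3 * (β / c)) := by
  simpa [momentMean_one] using momentMean_X_four_mul K α β c 1

lemma momentMean_X_five (α β c : ℂ) : momentMean K α β c (X 5) = -(K.prod 0 4 * (α / c)) := by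
  simpa [momentMean_one] using momentMean_X_five_mul K α β c 1

variable {K}

/-- The bubble in `4 + 2 e` dimensions. -/
lemma loopMean_bubbleNumerator (hK : K.OnShell) {e : ℂ} (he : 0 < e.re) :
    loopMean K (2 * (e + 2)) (e + 1) (2 * e + 2) 2 (bubbleNumerator K (2 * (e + 2)))
      = (1 + e) / (3 + 2 * e) * (4 * K.prod 0 1 * K.prod 2 3 * K.prod 2 4
        + (1 + 2 * e) * K.prod 3 4 * (K.prod 0 2 - K.prod 1 2) ^ 2
        - (K.prod 0 2 - K.prod 1 2)
          * (K.prod 1 3 * K.prod 2 4 - K.prod 0 4 * K.prod 2 3)) := by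
  have h1 : e + 1 ≠ 0 := by intro h; have := congrArg Complex.re h; simp at this; linarith
  have h3 : 2 * e + 3 ≠ 0 := by intro h; have := congrArg Complex.re h; simp at this; linarith
  rw [loopMean_eq K (by simp; linarith), Finset.sum_range_succ, Finset.sum_range_succ,
    Finset.sum_range_zero]
  simp only [Function.iterate_succ, Function.comp_apply, Function.iterate_zero, id,
    box_bubbleNumerator hK, momentMean_C]
  simp only [bubbleNumerator, mul_add, add_mul, sub_mul, mul_sub, mul_assoc, map_add, map_sub,
    momentMean_C_mul, momentMean_X_three_mul, momentMean_ofNat_mul,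
    momentMean_C, momentMean_X_zero, momentMean_X_one, momentMean_X_two, momentMean_X_three,
    momentMean_X_four, momentMean_X_five]
  simp only [rising_succ, rising_zero, Nat.factorial, show 2 * 1 = 1 + 1 by rfl, mul_zero,
    Nat.cast_zero, Nat.cast_one, mul_one, add_zero]
  have e2 : 2 * e + 2 = 2 * (e + 1) := by ring
  have e3 : 2 * (e + 1) + 1 = 2 * e + 3 := by ring
  rw [show 3 + 2 * e = 2 * e + 3 by ring, e2, e3]
  field_simp
  ring

/-- The mean of the triangle numerator in terms of the moments `mᵢⱼ` of `yⁱ zʲ`. -/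
lemma momentMean_triangleNumerator (n e c : ℂ) {m10 m11 m20 m21 m22 m30 m31 : ℂ}
    (h10 : m10 = e / c) (h20 : m20 = m10 * ((e + 1) / (c + 1))) (h11 : m11 = m10 * (e / (c + 1)))
    (h21 : m21 = m20 * (e / (c + 2))) (h30 : m30 = m20 * ((e + 2) / (c + 2)))
    (h22 : m22 = m21 * ((e + 1) / (c + 3))) (h31 : m31 = m30 * (e / (c + 3))) :
    momentMean K e e c (triangleNumerator K n)
      = K.prod 2 3 * K.prod 2 4 * K.prod 0 1 ^ 2 *
          (-4 * m22 + 12 * m21 - 10 * m11 - 4 * (m20 + m11) + 12 * m10 - 4)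
      - K.prod 3 4 * K.prod 0 1 *
          (2 * ((K.prod 0 2 ^ 2 + K.prod 1 2 ^ 2) * m31 + 2 * K.prod 0 2 * K.prod 1 2 * m22)
          - 2 * ((K.prod 0 2 ^ 2 + K.prod 1 2 ^ 2) * (m30 + m21)
            + 4 * K.prod 0 2 * K.prod 1 2 * m21)
          + 8 * ((K.prod 0 2 ^ 2 + K.prod 1 2 ^ 2) * m20 + 2 * K.prod 0 2 * K.prod 1 2 * m11)
          - (K.prod 0 2 + K.prod 1 2) ^ 2 * (2 * m21 + 4 * m10)
          - 2 * (K.prod 0 2 - K.prod 1 2) ^ 2 * (m20 - m11)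
          + K.prod 0 2 * K.prod 1 2 * (10 * m11 - 4 * m10 + 4))
      + K.prod 2 4 * K.prod 1 3 * K.prod 0 1 *
          (2 * (K.prod 0 2 * m22 + K.prod 1 2 * m31) - 2 * (K.prod 0 2 * m21 + K.prod 1 2 * m30)
          - 2 * (K.prod 0 2 + K.prod 1 2) * m21 + 8 * (K.prod 0 2 * m11 + K.prod 1 2 * m20)
          - 2 * (K.prod 0 2 + K.prod 1 2) * m21 + 2 * (K.prod 0 2 - K.prod 1 2) * (m20 - m11)
          - K.prod 0 2 * (2 * m21 - 2 * m20 + 2 * m11) + 4 * K.prod 1 2 * m11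
          - 4 * (K.prod 0 2 + K.prod 1 2) * m10 + K.prod 0 2 * (10 * m11 - 8 * m10 + 4))
      + K.prod 2 3 * K.prod 0 4 * K.prod 0 1 *
          (2 * (K.prod 1 2 * m22 + K.prod 0 2 * m31) - 2 * (K.prod 1 2 * m21 + K.prod 0 2 * m30)
          - 2 * (K.prod 0 2 + K.prod 1 2) * m21 + 8 * (K.prod 1 2 * m11 + K.prod 0 2 * m20)
          - 2 * (K.prod 0 2 + K.prod 1 2) * m21 + 2 * (K.prod 1 2 - K.prod 0 2) * (m20 - m11)
          - K.prod 1 2 * (2 * m21 - 2 * m20 + 2 * m11) + 4 * K.prod 0 2 * m11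
          - 4 * (K.prod 0 2 + K.prod 1 2) * m10 + K.prod 1 2 * (10 * m11 - 8 * m10 + 4))
      + K.prod 1 3 * K.prod 0 4 *
          ((8 - 4 * n) * ((K.prod 0 2 ^ 2 + K.prod 1 2 ^ 2) * m31
              + 2 * K.prod 0 2 * K.prod 1 2 * m22 - (K.prod 0 2 + K.prod 1 2) ^ 2 * m21)
          + ((16 - 4 * n) * K.prod 0 2 * K.prod 1 2 - 4 * K.prod 0 2 ^ 2 - 4 * K.prod 1 2 ^ 2) * m11
          + 8 * ((K.prod 0 2 ^ 2 + K.prod 1 2 ^ 2) * m20 + 2 * K.prod 0 2 * K.prod 1 2 * m11)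
          - 16 * K.prod 0 2 * K.prod 1 2 * m11
          - 8 * (K.prod 0 2 ^ 2 + K.prod 1 2 ^ 2) * m20) := by
  subst h22 h31 h21 h30 h20 h11 h10
  simp only [triangleNumerator, pow_two, mul_add, add_mul, sub_mul, mul_sub,
    mul_assoc, neg_mul, mul_neg, map_add, map_sub, map_neg,
    momentMean_C_mul, momentMean_X_zero_mul, momentMean_X_one_mul, momentMean_X_two_mul,
    momentMean_X_three_mul, momentMean_X_four_mul, momentMean_X_five_mul, momentMean_ofNat_mul,
    momentMean_C, momentMean_X_zero, momentMean_X_one, momentMean_X_two, momentMean_X_three,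
    momentMean_X_four, momentMean_X_five]
  ring

lemma momentMean_triangleNumeratorBox (n e c : ℂ) {m10 m11 m20 : ℂ}
    (h10 : m10 = e / c) (h20 : m20 = m10 * ((e + 1) / (c + 1))) (h11 : m11 = m10 * (e / (c + 1))) :
    momentMean K e e c (triangleNumeratorBox K n)
      = K.prod 2 3 * K.prod 2 4 * K.prod 0 1 *
          (24 - 10 * n - (8 * n + 8) * m11 + (12 * n + 8) * m10)
      + K.prod 3 4 *
          ((8 - 10 * n) * ((K.prod 0 2 ^ 2 + K.prod 1 2 ^ 2) * m20
              + 2 * K.prod 0 2 * K.prod 1 2 * m11)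
          - (4 - 10 * n) * (K.prod 0 2 + K.prod 1 2) ^ 2 * m10
          + (40 - 18 * n) * K.prod 0 2 * K.prod 1 2 - 12 * (K.prod 0 2 ^ 2 + K.prod 1 2 ^ 2))
      + K.prod 2 4 * K.prod 1 3 *
          ((40 - 14 * n) * (K.prod 0 2 * m11 + K.prod 1 2 * m20)
          - (2 * n + 8) * (K.prod 0 2 + K.prod 1 2) * m10
          - ((24 - 6 * n) * K.prod 0 2 + (20 - 8 * n) * K.prod 1 2) * m10
          + (10 * n - 24) * K.prod 0 2 + 12 * K.prod 1 2)
      + K.prod 2 3 * K.prod 0 4 *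
          ((40 - 14 * n) * (K.prod 1 2 * m11 + K.prod 0 2 * m20)
          - (2 * n + 8) * (K.prod 0 2 + K.prod 1 2) * m10
          - ((24 - 6 * n) * K.prod 1 2 + (20 - 8 * n) * K.prod 0 2) * m10
          + (10 * n - 24) * K.prod 1 2 + 12 * K.prod 0 2) := by
  subst h20 h11 h10
  simp only [triangleNumeratorBox, pow_two, mul_add, add_mul, sub_mul, mul_sub,
    mul_assoc, neg_mul, mul_neg, map_add, map_sub,
    momentMean_C_mul, momentMean_X_three_mul, momentMean_ofNat_mul,
    momentMean_C, momentMean_X_zero, momentMean_X_one, momentMean_X_two, momentMean_X_three,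
    momentMean_X_four, momentMean_X_five]
  ring

/-- The triangle with Feynman-gauge propagators in `4 + 2 e` dimensions. -/
lemma loopMean_triangleNumerator (hK : K.OnShell) {e : ℂ} (he : 0 < e.re) :
    loopMean K (2 * (e + 2)) e (2 * e + 1) 3 (triangleNumerator K (2 * (e + 2)))
        * ((1 + e) * (1 + 2 * e) * (3 + 2 * e) * (2 + e))
      = K.prod 0 1 ^ 2 * K.prod 2 3 * K.prod 2 4
          * (-24 - 48 * e - 72 * e ^ 2 - 52 * e ^ 3 - 12 * e ^ 4)
        + K.prod 0 1 * (K.prod 0 2 ^ 2 + K.prod 1 2 ^ 2) * K.prod 3 4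
          * (2 * e + 17 * e ^ 2 + 18 * e ^ 3 + 5 * e ^ 4)
        - K.prod 0 1 * K.prod 0 2 * K.prod 1 2 * K.prod 3 4
          * (24 + 60 * e + 122 * e ^ 2 + 100 * e ^ 3 + 26 * e ^ 4)
        + K.prod 0 1 * (K.prod 0 2 * K.prod 1 3 * K.prod 2 4 + K.prod 1 2 * K.prod 0 4 * K.prod 2 3)
          * (24 + 54 * e + 87 * e ^ 2 + 64 * e ^ 3 + 15 * e ^ 4)
        + K.prod 0 1 * (K.prod 0 2 * K.prod 0 4 * K.prod 2 3 + K.prod 1 2 * K.prod 1 3 * K.prod 2 4)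
          * (2 * e + 5 * e ^ 2 + 4 * e ^ 3 + e ^ 4)
        + (K.prod 0 2 ^ 2 + K.prod 1 2 ^ 2) * K.prod 1 3 * K.prod 0 4
          * (-8 * e ^ 2 - 4 * e ^ 3 + 4 * e ^ 4 + 2 * e ^ 5)
        + K.prod 0 2 * K.prod 1 2 * K.prod 1 3 * K.prod 0 4
          * (12 * e ^ 2 + 4 * e ^ 3 - 8 * e ^ 4 - 4 * e ^ 5) := by
  have h0 : e ≠ 0 := by intro h; have := congrArg Complex.re h; simp at this; linarith
  have h1 : e + 1 ≠ 0 := by intro h; have := congrArg Complex.re h; simp at this; linarith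
  have h2 : e + 2 ≠ 0 := by intro h; have := congrArg Complex.re h; simp at this; linarith
  have h3 : 2 * e + 1 ≠ 0 := by intro h; have := congrArg Complex.re h; simp at this; linarith
  have h4 : 2 * e + 3 ≠ 0 := by intro h; have := congrArg Complex.re h; simp at this; linarith
  rw [loopMean_eq K he, Finset.sum_range_succ, Finset.sum_range_succ, Finset.sum_range_succ,
    Finset.sum_range_zero]
  simp only [Function.iterate_succ, Function.comp_apply, Function.iterate_zero, id,
    box_triangleNumerator hK, box_triangleNumeratorBox hK, momentMean_C]
  rw [momentMean_triangleNumerator _ _ _ rfl rfl rfl rfl rfl rfl rfl,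
    momentMean_triangleNumeratorBox _ _ _ rfl rfl rfl]
  simp only [rising_succ, rising_zero, Nat.factorial, show 2 * 1 = 1 + 1 by rfl,
    show 2 * 2 = 1 + 1 + 1 + 1 by rfl, mul_zero,
    Nat.cast_zero, Nat.cast_one, Nat.cast_add, Nat.cast_ofNat, mul_one, add_zero]
  have e1 : 2 * e + 1 + (1 + 1) = 2 * e + 3 := by ring
  have e2 : 2 * e + 1 + 1 = 2 * (e + 1) := by ring
  have e3 : 2 * e + 1 + 2 = 2 * e + 3 := by ring
  have e4 : 2 * e + 1 + 3 = 2 * (e + 2) := by ring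
  have e5 : 2 * e + 3 + 1 = 2 * (e + 2) := by ring
  have e6 : 2 * e + 1 + (1 + 2) = 2 * (e + 2) := by ring
  have e7 : e + 1 + 1 = e + 2 := by ring
  rw [show 3 + 2 * e = 2 * e + 3 by ring, add_comm 1 e, add_comm 2 e, add_comm 1 (2 * e)]
  simp only [e1, e2, e3, e4, e5, e6, e7]
  generalize K.prod 0 1 = s, K.prod 0 2 = d₁, K.prod 1 2 = d₂, K.prod 1 3 = a, K.prod 0 4 = b,
    K.prod 2 3 = u, K.prod 2 4 = v, K.prod 3 4 = w
  -- `field_simp` looks for these denominators with the numeral on the right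
  rw [mul_comm] at h3 h4
  field_simp
  ring

end Means

/-! ### The gauge-dependent part of the triangle -/

section Longitudinal

open MvPolynomial

variable {K : Kinematics d}

/-- Iterated d'Alembertians of `D₁ D₂ P Q`, where `D₁ = (k + p₁)²`, `D₂ = (k + p₂)²`, and the
hypotheses describe `P = (k + p₁)·A`, `Q = (k + p₂)·B` with `κ = A·B`, `α = (p₁ - p₂)·A` and
`β = (p₁ - p₂)·B`. -/
lemma iterate_box_pair (hK : K.OnShell) (n : ℂ) {P Q : Poly} {κ α β : ℂ}
    (hP : box K n P = 0) (hQ : box K n Q = 0) (hPQ : gradPair K P Q = C κ)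
    (h1P : gradPair K (X 0 + 2 * X 1) P = 2 * P)
    (h2P : gradPair K (X 0 + 2 * X 2) P = 2 * (P - C α))
    (h1Q : gradPair K (X 0 + 2 * X 1) Q = 2 * (Q + C β))
    (h2Q : gradPair K (X 0 + 2 * X 2) Q = 2 * Q) :
    box K n ((X 0 + 2 * X 1) * (X 0 + 2 * X 2) * (P * Q))
        = (2 * C n + 12) * (P * Q) * ((X 0 + 2 * X 1) + (X 0 + 2 * X 2))
          + 8 * C (K.prod 0 1) * (P * Q)
          + 2 * C κ * ((X 0 + 2 * X 1) * (X 0 + 2 * X 2))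
          - 4 * C α * Q * (X 0 + 2 * X 1) + 4 * C β * P * (X 0 + 2 * X 2)
    ∧ (box K n)^[2] ((X 0 + 2 * X 1) * (X 0 + 2 * X 2) * (P * Q))
        = C ((2 * n + 12) * (4 * n + 16)) * (P * Q)
          + C (16 * n + 64) * (C β * P - C α * Q)
          + C (κ * (8 * n + 32)) * ((X 0 + 2 * X 1) + (X 0 + 2 * X 2))
          + C (32 * K.prod 0 1 * κ - 32 * α * β)
    ∧ (box K n)^[3] ((X 0 + 2 * X 1) * (X 0 + 2 * X 2) * (P * Q))
        = C (48 * κ * (n + 4) * (n + 2)) := by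
  have hD1 : box K n (X 0 + 2 * X 1) = C (2 * n) := by
    simp [box_add, box_mul, box_X_zero, box_X_one, box_ofNat, gradPair_ofNat_left]
  have hD2 : box K n (X 0 + 2 * X 2) = C (2 * n) := by
    simp [box_add, box_mul, box_X_zero, box_X_two, box_ofNat, gradPair_ofNat_left]
  have h12 : gradPair K (X 0 + 2 * X 1) (X 0 + 2 * X 2)
      = 2 * ((X 0 + 2 * X 1) + (X 0 + 2 * X 2)) + 4 * C (K.prod 0 1) := by
    simp only [gradPair_add_left, gradPair_add_right, gradPair_mul_left, gradPair_mul_right,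
      gradPair_ofNat_left, gradPair_ofNat_right, hK.gradPair_X]
    simp; ring
  have hP1 := (gradPair_comm K _ _).trans h1P
  have hP2 := (gradPair_comm K _ _).trans h2P
  have hQ1 := (gradPair_comm K _ _).trans h1Q
  have hQ2 := (gradPair_comm K _ _).trans h2Q
  generalize (X 0 + 2 * X 1 : Poly) = D₁ at *
  generalize (X 0 + 2 * X 2 : Poly) = D₂ at *
  have e1 : box K n (D₁ * D₂ * (P * Q)) = (2 * C n + 12) * (P * Q) * (D₁ + D₂)
      + 8 * C (K.prod 0 1) * (P * Q) + 2 * C κ * (D₁ * D₂)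
      - 4 * C α * Q * D₁ + 4 * C β * P * D₂ := by
    simp only [box_mul, gradPair_mul_left, gradPair_mul_right, hP, hQ, hPQ, hD1, hD2, h1P, h2P,
      h1Q, h2Q, h12, C_mul, map_ofNat]
    ring
  have e2 : box K n ((2 * C n + 12) * (P * Q) * (D₁ + D₂)
      + 8 * C (K.prod 0 1) * (P * Q) + 2 * C κ * (D₁ * D₂)
      - 4 * C α * Q * D₁ + 4 * C β * P * D₂) = C ((2 * n + 12) * (4 * n + 16)) * (P * Q)
          + C (16 * n + 64) * (C β * P - C α * Q)
          + C (κ * (8 * n + 32)) * (D₁ + D₂)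
          + C (32 * K.prod 0 1 * κ - 32 * α * β) := by
    simp only [box_mul, box_add, box_sub, box_C, box_ofNat, gradPair_mul_left, gradPair_mul_right,
      gradPair_add_left, gradPair_add_right, gradPair_C_left, gradPair_ofNat_left,
      hP, hQ, hPQ, hD1, hD2, h12, hP1, hP2, hQ1, hQ2,
      C_mul, C_add, C_sub, map_ofNat]
    ring
  have e3 : box K n (C ((2 * n + 12) * (4 * n + 16)) * (P * Q)
          + C (16 * n + 64) * (C β * P - C α * Q)
          + C (κ * (8 * n + 32)) * (D₁ + D₂)
          + C (32 * K.prod 0 1 * κ - 32 * α * β)) = C (48 * κ * (n + 4) * (n + 2)) := by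
    simp only [box_add, box_sub, box_C_mul, box_C, box_mul _ _ P Q, hP, hQ, hPQ, hD1, hD2]
    simp only [C_mul, C_add, map_ofNat]
    ring
  refine ⟨e1, ?_, ?_⟩
  · rw [Function.iterate_succ_apply, Function.iterate_one, e1, e2]
  · rw [Function.iterate_succ_apply, Function.iterate_succ_apply, Function.iterate_one, e1, e2, e3]

/-- Iterated d'Alembertians of `D₁ D₂ (k + p₁)·(k + p₂)`, where
`(k + p₁)·(k + p₂) = (D₁ + D₂) / 2 + p₁·p₂`. -/
lemma iterate_box_scalar (hK : K.OnShell) (n : ℂ) :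
    box K n ((X 0 + 2 * X 1) * (X 0 + 2 * X 2) * (X 0 + X 1 + X 2 + C (K.prod 0 1)))
        = (C n + 4) * ((X 0 + 2 * X 1) + (X 0 + 2 * X 2)) ^ 2
          + (2 * C n + 12) * C (K.prod 0 1) * ((X 0 + 2 * X 1) + (X 0 + 2 * X 2))
          + 8 * C (K.prod 0 1) ^ 2 + (2 * C n + 8) * ((X 0 + 2 * X 1) * (X 0 + 2 * X 2))
    ∧ (box K n)^[2] ((X 0 + 2 * X 1) * (X 0 + 2 * X 2) * (X 0 + X 1 + X 2 + C (K.prod 0 1)))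
        = C (12 * (n + 4) * (n + 2)) * ((X 0 + 2 * X 1) + (X 0 + 2 * X 2))
          + C (K.prod 0 1 * (8 * n ^ 2 + 80 * n + 128))
    ∧ (box K n)^[3] ((X 0 + 2 * X 1) * (X 0 + 2 * X 2) * (X 0 + X 1 + X 2 + C (K.prod 0 1)))
        = C (48 * n * (n + 4) * (n + 2)) := by
  have e1 : box K n ((X 0 + 2 * X 1) * (X 0 + 2 * X 2) * (X 0 + X 1 + X 2 + C (K.prod 0 1)))
        = (C n + 4) * ((X 0 + 2 * X 1) + (X 0 + 2 * X 2)) ^ 2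
          + (2 * C n + 12) * C (K.prod 0 1) * ((X 0 + 2 * X 1) + (X 0 + 2 * X 2))
          + 8 * C (K.prod 0 1) ^ 2 + (2 * C n + 8) * ((X 0 + 2 * X 1) * (X 0 + 2 * X 2)) := by
    simp only [box_mul, box_add, box_C, box_ofNat, box_X_zero, box_X_one, box_X_two,
      gradPair_add_left, gradPair_add_right, gradPair_mul_left, gradPair_mul_right,
      gradPair_C_right,
      gradPair_ofNat_left, gradPair_ofNat_right, hK.gradPair_X]
    simp only [Matrix.cons_val, C_mul, map_ofNat]
    ring
  have e2 : box K n ((C n + 4) * ((X 0 + 2 * X 1) + (X 0 + 2 * X 2)) ^ 2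
          + (2 * C n + 12) * C (K.prod 0 1) * ((X 0 + 2 * X 1) + (X 0 + 2 * X 2))
          + 8 * C (K.prod 0 1) ^ 2 + (2 * C n + 8) * ((X 0 + 2 * X 1) * (X 0 + 2 * X 2)))
        = C (12 * (n + 4) * (n + 2)) * ((X 0 + 2 * X 1) + (X 0 + 2 * X 2))
          + C (K.prod 0 1 * (8 * n ^ 2 + 80 * n + 128)) := by
    simp only [pow_two, box_mul, box_add, box_C, box_ofNat, box_X_zero, box_X_one, box_X_two,
      gradPair_add_left, gradPair_add_right, gradPair_mul_left, gradPair_mul_right,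
      gradPair_C_left, gradPair_C_right,
      gradPair_ofNat_left, gradPair_ofNat_right, hK.gradPair_X]
    simp only [Matrix.cons_val, C_mul, C_add, map_ofNat]
    ring
  have e3 : box K n (C (12 * (n + 4) * (n + 2)) * ((X 0 + 2 * X 1) + (X 0 + 2 * X 2))
          + C (K.prod 0 1 * (8 * n ^ 2 + 80 * n + 128))) = C (48 * n * (n + 4) * (n + 2)) := by
    simp only [box_mul, box_add, box_C, box_ofNat, box_X_zero, box_X_one, box_X_two,
      gradPair_add_right, gradPair_mul_right, gradPair_C_left,
      gradPair_ofNat_left, gradPair_ofNat_right]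
    simp only [C_mul, C_add, map_ofNat]
    ring
  refine ⟨e1, ?_, ?_⟩
  · rw [Function.iterate_succ_apply, Function.iterate_one, e1, e2]
  · rw [Function.iterate_succ_apply, Function.iterate_succ_apply, Function.iterate_one, e1, e2, e3]

/-- The integral of `D₁ D₂ (k + p₁)·(k + p₂)` over `(k²)² D₁ D₂` is zero, because it is scaleless
before Feynman parameters are introduced. -/
lemma loopMean_scalar (hK : K.OnShell) {x : ℂ} (hx : 0 < x.re) :
    loopMean K (2 * (x + 3)) x (2 * x + 2) 4
        ((X 0 + 2 * X 1) * (X 0 + 2 * X 2) * (X 0 + X 1 + X 2 + C (K.prod 0 1))) = 0 := by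
  have h1 : x + 1 ≠ 0 := by intro h; have := congrArg Complex.re h; simp at this; linarith
  have h2 : x + 2 ≠ 0 := by intro h; have := congrArg Complex.re h; simp at this; linarith
  have h3 : x + 3 ≠ 0 := by intro h; have := congrArg Complex.re h; simp at this; linarith
  have h4 : x * 2 + 3 ≠ 0 := by intro h; have := congrArg Complex.re h; simp at this; linarith
  have h5 : x * 2 + 5 ≠ 0 := by intro h; have := congrArg Complex.re h; simp at this; linarith
  have h6 : x * 2 + 7 ≠ 0 := by intro h; have := congrArg Complex.re h; simp at this; linarith
  obtain ⟨b1, b2, b3⟩ := iterate_box_scalar hK (2 * (x + 3))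
  rw [loopMean_eq K hx, Finset.sum_range_succ, Finset.sum_range_succ, Finset.sum_range_succ,
    Finset.sum_range_succ, Finset.sum_range_zero, Function.iterate_zero, Function.iterate_one,
    b1, b2, b3]
  clear b1 b2 b3
  simp only [id, pow_two, mul_add, add_mul, mul_assoc, map_add,
    momentMean_C_mul, momentMean_X_zero_mul, momentMean_X_one_mul, momentMean_X_two_mul,
    momentMean_ofNat_mul, momentMean_C, momentMean_X_zero, momentMean_X_one, momentMean_X_two]
  generalize K.prod 0 1 = s
  simp only [rising_succ, rising_zero, Nat.factorial, show 2 * 1 = 1 + 1 by rfl,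
    show 2 * 2 = 1 + 1 + 1 + 1 by rfl, show 2 * 3 = 1 + 1 + 1 + 1 + 1 + 1 by rfl, mul_zero,
    Nat.cast_zero, Nat.cast_one, Nat.cast_add, Nat.cast_ofNat, mul_one, add_zero]
  simp only [add_assoc (2 * x), add_assoc x]
  norm_num only
  have e4 : 2 * x + 4 = 2 * (x + 2) := by ring
  have e6 : 2 * x + 6 = 2 * (x + 3) := by ring
  have e2 : 2 * x + 2 = 2 * (x + 1) := by ring
  simp only [e2, e4, e6]
  have h7 : 2 * x + 3 ≠ 0 := by rwa [mul_comm]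
  have h8 : 2 * x + 5 ≠ 0 := by rwa [mul_comm]
  have h9 : 2 * x + 7 ≠ 0 := by rwa [mul_comm]
  field_simp
  ring

/-- The integral of `D₁ D₂ (k + p₁)·A (k + p₂)·B` over `(k²)² D₁ D₂` is zero; here `Aᵢ = pᵢ·A`,
`Bᵢ = pᵢ·B`, and `mP`, `mQ` are the values of the factors at `k = -(y p₁ + z p₂)`. -/
lemma loopMean_pair (hK : K.OnShell) {x : ℂ} (hx : 0 < x.re) {P Q : Poly} {κ A₁ A₂ B₁ B₂ : ℂ}
    (hP : box K (2 * (x + 3)) P = 0) (hQ : box K (2 * (x + 3)) Q = 0) (hPQ : gradPair K P Q = C κ)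
    (h1P : gradPair K (X 0 + 2 * X 1) P = 2 * P)
    (h2P : gradPair K (X 0 + 2 * X 2) P = 2 * (P - C (A₁ - A₂)))
    (h1Q : gradPair K (X 0 + 2 * X 1) Q = 2 * (Q + C (B₁ - B₂)))
    (h2Q : gradPair K (X 0 + 2 * X 2) Q = 2 * Q)
    (mP : ∀ (α β c : ℂ) (N : Poly), momentMean K α β c (P * N) = A₁ * momentMean K α β c N
      - A₁ * (α / c) * momentMean K (α + 1) β (c + 1) N
      - A₂ * (β / c) * momentMean K α (β + 1) (c + 1) N)
    (mQ : ∀ (α β c : ℂ) (N : Poly), momentMean K α β c (Q * N) = B₂ * momentMean K α β c N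
      - B₁ * (α / c) * momentMean K (α + 1) β (c + 1) N
      - B₂ * (β / c) * momentMean K α (β + 1) (c + 1) N) :
    loopMean K (2 * (x + 3)) x (2 * x + 2) 4 ((X 0 + 2 * X 1) * (X 0 + 2 * X 2) * (P * Q)) = 0 := by
  have h1 : x + 1 ≠ 0 := by intro h; have := congrArg Complex.re h; simp at this; linarith
  have h2 : x + 2 ≠ 0 := by intro h; have := congrArg Complex.re h; simp at this; linarith
  have h3 : x + 3 ≠ 0 := by intro h; have := congrArg Complex.re h; simp at this; linarith
  have h4 : x * 2 + 3 ≠ 0 := by intro h; have := congrArg Complex.re h; simp at this; linarith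
  have h5 : x * 2 + 5 ≠ 0 := by intro h; have := congrArg Complex.re h; simp at this; linarith
  have h6 : x * 2 + 7 ≠ 0 := by intro h; have := congrArg Complex.re h; simp at this; linarith
  have mP1 : ∀ α β c : ℂ, momentMean K α β c P = A₁ - A₁ * (α / c) - A₂ * (β / c) := by
    intro α β c; simpa [momentMean_one] using mP α β c 1
  have mQ1 : ∀ α β c : ℂ, momentMean K α β c Q = B₂ - B₁ * (α / c) - B₂ * (β / c) := by
    intro α β c; simpa [momentMean_one] using mQ α β c 1
  obtain ⟨b1, b2, b3⟩ := iterate_box_pair hK (2 * (x + 3)) hP hQ hPQ h1P h2P h1Q h2Q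
  rw [loopMean_eq K hx, Finset.sum_range_succ, Finset.sum_range_succ, Finset.sum_range_succ,
    Finset.sum_range_succ, Finset.sum_range_zero, Function.iterate_zero, Function.iterate_one,
    b1, b2, b3]
  clear b1 b2 b3
  simp only [id, pow_two, mul_add, add_mul, mul_sub, sub_mul, mul_assoc, map_add, map_sub,
    mP, mQ, mP1, mQ1,
    momentMean_C_mul, momentMean_X_zero_mul, momentMean_X_one_mul, momentMean_X_two_mul,
    momentMean_ofNat_mul, momentMean_C, momentMean_X_zero, momentMean_X_one, momentMean_X_two]
  generalize K.prod 0 1 = s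
  simp only [rising_succ, rising_zero, Nat.factorial, show 2 * 1 = 1 + 1 by rfl,
    show 2 * 2 = 1 + 1 + 1 + 1 by rfl, show 2 * 3 = 1 + 1 + 1 + 1 + 1 + 1 by rfl, mul_zero,
    Nat.cast_zero, Nat.cast_one, Nat.cast_add, Nat.cast_ofNat, mul_one, add_zero]
  simp only [add_assoc (2 * x), add_assoc x]
  norm_num only
  have e4 : 2 * x + 4 = 2 * (x + 2) := by ring
  have e6 : 2 * x + 6 = 2 * (x + 3) := by ring
  have e2 : 2 * x + 2 = 2 * (x + 1) := by ring
  simp only [e2, e4, e6]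
  have h7 : 2 * x + 3 ≠ 0 := by rwa [mul_comm]
  have h8 : 2 * x + 5 ≠ 0 := by rwa [mul_comm]
  have h9 : 2 * x + 7 ≠ 0 := by rwa [mul_comm]
  field_simp
  ring

end Longitudinal

section Longitudinal

open MvPolynomial

variable {K : Kinematics d}

lemma loopMean_add (n x c : ℂ) (R : ℕ) (M N : Poly) :
    loopMean K n x c R (M + N) = loopMean K n x c R M + loopMean K n x c R N := by
  simp only [loopMean, iterate_box_add, map_add, mul_add, Finset.sum_add_distrib]

/-- The operator vertex between the denominators `D₁ = (k + p₁)²` and `D₂ = (k + p₂)²`, as a linear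
combination of terms `D₁ D₂ (k + p₁)·A (k + p₂)·B` and `D₁ D₂ (k + p₁)·(k + p₂)`. -/
lemma longitudinal_eq : (X 0 + 2 * X 1) * (X 0 + 2 * X 2) * operatorForm K
    = C (K.prod 2 4) *
        ((X 0 + 2 * X 1) * (X 0 + 2 * X 2) * ((X 3 + C (K.prod 0 2)) * (X 4 + C (K.prod 1 3))))
      + (C (K.prod 2 3) *
        ((X 0 + 2 * X 1) * (X 0 + 2 * X 2) * ((X 5 + C (K.prod 0 4)) * (X 3 + C (K.prod 1 2))))
      + (C (-K.prod 3 4) *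
        ((X 0 + 2 * X 1) * (X 0 + 2 * X 2) * ((X 3 + C (K.prod 0 2)) * (X 3 + C (K.prod 1 2))))
      + C (-(K.prod 2 3 * K.prod 2 4)) *
        ((X 0 + 2 * X 1) * (X 0 + 2 * X 2) * (X 0 + X 1 + X 2 + C (K.prod 0 1))))) := by
  simp only [operatorForm, C_neg, C_mul]; ring

/-- The gauge-dependent part of the triangle is zero. -/
lemma longitudinal_zero (hK : K.OnShell) {x : ℂ} (hx : 0 < x.re) :
    (box K (2 * (x + 3)))^[4] ((X 0 + 2 * X 1) * (X 0 + 2 * X 2) * operatorForm K) = 0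
    ∧ loopMean K (2 * (x + 3)) x (2 * x + 2) 4
        ((X 0 + 2 * X 1) * (X 0 + 2 * X 2) * operatorForm K) = 0 := by
  set n := 2 * (x + 3) with hn
  have hbox : ∀ z : ℂ, box K n (X 3 + C z) = 0 ∧ box K n (X 4 + C z) = 0
      ∧ box K n (X 5 + C z) = 0 := fun z => by
    simp [box_add, box_C, box_X_three, box_X_four, box_X_five]
  have hP : ∀ (α β c : ℂ) (N : Poly), momentMean K α β c ((X 3 + C (K.prod 0 2)) * N)
      = K.prod 0 2 * momentMean K α β c N
      - K.prod 0 2 * (α / c) * momentMean K (α + 1) β (c + 1) N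
      - K.prod 1 2 * (β / c) * momentMean K α (β + 1) (c + 1) N := fun α β c N => by
    rw [add_mul, map_add, momentMean_X_three_mul, momentMean_C_mul]; ring
  have hP' : ∀ (α β c : ℂ) (N : Poly), momentMean K α β c ((X 5 + C (K.prod 0 4)) * N)
      = K.prod 0 4 * momentMean K α β c N
      - K.prod 0 4 * (α / c) * momentMean K (α + 1) β (c + 1) N
      - 0 * (β / c) * momentMean K α (β + 1) (c + 1) N := fun α β c N => by
    rw [add_mul, map_add, momentMean_X_five_mul, momentMean_C_mul]; ring
  have hQ : ∀ (α β c : ℂ) (N : Poly), momentMean K α β c ((X 3 + C (K.prod 1 2)) * N)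
      = K.prod 1 2 * momentMean K α β c N
      - K.prod 0 2 * (α / c) * momentMean K (α + 1) β (c + 1) N
      - K.prod 1 2 * (β / c) * momentMean K α (β + 1) (c + 1) N := fun α β c N => by
    rw [add_mul, map_add, momentMean_X_three_mul, momentMean_C_mul]; ring
  have hQ' : ∀ (α β c : ℂ) (N : Poly), momentMean K α β c ((X 4 + C (K.prod 1 3)) * N)
      = K.prod 1 3 * momentMean K α β c N
      - 0 * (α / c) * momentMean K (α + 1) β (c + 1) N
      - K.prod 1 3 * (β / c) * momentMean K α (β + 1) (c + 1) N := fun α β c N => by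
    rw [add_mul, map_add, momentMean_X_four_mul, momentMean_C_mul]; ring
  have g : ∀ (i j l : Fin 6) (z : ℂ), gradPair K (X i + 2 * X j) (X l + C z)
      = gradPair K (X i) (X l) + 2 * gradPair K (X j) (X l) := fun i j l z => by
    rw [gradPair_add_right, gradPair_C_right, gradPair_add_left, gradPair_mul_left,
      gradPair_ofNat_left]; ring
  have g' : ∀ (i j : Fin 6) (y z : ℂ), gradPair K (X i + C y) (X j + C z)
      = gradPair K (X i) (X j) := fun i j y z => by
    rw [gradPair_add_right, gradPair_C_right, gradPair_add_left, gradPair_C_left]; ring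
  have a1 : gradPair K (X 0 + 2 * X 1) (X 3 + C (K.prod 0 2)) = 2 * (X 3 + C (K.prod 0 2)) := by
    rw [g]; simp [hK.gradPair_X]; ring
  have a2 : gradPair K (X 0 + 2 * X 2) (X 3 + C (K.prod 0 2))
      = 2 * (X 3 + C (K.prod 0 2) - C (K.prod 0 2 - K.prod 1 2)) := by
    rw [g]; simp [hK.gradPair_X]; ring
  have a3 : gradPair K (X 0 + 2 * X 1) (X 3 + C (K.prod 1 2))
      = 2 * (X 3 + C (K.prod 1 2) + C (K.prod 0 2 - K.prod 1 2)) := by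
    rw [g]; simp [hK.gradPair_X]; ring
  have a4 : gradPair K (X 0 + 2 * X 2) (X 3 + C (K.prod 1 2)) = 2 * (X 3 + C (K.prod 1 2)) := by
    rw [g]; simp [hK.gradPair_X]; ring
  have a5 : gradPair K (X 0 + 2 * X 1) (X 4 + C (K.prod 1 3))
      = 2 * (X 4 + C (K.prod 1 3) + C (0 - K.prod 1 3)) := by
    rw [g]; simp [hK.gradPair_X]
  have a6 : gradPair K (X 0 + 2 * X 2) (X 4 + C (K.prod 1 3)) = 2 * (X 4 + C (K.prod 1 3)) := by
    rw [g]; simp [hK.gradPair_X]; ring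
  have a7 : gradPair K (X 0 + 2 * X 1) (X 5 + C (K.prod 0 4)) = 2 * (X 5 + C (K.prod 0 4)) := by
    rw [g]; simp [hK.gradPair_X]; ring
  have a8 : gradPair K (X 0 + 2 * X 2) (X 5 + C (K.prod 0 4))
      = 2 * (X 5 + C (K.prod 0 4) - C (K.prod 0 4 - 0)) := by
    rw [g]; simp [hK.gradPair_X]
  have k1 : gradPair K (X 3 + C (K.prod 0 2)) (X 4 + C (K.prod 1 3)) = C (K.prod 2 3) := by
    rw [g']; simp [hK.gradPair_X]
  have k2 : gradPair K (X 5 + C (K.prod 0 4)) (X 3 + C (K.prod 1 2)) = C (K.prod 2 4) := by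
    rw [g']; simp [hK.gradPair_X]
  have k3 : gradPair K (X 3 + C (K.prod 0 2)) (X 3 + C (K.prod 1 2)) = C 0 := by
    rw [g']; simp [hK.gradPair_X]
  constructor
  · have z : ∀ N : Poly, (∃ z : ℂ, (box K n)^[3] N = C z) → (box K n)^[4] N = 0 := by
      rintro N ⟨z, hz⟩
      rw [Function.iterate_succ_apply', hz, box_C]
    rw [longitudinal_eq, iterate_box_add, iterate_box_add, iterate_box_add, iterate_box_C_mul,
      iterate_box_C_mul, iterate_box_C_mul, iterate_box_C_mul,
      z _ ⟨_, (iterate_box_pair hK n (hbox _).1 (hbox _).2.1 k1 a1 a2 a5 a6).2.2⟩,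
      z _ ⟨_, (iterate_box_pair hK n (hbox _).2.2 (hbox _).1 k2 a7 a8 a3 a4).2.2⟩,
      z _ ⟨_, (iterate_box_pair hK n (hbox _).1 (hbox _).1 k3 a1 a2 a3 a4).2.2⟩,
      z _ ⟨_, (iterate_box_scalar hK n).2.2⟩]
    ring
  · rw [longitudinal_eq, loopMean_add, loopMean_add, loopMean_add, loopMean_C_mul,
      loopMean_C_mul, loopMean_C_mul, loopMean_C_mul,
      loopMean_pair hK hx (hbox _).1 (hbox _).2.1 k1 a1 a2 a5 a6 hP hQ',
      loopMean_pair hK hx (hbox _).2.2 (hbox _).1 k2 a7 a8 a3 a4 hP' hQ,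
      loopMean_pair hK hx (hbox _).1 (hbox _).1 k3 a1 a2 a3 a4 hP hQ, loopMean_scalar hK hx]
    ring

end Longitudinal

/-! ### The one-loop amplitude in closed form -/

section Amplitude

open MvPolynomial

variable (K : Kinematics d)

/-- The kinematic factor of the Born vertex. -/
def bornFactor : ℂ :=
  K.prod 0 1 * K.prod 2 3 * K.prod 2 4 - K.prod 1 2 * K.prod 0 4 * K.prod 2 3
    - K.prod 0 2 * K.prod 1 3 * K.prod 2 4 + K.prod 0 2 * K.prod 1 2 * K.prod 3 4

/-- The transverse tensor `ε₁·ε₂ - (p₁·ε₂)(p₂·ε₁) / p₁·p₂`. -/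
def transverse : ℂ := K.prod 3 4 - K.prod 0 4 * K.prod 1 3 / K.prod 0 1

/-- The coefficients of the three form factors in the one-loop amplitude in `4 + 2 e` dimensions,
without the common Gamma functions. -/
def formCoeff (e : ℂ) : Fin 3 → ℂ :=
  ![-(12 + 28 * e + 46 * e ^ 2 + 34 * e ^ 3 + 8 * e ^ 4)
      / (e ^ 2 * (1 + e) * (1 + 2 * e) * (3 + 2 * e) * (2 + e)),
    (2 - e ^ 2) / ((1 + e) * (1 + 2 * e) * (3 + 2 * e)),
    -(6 + 2 * e - 4 * e ^ 2 - 2 * e ^ 3) / ((1 + e) * (1 + 2 * e) * (3 + 2 * e) * (2 + e))]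

/-- The sum of the form factors with their coefficients. -/
def formFactorSum (e : ℂ) : ℂ :=
  formCoeff e 0 * bornFactor K
    + formCoeff e 1 * (transverse K * (K.prod 0 2 ^ 2 + K.prod 1 2 ^ 2))
    + formCoeff e 2 * (transverse K * (K.prod 0 2 * K.prod 1 2))

/-- The Gamma functions of the one-loop amplitude in `4 + 2 e` dimensions. -/
def gammaFactor (e : ℂ) : ℂ :=
  Complex.Gamma (1 - e) * Complex.Gamma (1 + e) ^ 2 / Complex.Gamma (1 + 2 * e)

/-- The one-loop amplitude in `n` dimensions, in closed form. -/
def amplitude (gr μ : ℝ) (a b : Fin 8) (n : ℂ) : ℂ :=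
  3 * kron a b * coupling gr μ n ^ 2 * ((4 * Real.pi : ℝ) : ℂ) ^ (-(n / 2))
    * powI0 (-K.Qsq) (n / 2 - 2) * gammaFactor (n / 2 - 2) * formFactorSum K (n / 2 - 2)

variable {K}

lemma born_eq (a b : Fin 8) : born K a b = kron a b * bornFactor K := by
  have hneg : ∀ u v : Fin (d + 1) → ℂ, mink (-u) v = -mink u v := fun u v => by
    simp [mink, Finset.sum_neg_distrib]; ring
  have hneg' : ∀ u v : Fin (d + 1) → ℂ, mink u (-v) = -mink u v := fun u v => by
    simp [mink, Finset.sum_neg_distrib]; ring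
  have e2 : K.Δ = K.ext 2 := rfl
  have e3 : K.ε₁ = K.ext 3 := rfl
  have e4 : K.ε₂ = K.ext 4 := rfl
  simp only [born, hneg, hneg', e2, e3, e4]
  have hp : ∀ i j, mink (K.ext i) (K.ext j) = K.prod i j := fun _ _ => rfl
  simp only [hp]
  rw [K.prod_comm 2 1, K.prod_comm 2 0, bornFactor]
  ring

lemma newFormFactor_eq : newFormFactor K
    = 2 / 3 * (transverse K * (K.prod 0 2 ^ 2 + K.prod 1 2 ^ 2))
      - transverse K * (K.prod 0 2 * K.prod 1 2) := by
  have e2 : K.Δ = K.ext 2 := rfl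
  have e3 : K.ε₁ = K.ext 3 := rfl
  have e4 : K.ε₂ = K.ext 4 := rfl
  simp only [newFormFactor, e2, e3, e4, transverse]
  have hp : ∀ i j, mink (K.ext i) (K.ext j) = K.prod i j := fun _ _ => rfl
  simp only [hp]
  rw [K.prod_comm 2 1, K.prod_comm 2 0]
  ring

/-- The form factors from the means of the triangle and the bubble. -/
lemma formFactorSum_eq (hK : K.OnShell) {e : ℂ} (he : 0 < e.re) :
    loopMean K (2 * (e + 2)) e (2 * e + 1) 3 (triangleNumerator K (2 * (e + 2)))
        / (2 * K.prod 0 1 * e ^ 2)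
      - loopMean K (2 * (e + 2)) (e + 1) (2 * e + 2) 2 (bubbleNumerator K (2 * (e + 2)))
        / (2 * e * (2 * e + 1)) = formFactorSum K e := by
  have h0 : e ≠ 0 := by rintro rfl; simp at he
  have h1 : 1 + e ≠ 0 := by intro h; have := congrArg Complex.re h; simp at this; linarith
  have h2 : 2 + e ≠ 0 := by intro h; have := congrArg Complex.re h; simp at this; linarith
  have h3 : 1 + 2 * e ≠ 0 := by intro h; have := congrArg Complex.re h; simp at this; linarith
  have h4 : 3 + 2 * e ≠ 0 := by intro h; have := congrArg Complex.re h; simp at this; linarith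
  have hs := hK.prod_ne_zero
  rw [loopMean_bubbleNumerator hK he,
    eq_div_of_mul_eq (by positivity) (loopMean_triangleNumerator hK he)]
  simp only [formFactorSum, formCoeff, bornFactor, transverse, Matrix.cons_val]
  generalize K.prod 0 1 = s, K.prod 0 2 = d₁, K.prod 1 2 = d₂, K.prod 1 3 = a, K.prod 0 4 = b,
    K.prod 2 3 = u, K.prod 2 4 = v, K.prod 3 4 = w at *
  rw [add_comm (2 * e) 1]
  have h3' : 1 + e * 2 ≠ 0 := by rwa [mul_comm]
  have h4' : 3 + e * 2 ≠ 0 := by rwa [mul_comm]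
  field_simp
  ring

/-- Where the parameter integrals converge, the sum of the diagrams is the closed form, for every
value `α` of the gauge parameter. -/
lemma oneLoop_eq (hK : K.OnShell) {T : Fin 8 → Matrix (Fin 3) (Fin 3) ℂ} (hT : IsSU3Generators T)
    (gr μ α : ℝ) (a b : Fin 8) {n : ℂ} (hn : 8 < n.re) (hn' : ∀ j : ℕ, n ≠ 2 * j) :
    oneLoop K (structureConst T) gr μ α a b n = amplitude K gr μ a b n := by
  obtain ⟨e, rfl⟩ : ∃ e : ℂ, n = 2 * (e + 2) := ⟨n / 2 - 2, by ring⟩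
  have he : 2 < e.re := by simp at hn; linarith
  have h0 : e ≠ 0 := by rintro rfl; simp at he; linarith
  have h1 : 2 * e + 1 ≠ 0 := by intro h; have := congrArg Complex.re h; simp at this; linarith
  have hs := hK.prod_ne_zero
  obtain ⟨lz, lm⟩ := longitudinal_zero hK (x := e - 1) (by simp; linarith)
  have hlong : ∀ z : ℂ, triangleIntegral K (2 * (e + 2)) 1 0 0
      (C z * ((X 0 + 2 * X 1) * (X 0 + 2 * X 2) * operatorForm K)) = 0 := by
    intro z
    have hd : 2 * (e + 2) = 2 * (e - 1 + 3) := by ring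
    rw [triangleIntegral_eq K hK (x := e - 1) (R := 4) (by push_cast; ring) (by simp; linarith)
      (by rw [hd, iterate_box_C_mul, lz, mul_zero]), loopMean_C_mul, hd,
      show 2 * (e - 1) + 1 + ((1 : ℕ) : ℂ) = 2 * (e - 1) + 2 by push_cast; ring, lm]
    ring
  have hT3 : (box K (2 * (e + 2)))^[3] (triangleNumerator K (2 * (e + 2))) = 0 := by
    rw [Function.iterate_succ_apply, Function.iterate_succ_apply, Function.iterate_one,
      box_triangleNumerator hK, box_triangleNumeratorBox hK, box_C]
  have hB2 : (box K (2 * (e + 2)))^[2] (bubbleNumerator K (2 * (e + 2))) = 0 := by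
    rw [Function.iterate_succ_apply, Function.iterate_one, box_bubbleNumerator hK, box_C]
  have hpow : powI0 (-K.Qsq) e = powI0 (-K.Qsq) (e - 1) * (2 * K.prod 0 1) := by
    have := powI0_add_nat (neg_ne_zero.2 hK.Q_sq) (e - 1) 1
    rw [Nat.cast_one, sub_add_cancel, pow_one, hK.neg_Qsq] at this
    exact this
  have hG : Complex.Gamma (1 + e) = e * Complex.Gamma e := by
    rw [add_comm, Complex.Gamma_add_one e h0]
  have hG1 : Complex.Gamma (1 - e) = -e * Complex.Gamma (-e) := by
    rw [← Complex.Gamma_add_one _ (neg_ne_zero.2 h0)]; congr 1; ring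
  have hG2 : Complex.Gamma (2 * (e + 1)) = (2 * e + 1) * Complex.Gamma (2 * e + 1) := by
    rw [← Complex.Gamma_add_one _ h1]; congr 1; ring
  have hG3 : Complex.Gamma (2 * e + 1) ≠ 0 := by
    refine Complex.Gamma_ne_zero_of_re_pos ?_
    simp; linarith
  rw [oneLoop, diagramD_eq_zero _ _ _ _ _ _ hK (by linarith) hn',
    diagramE_eq_zero _ _ _ _ _ _ hK (by linarith) hn',
    diagramF_eq_zero _ _ _ _ _ _ (by linarith) hn',
    diagramB_eq _ _ _ _ _ hK (structureConst_swap) (hT.casimir a b),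
    diagramC_eq _ _ _ _ _ hK (structureConst_self) (hT.casimir a b), hlong,
    triangleIntegral_eq K hK (x := e) (R := 3) (by push_cast; ring) (by linarith)
      (by rw [iterate_box_C_mul, hT3, mul_zero]),
    bubbleIntegral_eq K hK (x := e + 1) (R := 2) (by ring) (by simp; linarith)
      (by rw [iterate_box_C_mul, hB2, mul_zero]), loopMean_C_mul, loopMean_C_mul,
    show 2 * e + 1 + ((0 : ℕ) : ℂ) = 2 * e + 1 by push_cast; ring]
  rw [amplitude, show 2 * (e + 2) / 2 - 2 = e by ring, gammaFactor,
    ← formFactorSum_eq hK (by linarith), hG, hG1, show 1 - (e + 1) = -e by ring,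
    show e + 1 - 1 = e by ring, add_comm e 1, hG, add_comm 1 e, hG2, add_comm 1 (2 * e),
    show 2 * (e + 1) = 2 * e + 2 by ring, hpow]
  generalize loopMean K _ _ _ _ _ = τ
  generalize loopMean K _ _ _ _ _ = τ'
  have hI : Complex.I ^ 2 = -1 := Complex.I_sq
  field_simp
  simp only [hI]
  ring

end Amplitude

/-! ### Second-order expansions -/

section Expansions

/-- `f e = a + b e + c e² + O(e³)` as `e → 0`, `e ≠ 0`. -/
def HasExpansion (f : ℂ → ℂ) (a b c : ℂ) : Prop :=
  (fun e => f e - (a + b * e + c * e ^ 2)) =O[𝓝[≠] 0] fun e => e ^ 3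

lemma isBigO_pow_three_mul {r : ℂ → ℂ} (hr : ContinuousAt r 0) :
    (fun e => e ^ 3 * r e) =O[𝓝[≠] 0] fun e : ℂ => e ^ 3 := by
  have h : r =O[𝓝[≠] 0] fun _ => (1 : ℂ) := (hr.tendsto.mono_left nhdsWithin_le_nhds).isBigO_one ℂ
  simpa using (isBigO_refl (fun e : ℂ => e ^ 3) (𝓝[≠] 0)).mul h

lemma HasExpansion.of_eq {f : ℂ → ℂ} {a b c : ℂ} {r : ℂ → ℂ} (hr : ContinuousAt r 0)
    (h : ∀ᶠ e in 𝓝[≠] 0, f e = a + b * e + c * e ^ 2 + e ^ 3 * r e) : HasExpansion f a b c := by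
  refine (isBigO_pow_three_mul hr).congr' ?_ EventuallyEq.rfl
  filter_upwards [h] with e he
  rw [he]; ring

lemma HasExpansion.congr {f g : ℂ → ℂ} {a b c : ℂ} (h : HasExpansion f a b c)
    (hfg : ∀ᶠ e in 𝓝[≠] 0, g e = f e) : HasExpansion g a b c := by
  refine IsBigO.congr' h ?_ EventuallyEq.rfl
  filter_upwards [hfg] with e he
  rw [he]

lemma HasExpansion.tendsto {f : ℂ → ℂ} {a b c : ℂ} (h : HasExpansion f a b c) :
    Tendsto f (𝓝[≠] 0) (𝓝 a) := by
  have h1 : Tendsto (fun e : ℂ => e ^ 3) (𝓝[≠] 0) (𝓝 0) := by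
    have : Tendsto (fun e : ℂ => e ^ 3) (𝓝 0) (𝓝 (0 ^ 3)) := (continuous_pow 3).tendsto 0
    simpa using this.mono_left nhdsWithin_le_nhds
  have h2 : Tendsto (fun e : ℂ => a + b * e + c * e ^ 2) (𝓝[≠] 0) (𝓝 a) := by
    have : Tendsto (fun e : ℂ => a + b * e + c * e ^ 2) (𝓝 0) (𝓝 (a + b * 0 + c * 0 ^ 2)) :=
      Continuous.tendsto (by fun_prop) 0
    simpa using this.mono_left nhdsWithin_le_nhds
  simpa using (h.trans_tendsto h1).add h2

lemma HasExpansion.mul {f g : ℂ → ℂ} {a b c a' b' c' : ℂ} (hf : HasExpansion f a b c)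
    (hg : HasExpansion g a' b' c') :
    HasExpansion (fun e => f e * g e) (a * a') (a * b' + b * a') (a * c' + b * b' + c * a') := by
  have hb : g =O[𝓝[≠] 0] fun _ => (1 : ℂ) := hg.tendsto.isBigO_one ℂ
  have hp : (fun e : ℂ => a + b * e + c * e ^ 2) =O[𝓝[≠] 0] fun _ => (1 : ℂ) := by
    have : Tendsto (fun e : ℂ => a + b * e + c * e ^ 2) (𝓝 0) (𝓝 (a + b * 0 + c * 0 ^ 2)) :=
      Continuous.tendsto (by fun_prop) 0
    exact (this.mono_left nhdsWithin_le_nhds).isBigO_one ℂ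
  have h1 := IsBigO.mul hf hb
  have h2 := IsBigO.mul hp hg
  have h3 := isBigO_pow_three_mul (r := fun e => b * c' + c * b' + c * c' * e) (by fun_prop)
  simp only [mul_one, one_mul] at h1 h2
  refine ((h1.add h2).add h3).congr_left fun e => ?_
  ring

lemma HasExpansion.unique {f : ℂ → ℂ} {a b c a' b' c' : ℂ} (h : HasExpansion f a b c)
    (h' : HasExpansion f a' b' c') : a = a' ∧ b = b' ∧ c = c' := by
  have ha := tendsto_nhds_unique h.tendsto h'.tendsto
  subst ha
  have key : (fun e : ℂ => (b - b') * e + (c - c') * e ^ 2) =O[𝓝[≠] 0] fun e => e ^ 3 :=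
    (h'.sub h).congr_left fun e => by ring
  have key1 : (fun e : ℂ => (b - b') + (c - c') * e) =O[𝓝[≠] 0] fun e => e ^ 2 := by
    refine (key.mul (isBigO_refl (fun e : ℂ => e⁻¹) _)).congr' ?_ ?_
    all_goals
      filter_upwards [self_mem_nhdsWithin] with e he
      have : e ≠ 0 := he
      field_simp
  have z2 : Tendsto (fun e : ℂ => e ^ 2) (𝓝[≠] 0) (𝓝 0) := by
    have : Tendsto (fun e : ℂ => e ^ 2) (𝓝 0) (𝓝 (0 ^ 2)) := (continuous_pow 2).tendsto 0
    simpa using this.mono_left nhdsWithin_le_nhds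
  have z1 : Tendsto (fun e : ℂ => e) (𝓝[≠] 0) (𝓝 0) := tendsto_id.mono_left nhdsWithin_le_nhds
  have hb : b - b' = 0 := by
    refine tendsto_nhds_unique ?_ (key1.trans_tendsto z2)
    simpa using (z1.const_mul (c - c')).const_add (b - b')
  have hc : c - c' = 0 := by
    have key2 : (fun _ : ℂ => c - c') =O[𝓝[≠] 0] fun e : ℂ => e := by
      refine (key1.mul (isBigO_refl (fun e : ℂ => e⁻¹) _)).congr' ?_ ?_
      all_goals
        filter_upwards [self_mem_nhdsWithin] with e he
        have : e ≠ 0 := he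
        first | rw [hb, zero_add] | skip
        field_simp
    exact tendsto_nhds_unique tendsto_const_nhds (key2.trans_tendsto z1)
  exact ⟨rfl, sub_eq_zero.1 hb, sub_eq_zero.1 hc⟩

lemma HasExpansion.comp_mul {f : ℂ → ℂ} {a b c : ℂ} (h : HasExpansion f a b c) {z : ℂ}
    (hz : z ≠ 0) : HasExpansion (fun e => f (z * e)) a (b * z) (c * z ^ 2) := by
  have ht : Tendsto (fun e : ℂ => z * e) (𝓝[≠] 0) (𝓝[≠] 0) := by
    refine tendsto_nhdsWithin_iff.2 ⟨?_, ?_⟩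
    · have : Tendsto (fun e : ℂ => z * e) (𝓝 0) (𝓝 (z * 0)) := Continuous.tendsto (by fun_prop) 0
      simpa using this.mono_left nhdsWithin_le_nhds
    · filter_upwards [self_mem_nhdsWithin] with e he
      exact mul_ne_zero hz he
  have h1 := (h.comp_tendsto ht).trans
    (g := fun e : ℂ => (z * e) ^ 3) (k := fun e : ℂ => e ^ 3) (by
      simp only [mul_pow]
      exact isBigO_const_mul_self _ _ _)
  refine h1.congr_left fun e => ?_
  simp only [Function.comp]
  ring

lemma hasExpansion_of_analyticAt {f : ℂ → ℂ} (hf : AnalyticAt ℂ f 0) {b : ℂ}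
    (hb : HasDerivAt f b 0) : ∃ c, HasExpansion f (f 0) b c := by
  obtain ⟨p, hp⟩ := hf
  refine ⟨p.coeff 2, ?_⟩
  have h1 := hp.isBigO_sub_partialSum_pow 3
  have h0 : p.coeff 0 = f 0 := hp.coeff_zero _
  have hb' : p.coeff 1 = b := hp.hasDerivAt.unique hb
  refine ((h1.mono nhdsWithin_le_nhds).trans (isBigO_of_le _ fun e => by simp)).congr_left
    fun e => ?_
  simp [FormalMultilinearSeries.partialSum, Finset.sum_range_succ, h0, hb']
  ring

end Expansions

section GammaExpansion

open Complex

lemma hasExpansion_sinc : HasExpansion (fun e => sin (Real.pi * e) / (Real.pi * e))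
    1 0 (-(Real.pi : ℂ) ^ 2 / 6) := by
  have hpi : (Real.pi : ℂ) ≠ 0 := by exact_mod_cast Real.pi_ne_zero
  have h1 : (fun z : ℂ => sin z - (z - z ^ 3 / 6)) =O[𝓝[≠] 0] fun z => z ^ 5 := by
    refine IsBigO.of_bound (1 / 100) ?_
    have : ∀ᶠ z : ℂ in 𝓝[≠] 0, ‖z‖ ≤ 1 :=
      nhdsWithin_le_nhds (by
      filter_upwards [Metric.closedBall_mem_nhds (0 : ℂ) one_pos] with z hz
      simpa using hz)
    filter_upwards [this] with z hz
    rw [norm_pow]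
    linarith [sin_bound hz]
  have h2 : HasExpansion (fun z => sin z / z) 1 0 (-1 / 6) := by
    have h4 : (fun z : ℂ => z ^ 4) =O[𝓝[≠] 0] fun z => z ^ 3 :=
      (isBigO_pow_three_mul (r := fun z => z) continuousAt_id).congr_left fun z => by ring
    refine ((h1.mul (isBigO_refl (fun z : ℂ => z⁻¹) _)).congr' ?_ ?_).trans h4
    all_goals
      filter_upwards [self_mem_nhdsWithin] with e he
      have : e ≠ 0 := he
      field_simp
      try ring
  have h3 := h2.comp_mul hpi
  rw [zero_mul, show -1 / 6 * (Real.pi : ℂ) ^ 2 = -(Real.pi : ℂ) ^ 2 / 6 by ring] at h3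
  exact h3

lemma analyticAt_Gamma_one : AnalyticAt ℂ Gamma 1 := by
  have h : AnalyticAt ℂ (fun s => (Gamma s)⁻¹) 1 :=
    differentiable_one_div_Gamma.analyticAt 1
  have h1 := h.inv (by simp)
  rwa [show (fun s => (Gamma s)⁻¹)⁻¹ = Gamma by ext s; simp] at h1

/-- The second-order coefficient follows from the reflection formula. -/
lemma hasExpansion_Gamma : HasExpansion (fun e => Gamma (1 + e))
    1 (-(Real.eulerMascheroniConstant : ℂ))
    (((Real.eulerMascheroniConstant : ℂ) ^ 2 + (Real.pi : ℂ) ^ 2 / 6) / 2) := by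
  have hpi : (Real.pi : ℂ) ≠ 0 := by exact_mod_cast Real.pi_ne_zero
  have hd : HasDerivAt (fun e => Gamma (1 + e)) (-(Real.eulerMascheroniConstant : ℂ)) 0 := by
    have h1 : HasDerivAt Gamma (-(Real.eulerMascheroniConstant : ℂ)) (1 + 0) := by
      simpa using hasDerivAt_Gamma_one
    exact h1.comp_const_add 1 0
  have ha : AnalyticAt ℂ (fun e => Gamma (1 + e)) 0 := by
    have h1 : AnalyticAt ℂ Gamma (1 + 0) := by simpa using analyticAt_Gamma_one
    exact h1.comp (f := fun e : ℂ => 1 + e) (by fun_prop)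
  obtain ⟨c, hc⟩ := hasExpansion_of_analyticAt ha hd
  simp only [add_zero, Gamma_one] at hc
  have h1 := (hasExpansion_sinc.mul hc).mul (hc.comp_mul (neg_ne_zero.2 one_ne_zero))
  have h2 : HasExpansion (fun e => sin (Real.pi * e) / (Real.pi * e) * Gamma (1 + e)
      * Gamma (1 + -1 * e)) 1 0 0 := by
    refine HasExpansion.of_eq (r := fun _ => 0) continuousAt_const ?_
    have hs : ∀ᶠ e : ℂ in 𝓝[≠] 0, sin (Real.pi * e) / (Real.pi * e) ≠ 0 :=
      hasExpansion_sinc.tendsto.eventually_ne one_ne_zero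
    filter_upwards [self_mem_nhdsWithin, hs] with e he hs
    have he' : e ≠ 0 := he
    have hs' : sin (Real.pi * e) ≠ 0 := fun h => hs (by rw [h, zero_div])
    rw [show 1 + -1 * e = 1 - e by ring, add_comm 1 e, Gamma_add_one e he', mul_assoc, mul_assoc,
      Gamma_mul_Gamma_one_sub]
    field_simp
    ring
  obtain ⟨-, -, h3⟩ := h1.unique h2
  have : c = ((Real.eulerMascheroniConstant : ℂ) ^ 2 + (Real.pi : ℂ) ^ 2 / 6) / 2 := by
    linear_combination h3 / 2
  rwa [← this]

lemma analyticAt_gammaFactor : AnalyticAt ℂ gammaFactor 0 := by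
  have h : ∀ z : ℂ, AnalyticAt ℂ (fun e => Gamma (1 + z * e)) 0 := fun z => by
    have h1 : AnalyticAt ℂ Gamma (1 + z * 0) := by simpa using analyticAt_Gamma_one
    exact h1.comp (f := fun e : ℂ => 1 + z * e) (by fun_prop)
  have h1 := ((h (-1)).mul ((h 1).pow 2)).div (h 2) (by simp)
  refine h1.congr (Eventually.of_forall fun e => ?_)
  simp [gammaFactor, sub_eq_add_neg]

lemma hasExpansion_gammaFactor : HasExpansion gammaFactor 1 (Real.eulerMascheroniConstant : ℂ)
    ((Real.eulerMascheroniConstant : ℂ) ^ 2 / 2 - (Real.pi : ℂ) ^ 2 / 12) := by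
  obtain ⟨c, hc⟩ := hasExpansion_of_analyticAt analyticAt_gammaFactor
    analyticAt_gammaFactor.differentiableAt.hasDerivAt
  have h1 := hc.mul (hasExpansion_Gamma.comp_mul two_ne_zero)
  have h2 := (hasExpansion_Gamma.comp_mul (neg_ne_zero.2 one_ne_zero)).mul
    (hasExpansion_Gamma.mul hasExpansion_Gamma)
  have h3 := HasExpansion.congr (g := fun e => gammaFactor e * Gamma (1 + 2 * e)) h2 (by
    have hs : ∀ᶠ e : ℂ in 𝓝[≠] 0, Gamma (1 + 2 * e) ≠ 0 :=
      (hasExpansion_Gamma.comp_mul two_ne_zero).tendsto.eventually_ne one_ne_zero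
    filter_upwards [hs] with e he
    rw [gammaFactor, div_mul_cancel₀ _ he]
    ring_nf)
  obtain ⟨e0, e1, e2⟩ := h1.unique h3
  have f0 : gammaFactor 0 = 1 := by simp [gammaFactor]
  rw [f0] at hc e1 e2
  have f1 : deriv gammaFactor 0 = (Real.eulerMascheroniConstant : ℂ) := by linear_combination e1
  rw [f1] at hc e2
  have : c = (Real.eulerMascheroniConstant : ℂ) ^ 2 / 2 - (Real.pi : ℂ) ^ 2 / 12 := by
    linear_combination e2
  rwa [← this]

end GammaExpansion

/-! ### Meromorphic continuation -/

section Continuation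

variable {K : Kinematics d}

lemma differentiable_powI0 {m : ℝ} (hm : m ≠ 0) : Differentiable ℂ (powI0 m) := by
  have hc : ∀ t : ℝ, t ≠ 0 → Differentiable ℂ fun w : ℂ => (t : ℂ) ^ w := fun t ht =>
    differentiable_id.const_cpow (Or.inl (by exact_mod_cast ht))
  by_cases h : 0 ≤ m
  · have : powI0 m = fun w => (m : ℂ) ^ w := by ext w; simp [powI0, h]
    rw [this]; exact hc m hm
  · have : powI0 m = fun w => ((-m : ℝ) : ℂ) ^ w * Complex.exp (-(Real.pi * Complex.I * w)) := by
      ext w; simp [powI0, h]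
    rw [this]
    exact (hc (-m) (neg_ne_zero.2 hm)).mul (by fun_prop)

lemma meromorphic_gammaFactor : Meromorphic gammaFactor := by
  have h : ∀ z : ℂ, Meromorphic fun e : ℂ => Complex.Gamma (1 + z * e) := fun z x => by
    have h1 : MeromorphicAt Complex.Gamma (1 + z * x) := Meromorphic.Gamma _
    exact h1.comp_analyticAt (f := Complex.Gamma) (g := fun e : ℂ => 1 + z * e) (by fun_prop)
  intro x
  have h1 := ((h (-1) x).mul ((h 1 x).pow 2)).div (h 2 x)
  refine h1.congr (Eventually.of_forall fun e => ?_)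
  simp [gammaFactor, sub_eq_add_neg]

lemma meromorphic_formFactorSum : Meromorphic (formFactorSum K) := by
  intro x
  unfold formFactorSum formCoeff
  simp only [Matrix.cons_val]
  fun_prop

lemma meromorphic_amplitude (hK : K.OnShell) (gr : ℝ) {μ : ℝ} (hμ : 0 < μ) (a b : Fin 8) :
    Meromorphic (amplitude K gr μ a b) := by
  intro x
  have hlin : AnalyticAt ℂ (fun n : ℂ => n / 2 - 2) x := by fun_prop
  have h1 : MeromorphicAt (fun n : ℂ => gammaFactor (n / 2 - 2)) x :=
    (meromorphic_gammaFactor _).comp_analyticAt hlin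
  have h2 : MeromorphicAt (fun n : ℂ => formFactorSum K (n / 2 - 2)) x :=
    (meromorphic_formFactorSum _).comp_analyticAt hlin
  have h3 : MeromorphicAt (fun n : ℂ => powI0 (-K.Qsq) (n / 2 - 2)) x :=
    (((differentiable_powI0 (neg_ne_zero.2 hK.Q_sq)).comp
      (by fun_prop : Differentiable ℂ fun n : ℂ => n / 2 - 2)).analyticAt x).meromorphicAt
  have h4 : MeromorphicAt (fun n : ℂ => ((4 * Real.pi : ℝ) : ℂ) ^ (-(n / 2))) x := by
    have : Differentiable ℂ fun n : ℂ => ((4 * Real.pi : ℝ) : ℂ) ^ (-(n / 2)) :=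
      (by fun_prop : Differentiable ℂ fun n : ℂ => -(n / 2)).const_cpow
        (Or.inl (by exact_mod_cast (by positivity : 4 * Real.pi ≠ 0)))
    exact (this.analyticAt x).meromorphicAt
  have h5 : MeromorphicAt (fun n : ℂ => coupling gr μ n) x := by
    have : Differentiable ℂ fun n : ℂ => (gr : ℂ) * (μ : ℂ) ^ ((4 - n) / 2) :=
      ((by fun_prop : Differentiable ℂ fun n : ℂ => (4 - n) / 2).const_cpow
        (Or.inl (by exact_mod_cast hμ.ne'))).const_mul _
    exact (this.analyticAt x).meromorphicAt
  exact (((((MeromorphicAt.const (3 * kron a b) x).mul (h5.pow 2)).mul h4).mul h3).mul h1).mul h2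

end Continuation

/-! ### The expansion in `ε` -/

section Asymptotics

variable {K : Kinematics d}

lemma loopFactor_eq (hK : K.OnShell) (gr : ℝ) {μ ε : ℝ} (hμ : 0 < μ) (hε : 0 < ε) :
    3 * coupling gr μ (4 + ε) ^ 2 * ((4 * Real.pi : ℝ) : ℂ) ^ (-((4 + ε : ℂ) / 2))
      * powI0 (-K.Qsq) ((4 + ε : ℂ) / 2 - 2) = loopFactor K gr μ ε := by
  have e1 : (4 + ε : ℂ) / 2 - 2 = (ε / 2 : ℝ) := by push_cast; ring
  have hS : Sn (4 + ε) = (4 * Real.pi) ^ (-((4 + ε) / 2)) := by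
    have hp := Real.pi_pos
    rw [Sn, Real.rpow_neg (by positivity), div_eq_iff (by positivity)]
    rw [show (2 * Real.pi) ^ (4 + ε) = ((2 * Real.pi) ^ (2:ℝ)) ^ ((4 + ε) / 2) by
      rw [← Real.rpow_mul (by positivity)]; congr 1; ring]
    rw [show (2 * Real.pi) ^ (2:ℝ) = 4 * Real.pi * Real.pi by norm_num; ring,
      Real.mul_rpow (x := 4 * Real.pi) (by positivity) hp.le,
      inv_mul_cancel_left₀ (by positivity)]
  have h4 : ((4 * Real.pi : ℝ) : ℂ) ^ (-((4 + ε : ℂ) / 2)) = (Sn (4 + ε) : ℝ) := by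
    rw [hS, Complex.ofReal_cpow (by positivity)]; push_cast; rfl
  have hc : coupling gr μ (4 + ε) ^ 2 = (gr : ℂ) ^ 2 * ((μ ^ 2)⁻¹ : ℝ) ^ ((ε / 2 : ℝ) : ℂ) := by
    rw [coupling, mul_pow, ← Complex.ofReal_cpow (by positivity)]
    rw [show ((4 : ℂ) - (4 + ε)) / 2 = ((-(ε / 2) : ℝ) : ℂ) by push_cast; ring,
      ← Complex.ofReal_cpow hμ.le]
    have h1 : (μ ^ (-(ε / 2))) ^ 2 = (μ ^ 2)⁻¹ ^ (ε / 2) := by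
      rw [← Real.rpow_natCast (μ ^ _), ← Real.rpow_mul hμ.le, ← Real.rpow_natCast μ,
        ← Real.rpow_neg hμ.le, ← Real.rpow_mul hμ.le]
      congr 1; push_cast; ring
    rw [← h1, Complex.ofReal_pow]
  have hm : -K.Qsq / μ ^ 2 = (μ ^ 2)⁻¹ * -K.Qsq := by ring
  rw [loopFactor, h4, hc, e1, hm, show (ε / 2 : ℂ) = ((ε / 2 : ℝ) : ℂ) by push_cast; ring,
    powI0_mul (by positivity) (neg_ne_zero.2 hK.Q_sq) (by simpa using hε), CA]
  push_cast
  ring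

lemma loopFactor_isBigO (hK : K.OnShell) (gr : ℝ) {μ : ℝ} (hμ : 0 < μ) :
    loopFactor K gr μ =O[𝓝[>] 0] fun _ => (1 : ℝ) := by
  have hm : -K.Qsq / μ ^ 2 ≠ 0 := div_ne_zero (neg_ne_zero.2 hK.Q_sq) (by positivity)
  have hc : ContinuousAt (loopFactor K gr μ) 0 := by
    have h1 : Continuous fun ε : ℝ => powI0 (-K.Qsq / μ ^ 2) (ε / 2) :=
      (differentiable_powI0 hm).continuous.comp (by fun_prop)
    have hp := Real.pi_pos
    have h2 : Continuous fun ε : ℝ => Sn (4 + ε) := by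
      unfold Sn
      refine Continuous.div ?_ ?_ fun ε => by positivity
      · exact Continuous.rpow continuous_const (by fun_prop) fun _ => Or.inl hp.ne'
      · exact Continuous.rpow continuous_const (by fun_prop) fun _ => Or.inl (by positivity)
    unfold loopFactor
    exact ((Complex.continuous_ofReal.comp (h2.const_mul (gr ^ 2 * CA))).mul h1).continuousAt
  exact (hc.tendsto.mono_left nhdsWithin_le_nhds).isBigO_one ℝ

lemma hasExpansion_formCoeff : HasExpansion (fun e => e ^ 2 * formCoeff e 0)
    (-2) (11 / 3) (-(203 / 18)) := by
  refine HasExpansion.of_eq (r := fun e => (2873 + 5785 * e + 3796 * e ^ 2 + 812 * e ^ 3)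
    / (18 * ((1 + e) * (1 + 2 * e) * (3 + 2 * e) * (2 + e)))) ?_ ?_
  · exact ContinuousAt.div (by fun_prop) (by fun_prop) (by norm_num)
  · have hne : ∀ᶠ e : ℂ in 𝓝[≠] 0, (1 + e) * (1 + 2 * e) * (3 + 2 * e) * (2 + e) ≠ 0 := by
      have : ContinuousAt (fun e : ℂ => (1 + e) * (1 + 2 * e) * (3 + 2 * e) * (2 + e)) 0 := by
        fun_prop
      exact nhdsWithin_le_nhds (this.eventually_ne (by norm_num))
    filter_upwards [hne, self_mem_nhdsWithin] with e he he0
    have he0' : e ≠ 0 := he0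
    simp only [ne_eq, mul_eq_zero, not_or] at he
    obtain ⟨⟨⟨h1, h2⟩, h3⟩, h4⟩ := he
    have h2' : 1 + e * 2 ≠ 0 := by rwa [mul_comm]
    have h3' : 3 + e * 2 ≠ 0 := by rwa [mul_comm]
    simp only [formCoeff, Matrix.cons_val]
    field_simp
    ring

/-- The terms of the expansion in `e = ε / 2` that do not vanish with `ε`. -/
lemma gammaFactor_mul_formCoeff_zero :
    (fun e => gammaFactor e * formCoeff e 0 - (-2 / e ^ 2
      + (-2 * Real.eulerMascheroniConstant + 11 / 3) / e + h 2)) =O[𝓝[≠] 0] fun e : ℂ => e := by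
  have h1 := hasExpansion_gammaFactor.mul hasExpansion_formCoeff
  refine (IsBigO.mul h1 (isBigO_refl (fun e : ℂ => (e ^ 2)⁻¹) _)).congr' ?_ ?_
  · filter_upwards [self_mem_nhdsWithin] with e he
    have he' : e ≠ 0 := he
    have hh : (h 2 : ℂ) = -(Real.eulerMascheroniConstant : ℂ) ^ 2
        + 11 / 3 * Real.eulerMascheroniConstant + (Real.pi : ℂ) ^ 2 / 6 - 203 / 18 := by
      have : h 2 = -Real.eulerMascheroniConstant ^ 2
        + 11 / 3 * Real.eulerMascheroniConstant + Real.pi ^ 2 / 6 - 203 / 18 := by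
        simp [h, gammagg, STilde]
        ring
      rw [this]; push_cast; ring
    rw [hh]
    field_simp
    ring
  · filter_upwards [self_mem_nhdsWithin] with e he
    have he' : e ≠ 0 := he
    field_simp

lemma gammaFactor_mul_formCoeff_one :
    (fun e => gammaFactor e * formCoeff e 1 - 2 / 3) =O[𝓝[≠] 0] fun e : ℂ => e := by
  have hd : DifferentiableAt ℂ (fun e => gammaFactor e * formCoeff e 1) 0 := by
    refine analyticAt_gammaFactor.differentiableAt.mul ?_
    simp only [formCoeff, Matrix.cons_val]
    exact DifferentiableAt.div (by fun_prop) (by fun_prop) (by norm_num)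
  have h1 := hd.isBigO_sub.mono (nhdsWithin_le_nhds (s := {0}ᶜ))
  simpa [gammaFactor, formCoeff] using h1

lemma gammaFactor_mul_formCoeff_two :
    (fun e => gammaFactor e * formCoeff e 2 - -1) =O[𝓝[≠] 0] fun e : ℂ => e := by
  have hd : DifferentiableAt ℂ (fun e => gammaFactor e * formCoeff e 2) 0 := by
    refine analyticAt_gammaFactor.differentiableAt.mul ?_
    simp only [formCoeff, Matrix.cons_val]
    exact DifferentiableAt.div (by fun_prop) (by fun_prop) (by norm_num)
  have h1 := hd.isBigO_sub.mono (nhdsWithin_le_nhds (s := {0}ᶜ))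
  have h2 : gammaFactor 0 * formCoeff 0 2 = -1 := by
    simp [gammaFactor, formCoeff]; norm_num
  simpa only [h2, sub_zero] using h1

lemma amplitude_asymptotics (hK : K.OnShell) (gr : ℝ) {μ : ℝ} (hμ : 0 < μ) (a b : Fin 8) :
    (fun ε : ℝ => (born K a b + amplitude K gr μ a b (4 + ε)) - closedForm K gr μ a b ε)
      =O[𝓝[>] 0] fun ε : ℝ => ε := by
  have ht : Tendsto (fun ε : ℝ => (ε / 2 : ℂ)) (𝓝[>] 0) (𝓝[≠] 0) := by
    refine tendsto_nhdsWithin_iff.2 ⟨?_, ?_⟩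
    · have : Tendsto (fun ε : ℝ => (ε / 2 : ℂ)) (𝓝 0) (𝓝 (((0 : ℝ) : ℂ) / 2)) :=
        Continuous.tendsto (by fun_prop) 0
      simpa using this.mono_left nhdsWithin_le_nhds
    · filter_upwards [self_mem_nhdsWithin] with ε hε
      have : (ε : ℂ) ≠ 0 := by exact_mod_cast (ne_of_gt hε)
      simpa using this
  have h0 := (gammaFactor_mul_formCoeff_zero.const_mul_left (bornFactor K)).add
    ((gammaFactor_mul_formCoeff_one.const_mul_left
      (transverse K * (K.prod 0 2 ^ 2 + K.prod 1 2 ^ 2))).add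
    (gammaFactor_mul_formCoeff_two.const_mul_left (transverse K * (K.prod 0 2 * K.prod 1 2))))
  have h1 := ((h0.comp_tendsto ht).const_mul_left (kron a b)).trans
    (k := fun ε : ℝ => ε) (IsBigO.of_bound 1 (by
      filter_upwards with ε
      simp only [Function.comp, norm_div, Complex.norm_real, Complex.norm_ofNat]
      linarith [norm_nonneg ε]))
  have h2 := (loopFactor_isBigO hK gr hμ).mul h1
  simp only [one_mul] at h2
  refine h2.congr' ?_ EventuallyEq.rfl
  filter_upwards [self_mem_nhdsWithin] with ε hε
  have hε0 : (ε : ℂ) ≠ 0 := by exact_mod_cast (ne_of_gt hε)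
  have hA : amplitude K gr μ a b (4 + ε) = kron a b * loopFactor K gr μ ε
      * (gammaFactor (ε / 2) * formFactorSum K (ε / 2)) := by
    rw [← loopFactor_eq hK gr hμ hε, amplitude, show ((4 : ℂ) + ε) / 2 - 2 = ε / 2 by ring]
    ring
  rw [hA, closedForm, born_eq, newFormFactor_eq, formFactorSum]
  simp only [Function.comp]
  push_cast
  field_simp
  ring

end Asymptotics

end GluonOneLoop

end

theorem mainTheorem2 {d : ℕ} (T : Fin 8 → Matrix (Fin 3) (Fin 3) ℂ) (hT : IsSU3Generators T)
    (K : Kinematics d) (hK : K.OnShell) (gr μ : ℝ) (hμ : 0 < μ) :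
    ∃ A : Fin 8 → Fin 8 → ℂ → ℂ,
      (∀ (αr : ℝ) (a b : Fin 8),
        IsDimContinuation (A a b) (oneLoop K (structureConst T) gr μ αr a b)) ∧
      ∀ a b : Fin 8,
        (fun ε : ℝ => (born K a b + A a b (4 + ε)) - closedForm K gr μ a b ε)
          =O[𝓝[>] 0] fun ε : ℝ => ε :=
  ⟨amplitude K gr μ, fun α a b => ⟨fun n _ => meromorphic_amplitude hK gr hμ a b n,
    fun _ hn hn' => (oneLoop_eq hK hT gr μ α a b hn hn').symm⟩,
    fun a b => amplitude_asymptotics hK gr hμ a b⟩
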